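/- **Conventions.** A pseudo double category $\mathbb D$ has a category $\mathbb D_0$ of objects and arrows, a category $\mathbb D_1$ of proarrows $m\colon A\nrightarrow B$ and cells, source and target functors $\mathbb D_1\rightrightarrows\mathbb D_0$, an external unit functor $y\colon\mathbb D_0\to\mathbb D_1$ and an external composition $\otimes$ (written in diagrammatic order), associative and unital up to coherent invertible globular cells. Let $\mathbf{Dbl}$ be the 2-category of pseudo double categories, pseudo double functors and (vertical) transformations; *equivalent* means equivalent in $\mathbf{Dbl}$. A cell is *cartesian* (a *restriction*), resp. *opcartesian* (an *extension*), if it is a cartesian, resp. opcartesian, arrow for $\langle\mathrm{src},\mathrm{tgt}\rangle\colon\mathbb D_1\to\mathbb D_0\times\mathbb D_0$. Let $\mathcal F=(\mathcal E,\mathcal M)$ be an orthogonal factorization system on a finitely complete category $\mathscr C$ (both classes contain the isomorphisms and are closed under composition). It is *proper* if $\mathcal E$ consists of epimorphisms and $\mathcal M$ of monomorphisms, and *stable* if $\mathcal E$ is stable under pullback. For $\mathcal F$ proper and stable, $\mathbb R\mathbf{el}(\mathscr C;\mathcal F)$ is the double category with the objects and arrows of $\mathscr C$, whose proarrows $A\nrightarrow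 B$ are the spans $A\leftarrow R\to B$ with $R\to A\times B$ in $\mathcal M$, whose cells are the morphisms of spans, whose external units are the diagonals, and in which the composite of $R\colon A\nrightarrow B$ and $S\colon B\nrightarrow C$ is the $\mathcal F$-image of $R\times_BS\to A\times C$. An arrow $f\colon A\to B$ of $\mathbb D$ may have a companion $f_!\colon A\nrightarrow B$ and a conjoint $f^*\colon B\nrightarrow A$; $\mathbb D$ is an *equipment* if all arrows have both, *unit-pure* if $y$ is full, and *cartesian* if $\mathbb D\to\mathbb D\times\mathbb D$ and $\mathbb D\to\mathbf 1$ have right adjoints in $\mathbf{Dbl}$. An arrow $e$ is a *cover* if the cell $y_e$ is opcartesian (its cokernel is trivial), and an arrow $m$ is an *inclusion* if $y_m$ is cartesian (its kernel is trivial). Write $\mathcal M_{\mathbb D}$ for the class of inclusions that are orthogonal to all covers. A *relation* in $\mathbb D$ is a span $A\xleftarrow{d}R\xrightarrow{c}B$ of arrows with $\langle d,c\rangle\colon R\to A\times B$ in $\mathcal M_{\mathbb D}$; its *cokernel* is the extension $y_R\Rightarrow d^*\otimes c_!$ of $y_R$ along $d$ and $c$. A *tabulator* of $m\colon A\nrightarrow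 B$ is an object $\top m$ with a cell $\tau\colon y_{\top m}\Rightarrow m$ that is universal among cells $y_X\Rightarrow m$; let $l,r$ be the source and target of $\tau$. Tabulators are *strong* if each $\tau$ is opcartesian (so $m\cong l^*\otimes r_!$), *discrete* if each $\langle l,r\rangle\colon\top m\to A\times B$ is an inclusion, and *(externally) functorial* if, for composable $p\colon A\nrightarrow B$ and $q\colon B\nrightarrow C$, whenever $\top p\times_B\top q\to I\to A\times C$ is a factorization into a cover and an arrow of $\mathcal M_{\mathbb D}$, the induced arrow $I\to\top(p\otimes q)$ exists and is invertible. The *local product* $m\wedge n$ is the product in the category of proarrows $A\nrightarrow B$ and globular cells. **Theorem.** Let $\mathbb D$ be a pseudo double category in which every invertible arrow has a companion. Then $\mathbb D$ is equivalent to $\mathbb R\mathbf{el}(\mathscr C;\mathcal F)$ for some proper and stable factorization system $\mathcal F$ on a finitely complete category $\mathscr C$ if and only if 1. $\mathbb D$ is a unit-pure cartesian equipment; 2. $\mathbb D$ has tabulators, and they are strong, discrete and (externally) functorial; 3. every relation in $\mathbb D$ is the tabulator of its cokernel; 4. local products satisfy the Frobenius law: for all $f\colon A\to B$, $r\colon B\nrightarrow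 X$ and $q\colon A\nrightarrow X$, $$r\wedge (f^*\otimes q)\;\cong\; f^*\otimes\bigl((f_!\otimes r)\wedge q\bigr).$$ -/

import Mathlib

open CategoryTheory CategoryTheory.Limits

set_option linter.checkUnivs false

universe u v w z u₁ v₁ w₁ z₁ u₂ v₂ w₂ z₂ u₃ v₃ w₃ z₃

/-- A pseudo double category. Arrows between objects form the category `Obj`; proarrows `Pro A B`
are the objects, and cells the morphisms, of a second category, with source and target functors
`src`, `tgt`, an external unit functor `unit`, `unitMap` and an external composition
`comp`, `hcomp`, the latter defined on pairs of cells with matching target and source.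
External composition is written in diagrammatic order and is associative and unital up to coherent
invertible globular cells. -/
structure PseudoDoubleCategory where
  Obj : Type u
  [category : Category.{v} Obj]
  Pro : Obj → Obj → Type w
  Cell : ∀ {A B C D : Obj}, Pro A B → Pro C D → Type z
  src : ∀ {A B C D : Obj} {m : Pro A B} {n : Pro C D}, Cell m n → (A ⟶ C)
  tgt : ∀ {A B C D : Obj} {m : Pro A B} {n : Pro C D}, Cell m n → (B ⟶ D)
  -- the category of proarrows and cells, and the functors `src` and `tgt`
  cid : ∀ {A B : Obj} (m : Pro A B), Cell m m
  vcomp : ∀ {A B C D E F : Obj} {m : Pro A B} {n : Pro C D} {p : Pro E F},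
    Cell m n → Cell n p → Cell m p
  src_cid : ∀ {A B : Obj} (m : Pro A B), src (cid m) = 𝟙 A
  tgt_cid : ∀ {A B : Obj} (m : Pro A B), tgt (cid m) = 𝟙 B
  src_vcomp : ∀ {A B C D E F : Obj} {m : Pro A B} {n : Pro C D} {p : Pro E F}
    (α : Cell m n) (β : Cell n p), src (vcomp α β) = src α ≫ src β
  tgt_vcomp : ∀ {A B C D E F : Obj} {m : Pro A B} {n : Pro C D} {p : Pro E F}
    (α : Cell m n) (β : Cell n p), tgt (vcomp α β) = tgt α ≫ tgt β
  cid_vcomp : ∀ {A B C D : Obj} {m : Pro A B} {n : Pro C D} (α : Cell m n),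
    vcomp (cid m) α = α
  vcomp_cid : ∀ {A B C D : Obj} {m : Pro A B} {n : Pro C D} (α : Cell m n),
    vcomp α (cid n) = α
  vcomp_assoc : ∀ {A B C D E F G H : Obj} {m : Pro A B} {n : Pro C D} {p : Pro E F} {q : Pro G H}
    (α : Cell m n) (β : Cell n p) (γ : Cell p q),
    vcomp (vcomp α β) γ = vcomp α (vcomp β γ)
  -- the external unit functor
  unit : ∀ A : Obj, Pro A A
  unitMap : ∀ {A B : Obj}, (A ⟶ B) → Cell (unit A) (unit B)
  src_unitMap : ∀ {A B : Obj} (f : A ⟶ B), src (unitMap f) = f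
  tgt_unitMap : ∀ {A B : Obj} (f : A ⟶ B), tgt (unitMap f) = f
  unitMap_id : ∀ A : Obj, unitMap (𝟙 A) = cid (unit A)
  unitMap_comp : ∀ {A B C : Obj} (f : A ⟶ B) (g : B ⟶ C),
    unitMap (f ≫ g) = vcomp (unitMap f) (unitMap g)
  -- the external composition functor
  comp : ∀ {A B C : Obj}, Pro A B → Pro B C → Pro A C
  hcomp : ∀ {A B C A' B' C' : Obj} {m : Pro A B} {n : Pro B C} {m' : Pro A' B'} {n' : Pro B' C'}
    (α : Cell m m') (β : Cell n n'), tgt α = src β → Cell (comp m n) (comp m' n')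
  src_hcomp : ∀ {A B C A' B' C' : Obj} {m : Pro A B} {n : Pro B C} {m' : Pro A' B'}
    {n' : Pro B' C'} (α : Cell m m') (β : Cell n n') (h : tgt α = src β),
    src (hcomp α β h) = src α
  tgt_hcomp : ∀ {A B C A' B' C' : Obj} {m : Pro A B} {n : Pro B C} {m' : Pro A' B'}
    {n' : Pro B' C'} (α : Cell m m') (β : Cell n n') (h : tgt α = src β),
    tgt (hcomp α β h) = tgt β
  hcomp_cid : ∀ {A B C : Obj} (m : Pro A B) (n : Pro B C),
    hcomp (cid m) (cid n) ((tgt_cid m).trans (src_cid n).symm) = cid (comp m n)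
  interchange : ∀ {A B C A' B' C' A'' B'' C'' : Obj} {m : Pro A B} {n : Pro B C} {m' : Pro A' B'}
    {n' : Pro B' C'} {m'' : Pro A'' B''} {n'' : Pro B'' C''}
    (α : Cell m m') (β : Cell n n') (h : tgt α = src β)
    (α' : Cell m' m'') (β' : Cell n' n'') (h' : tgt α' = src β'),
    hcomp (vcomp α α') (vcomp β β') (by rw [tgt_vcomp, src_vcomp, h, h']) =
      vcomp (hcomp α β h) (hcomp α' β' h')
  -- the associator
  assocHom : ∀ {A B C D : Obj} (m : Pro A B) (n : Pro B C) (p : Pro C D),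
    Cell (comp (comp m n) p) (comp m (comp n p))
  assocInv : ∀ {A B C D : Obj} (m : Pro A B) (n : Pro B C) (p : Pro C D),
    Cell (comp m (comp n p)) (comp (comp m n) p)
  src_assocHom : ∀ {A B C D : Obj} (m : Pro A B) (n : Pro B C) (p : Pro C D),
    src (assocHom m n p) = 𝟙 A
  tgt_assocHom : ∀ {A B C D : Obj} (m : Pro A B) (n : Pro B C) (p : Pro C D),
    tgt (assocHom m n p) = 𝟙 D
  assocHom_inv : ∀ {A B C D : Obj} (m : Pro A B) (n : Pro B C) (p : Pro C D),
    vcomp (assocHom m n p) (assocInv m n p) = cid _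
  assocInv_hom : ∀ {A B C D : Obj} (m : Pro A B) (n : Pro B C) (p : Pro C D),
    vcomp (assocInv m n p) (assocHom m n p) = cid _
  assoc_naturality : ∀ {A B C D A' B' C' D' : Obj} {m : Pro A B} {n : Pro B C} {p : Pro C D}
    {m' : Pro A' B'} {n' : Pro B' C'} {p' : Pro C' D'}
    (α : Cell m m') (β : Cell n n') (γ : Cell p p') (h : tgt α = src β) (h' : tgt β = src γ),
    vcomp (hcomp (hcomp α β h) γ ((tgt_hcomp α β h).trans h')) (assocHom m' n' p') =
      vcomp (assocHom m n p) (hcomp α (hcomp β γ h') (h.trans (src_hcomp β γ h').symm))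
  -- the unitors
  leftHom : ∀ {A B : Obj} (m : Pro A B), Cell (comp (unit A) m) m
  leftInv : ∀ {A B : Obj} (m : Pro A B), Cell m (comp (unit A) m)
  src_leftHom : ∀ {A B : Obj} (m : Pro A B), src (leftHom m) = 𝟙 A
  tgt_leftHom : ∀ {A B : Obj} (m : Pro A B), tgt (leftHom m) = 𝟙 B
  leftHom_inv : ∀ {A B : Obj} (m : Pro A B), vcomp (leftHom m) (leftInv m) = cid _
  leftInv_hom : ∀ {A B : Obj} (m : Pro A B), vcomp (leftInv m) (leftHom m) = cid _
  left_naturality : ∀ {A B A' B' : Obj} {m : Pro A B} {m' : Pro A' B'} (α : Cell m m'),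
    vcomp (hcomp (unitMap (src α)) α (tgt_unitMap _)) (leftHom m') = vcomp (leftHom m) α
  rightHom : ∀ {A B : Obj} (m : Pro A B), Cell (comp m (unit B)) m
  rightInv : ∀ {A B : Obj} (m : Pro A B), Cell m (comp m (unit B))
  src_rightHom : ∀ {A B : Obj} (m : Pro A B), src (rightHom m) = 𝟙 A
  tgt_rightHom : ∀ {A B : Obj} (m : Pro A B), tgt (rightHom m) = 𝟙 B
  rightHom_inv : ∀ {A B : Obj} (m : Pro A B), vcomp (rightHom m) (rightInv m) = cid _
  rightInv_hom : ∀ {A B : Obj} (m : Pro A B), vcomp (rightInv m) (rightHom m) = cid _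
  right_naturality : ∀ {A B A' B' : Obj} {m : Pro A B} {m' : Pro A' B'} (α : Cell m m'),
    vcomp (hcomp α (unitMap (tgt α)) (src_unitMap _).symm) (rightHom m') = vcomp (rightHom m) α
  -- coherence
  pentagon : ∀ {A B C D E : Obj} (m : Pro A B) (n : Pro B C) (p : Pro C D) (q : Pro D E),
    vcomp (hcomp (assocHom m n p) (cid q) ((tgt_assocHom m n p).trans (src_cid q).symm))
      (vcomp (assocHom m (comp n p) q)
        (hcomp (cid m) (assocHom n p q) ((tgt_cid m).trans (src_assocHom n p q).symm))) =
      vcomp (assocHom (comp m n) p q) (assocHom m n (comp p q))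
  triangle : ∀ {A B C : Obj} (m : Pro A B) (n : Pro B C),
    vcomp (assocHom m (unit B) n)
      (hcomp (cid m) (leftHom n) ((tgt_cid m).trans (src_leftHom n).symm)) =
      hcomp (rightHom m) (cid n) ((tgt_rightHom m).trans (src_cid n).symm)

namespace PseudoDoubleCategory

attribute [instance] PseudoDoubleCategory.category

attribute [simp] src_cid tgt_cid src_vcomp tgt_vcomp cid_vcomp vcomp_cid src_unitMap tgt_unitMap
  unitMap_id src_hcomp tgt_hcomp hcomp_cid src_assocHom tgt_assocHom src_leftHom tgt_leftHom
  src_rightHom tgt_rightHom assocHom_inv assocInv_hom leftHom_inv leftInv_hom rightHom_inv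
  rightInv_hom

end PseudoDoubleCategory

/-! ### Double functors, transformations, adjunctions and equivalences -/

/-- A (pseudo) double functor. -/
structure DoubleFunctor (D : PseudoDoubleCategory.{u₁, v₁, w₁, z₁})
    (E : PseudoDoubleCategory.{u₂, v₂, w₂, z₂}) where
  fnc : D.Obj ⥤ E.Obj
  pro : ∀ {A B : D.Obj}, D.Pro A B → E.Pro (fnc.obj A) (fnc.obj B)
  cell : ∀ {A B A' B' : D.Obj} {m : D.Pro A B} {n : D.Pro A' B'},
    D.Cell m n → E.Cell (pro m) (pro n)
  src_cell : ∀ {A B A' B' : D.Obj} {m : D.Pro A B} {n : D.Pro A' B'} (α : D.Cell m n),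
    E.src (cell α) = fnc.map (D.src α)
  tgt_cell : ∀ {A B A' B' : D.Obj} {m : D.Pro A B} {n : D.Pro A' B'} (α : D.Cell m n),
    E.tgt (cell α) = fnc.map (D.tgt α)
  cell_cid : ∀ {A B : D.Obj} (m : D.Pro A B), cell (D.cid m) = E.cid (pro m)
  cell_vcomp : ∀ {A B A' B' A'' B'' : D.Obj} {m : D.Pro A B} {n : D.Pro A' B'}
    {p : D.Pro A'' B''} (α : D.Cell m n) (β : D.Cell n p),
    cell (D.vcomp α β) = E.vcomp (cell α) (cell β)
  -- comparison of external units
  unitHom : ∀ A : D.Obj, E.Cell (E.unit (fnc.obj A)) (pro (D.unit A))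
  unitInv : ∀ A : D.Obj, E.Cell (pro (D.unit A)) (E.unit (fnc.obj A))
  src_unitHom : ∀ A : D.Obj, E.src (unitHom A) = 𝟙 _
  tgt_unitHom : ∀ A : D.Obj, E.tgt (unitHom A) = 𝟙 _
  unitHom_inv : ∀ A : D.Obj, E.vcomp (unitHom A) (unitInv A) = E.cid _
  unitInv_hom : ∀ A : D.Obj, E.vcomp (unitInv A) (unitHom A) = E.cid _
  unit_naturality : ∀ {A B : D.Obj} (f : A ⟶ B),
    E.vcomp (E.unitMap (fnc.map f)) (unitHom B) = E.vcomp (unitHom A) (cell (D.unitMap f))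
  -- comparison of external composites
  compHom : ∀ {A B C : D.Obj} (m : D.Pro A B) (n : D.Pro B C),
    E.Cell (E.comp (pro m) (pro n)) (pro (D.comp m n))
  compInv : ∀ {A B C : D.Obj} (m : D.Pro A B) (n : D.Pro B C),
    E.Cell (pro (D.comp m n)) (E.comp (pro m) (pro n))
  src_compHom : ∀ {A B C : D.Obj} (m : D.Pro A B) (n : D.Pro B C), E.src (compHom m n) = 𝟙 _
  tgt_compHom : ∀ {A B C : D.Obj} (m : D.Pro A B) (n : D.Pro B C), E.tgt (compHom m n) = 𝟙 _
  compHom_inv : ∀ {A B C : D.Obj} (m : D.Pro A B) (n : D.Pro B C),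
    E.vcomp (compHom m n) (compInv m n) = E.cid _
  compInv_hom : ∀ {A B C : D.Obj} (m : D.Pro A B) (n : D.Pro B C),
    E.vcomp (compInv m n) (compHom m n) = E.cid _
  comp_naturality : ∀ {A B C A' B' C' : D.Obj} {m : D.Pro A B} {n : D.Pro B C}
    {m' : D.Pro A' B'} {n' : D.Pro B' C'} (α : D.Cell m m') (β : D.Cell n n')
    (h : D.tgt α = D.src β),
    E.vcomp (E.hcomp (cell α) (cell β) (by rw [tgt_cell, src_cell, h])) (compHom m' n') =
      E.vcomp (compHom m n) (cell (D.hcomp α β h))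
  -- coherence
  map_assoc : ∀ {A B C X : D.Obj} (m : D.Pro A B) (n : D.Pro B C) (p : D.Pro C X),
    E.vcomp (E.hcomp (compHom m n) (E.cid (pro p))
        ((tgt_compHom m n).trans (E.src_cid _).symm))
      (E.vcomp (compHom (D.comp m n) p) (cell (D.assocHom m n p))) =
    E.vcomp (E.assocHom (pro m) (pro n) (pro p))
      (E.vcomp (E.hcomp (E.cid (pro m)) (compHom n p)
        ((E.tgt_cid _).trans (src_compHom n p).symm)) (compHom m (D.comp n p)))
  map_left : ∀ {A B : D.Obj} (m : D.Pro A B),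
    E.vcomp (E.hcomp (unitHom A) (E.cid (pro m)) ((tgt_unitHom A).trans (E.src_cid _).symm))
      (E.vcomp (compHom (D.unit A) m) (cell (D.leftHom m))) = E.leftHom (pro m)
  map_right : ∀ {A B : D.Obj} (m : D.Pro A B),
    E.vcomp (E.hcomp (E.cid (pro m)) (unitHom B) ((E.tgt_cid _).trans (src_unitHom B).symm))
      (E.vcomp (compHom m (D.unit B)) (cell (D.rightHom m))) = E.rightHom (pro m)

namespace DoubleFunctor

attribute [simp] src_cell tgt_cell cell_cid src_unitHom tgt_unitHom src_compHom tgt_compHom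
  unitHom_inv unitInv_hom compHom_inv compInv_hom

/-- The identity double functor. -/
abbrev id (D : PseudoDoubleCategory.{u₁, v₁, w₁, z₁}) : DoubleFunctor D D where
  fnc := 𝟭 _
  pro m := m
  cell α := α
  src_cell _ := rfl
  tgt_cell _ := rfl
  cell_cid _ := rfl
  cell_vcomp _ _ := rfl
  unitHom _ := D.cid _
  unitInv _ := D.cid _
  src_unitHom _ := D.src_cid _
  tgt_unitHom _ := D.tgt_cid _
  unitHom_inv _ := D.cid_vcomp _
  unitInv_hom _ := D.cid_vcomp _
  unit_naturality _ := (D.vcomp_cid _).trans (D.cid_vcomp _).symm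
  compHom _ _ := D.cid _
  compInv _ _ := D.cid _
  src_compHom _ _ := D.src_cid _
  tgt_compHom _ _ := D.tgt_cid _
  compHom_inv _ _ := D.cid_vcomp _
  compInv_hom _ _ := D.cid_vcomp _
  comp_naturality _ _ _ := (D.vcomp_cid _).trans (D.cid_vcomp _).symm
  map_assoc _ _ _ := by simp
  map_left _ := by simp
  map_right _ := by simp

/-- The composite of two double functors, in diagrammatic order. -/
abbrev comp {D : PseudoDoubleCategory.{u₁, v₁, w₁, z₁}} {E : PseudoDoubleCategory.{u₂, v₂, w₂, z₂}}
    {K : PseudoDoubleCategory.{u₃, v₃, w₃, z₃}} (F : DoubleFunctor D E) (G : DoubleFunctor E K) :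
    DoubleFunctor D K where
  fnc := F.fnc ⋙ G.fnc
  pro m := G.pro (F.pro m)
  cell α := G.cell (F.cell α)
  src_cell α := by simp
  tgt_cell α := by simp
  cell_cid m := by simp
  cell_vcomp α β := by rw [F.cell_vcomp, G.cell_vcomp]
  unitHom A := K.vcomp (G.unitHom _) (G.cell (F.unitHom A))
  unitInv A := K.vcomp (G.cell (F.unitInv A)) (G.unitInv _)
  src_unitHom A := by simp
  tgt_unitHom A := by simp
  unitHom_inv A := by
    rw [K.vcomp_assoc, ← K.vcomp_assoc (G.cell _), ← G.cell_vcomp]; simp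
  unitInv_hom A := by
    rw [K.vcomp_assoc, ← K.vcomp_assoc (G.unitInv _), G.unitInv_hom, K.cid_vcomp,
      ← G.cell_vcomp]; simp
  unit_naturality f := by
    have h := G.unit_naturality (F.fnc.map f)
    have h' := F.unit_naturality f
    dsimp only [Functor.comp_map, Functor.comp_obj]
    rw [← K.vcomp_assoc, h, K.vcomp_assoc, K.vcomp_assoc, ← G.cell_vcomp, ← G.cell_vcomp, h']
  compHom m n := K.vcomp (G.compHom _ _) (G.cell (F.compHom m n))
  compInv m n := K.vcomp (G.cell (F.compInv m n)) (G.compInv _ _)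
  src_compHom m n := by simp
  tgt_compHom m n := by simp
  compHom_inv m n := by
    rw [K.vcomp_assoc, ← K.vcomp_assoc (G.cell _), ← G.cell_vcomp]; simp
  compInv_hom m n := by
    rw [K.vcomp_assoc, ← K.vcomp_assoc (G.compInv _ _), G.compInv_hom, K.cid_vcomp,
      ← G.cell_vcomp]; simp
  comp_naturality α β h := by
    have e := G.comp_naturality (F.cell α) (F.cell β) (by simp [h])
    have e' := F.comp_naturality α β h
    rw [← K.vcomp_assoc, e, K.vcomp_assoc, K.vcomp_assoc, ← G.cell_vcomp, ← G.cell_vcomp, e']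
  map_assoc m n p := by
    have hG := G.map_assoc (F.pro m) (F.pro n) (F.pro p)
    have hF := congrArg G.cell (F.map_assoc m n p)
    simp only [G.cell_vcomp] at hF
    have n1 := G.comp_naturality (F.compHom m n) (E.cid (F.pro p)) (by simp)
    have n2 := G.comp_naturality (E.cid (F.pro m)) (F.compHom n p) (by simp)
    simp only [G.cell_cid] at n1 n2
    have i1 := K.interchange (G.compHom (F.pro m) (F.pro n)) (K.cid (G.pro (F.pro p)))
      (by simp) (G.cell (F.compHom m n)) (K.cid (G.pro (F.pro p))) (by simp)
    have i2 := K.interchange (K.cid (G.pro (F.pro m))) (G.compHom (F.pro n) (F.pro p))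
      (by simp) (K.cid (G.pro (F.pro m))) (G.cell (F.compHom n p)) (by simp)
    simp only [K.cid_vcomp] at i1 i2
    rw [i1, i2]
    simp only [K.vcomp_assoc]
    rw [← K.vcomp_assoc (K.hcomp (G.cell _) _ _), n1]
    rw [← K.vcomp_assoc (K.hcomp _ (G.cell _) _) (G.compHom _ _), n2]
    simp only [K.vcomp_assoc]
    rw [hF, ← K.vcomp_assoc (G.compHom (E.comp _ _) _),
      ← K.vcomp_assoc (K.hcomp (G.compHom _ _) _ _), hG]
    simp only [K.vcomp_assoc]
  map_left m := by
    have hG := G.map_left (F.pro m)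
    have hF := congrArg G.cell (F.map_left m)
    simp only [G.cell_vcomp] at hF
    have n1 := G.comp_naturality (F.unitHom _) (E.cid (F.pro m)) (by simp)
    simp only [G.cell_cid] at n1
    have i1 := K.interchange (G.unitHom _) (K.cid (G.pro (F.pro m)))
      (by simp) (G.cell (F.unitHom _)) (K.cid (G.pro (F.pro m))) (by simp)
    simp only [K.cid_vcomp] at i1
    rw [i1]
    simp only [K.vcomp_assoc]
    rw [← K.vcomp_assoc (K.hcomp (G.cell _) _ _), n1]
    simp only [K.vcomp_assoc]
    rw [hF, hG]
  map_right m := by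
    have hG := G.map_right (F.pro m)
    have hF := congrArg G.cell (F.map_right m)
    simp only [G.cell_vcomp] at hF
    have n1 := G.comp_naturality (E.cid (F.pro m)) (F.unitHom _) (by simp)
    simp only [G.cell_cid] at n1
    have i1 := K.interchange (K.cid (G.pro (F.pro m))) (G.unitHom _)
      (by simp) (K.cid (G.pro (F.pro m))) (G.cell (F.unitHom _)) (by simp)
    simp only [K.cid_vcomp] at i1
    rw [i1]
    simp only [K.vcomp_assoc]
    rw [← K.vcomp_assoc (K.hcomp _ (G.cell _) _), n1]
    simp only [K.vcomp_assoc]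
    rw [hF, hG]

end DoubleFunctor

/-- A (vertical) transformation of double functors. -/
structure DoubleTrans {D : PseudoDoubleCategory.{u₁, v₁, w₁, z₁}}
    {E : PseudoDoubleCategory.{u₂, v₂, w₂, z₂}} (F G : DoubleFunctor D E) where
  app : F.fnc ⟶ G.fnc
  capp : ∀ {A B : D.Obj} (m : D.Pro A B), E.Cell (F.pro m) (G.pro m)
  src_capp : ∀ {A B : D.Obj} (m : D.Pro A B), E.src (capp m) = app.app A
  tgt_capp : ∀ {A B : D.Obj} (m : D.Pro A B), E.tgt (capp m) = app.app B
  naturality : ∀ {A B A' B' : D.Obj} {m : D.Pro A B} {n : D.Pro A' B'} (α : D.Cell m n),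
    E.vcomp (F.cell α) (capp n) = E.vcomp (capp m) (G.cell α)
  unit_coh : ∀ A : D.Obj,
    E.vcomp (F.unitHom A) (capp (D.unit A)) = E.vcomp (E.unitMap (app.app A)) (G.unitHom A)
  comp_coh : ∀ {A B C : D.Obj} (m : D.Pro A B) (n : D.Pro B C),
    E.vcomp (F.compHom m n) (capp (D.comp m n)) =
      E.vcomp (E.hcomp (capp m) (capp n) ((tgt_capp m).trans (src_capp n).symm)) (G.compHom m n)

/-- A transformation is invertible if it has an inverse transformation. -/
def DoubleTrans.IsInvertible {D : PseudoDoubleCategory.{u₁, v₁, w₁, z₁}}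
    {E : PseudoDoubleCategory.{u₂, v₂, w₂, z₂}} {F G : DoubleFunctor D E}
    (σ : DoubleTrans F G) : Prop :=
  ∃ τ : DoubleTrans G F,
    (∀ A : D.Obj, σ.app.app A ≫ τ.app.app A = 𝟙 _ ∧ τ.app.app A ≫ σ.app.app A = 𝟙 _) ∧
    ∀ ⦃A B : D.Obj⦄ (m : D.Pro A B), E.vcomp (σ.capp m) (τ.capp m) = E.cid _ ∧
      E.vcomp (τ.capp m) (σ.capp m) = E.cid _

/-- An adjunction `F ⊣ G` in the 2-category of double categories, double functors and
transformations. -/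
structure DoubleAdjunction {D : PseudoDoubleCategory.{u₁, v₁, w₁, z₁}}
    {E : PseudoDoubleCategory.{u₂, v₂, w₂, z₂}} (F : DoubleFunctor D E) (G : DoubleFunctor E D) where
  unit : DoubleTrans (DoubleFunctor.id D) (F.comp G)
  counit : DoubleTrans (G.comp F) (DoubleFunctor.id E)
  left_triangle : ∀ A : D.Obj,
    F.fnc.map (unit.app.app A) ≫ counit.app.app (F.fnc.obj A) = 𝟙 (F.fnc.obj A)
  left_triangle_cell : ∀ {A B : D.Obj} (m : D.Pro A B),
    E.vcomp (F.cell (unit.capp m)) (counit.capp (F.pro m)) = E.cid (F.pro m)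
  right_triangle : ∀ X : E.Obj,
    unit.app.app (G.fnc.obj X) ≫ G.fnc.map (counit.app.app X) = 𝟙 (G.fnc.obj X)
  right_triangle_cell : ∀ {X Y : E.Obj} (n : E.Pro X Y),
    D.vcomp (unit.capp (G.pro n)) (G.cell (counit.capp n)) = D.cid (G.pro n)

/-- Two pseudo double categories are equivalent if there are double functors in both directions
that are inverse to one another up to invertible transformations. -/
def DoubleEquivalent (D : PseudoDoubleCategory.{u₁, v₁, w₁, z₁})
    (E : PseudoDoubleCategory.{u₂, v₂, w₂, z₂}) : Prop :=
  ∃ (F : DoubleFunctor D E) (G : DoubleFunctor E D)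
    (η : DoubleTrans (DoubleFunctor.id D) (F.comp G))
    (ε : DoubleTrans (G.comp F) (DoubleFunctor.id E)), η.IsInvertible ∧ ε.IsInvertible

/-! ### Products of double categories, cartesian double categories -/

namespace PseudoDoubleCategory

/-- The product of two double categories, with componentwise structure. -/
abbrev prod (D : PseudoDoubleCategory.{u₁, v₁, w₁, z₁}) (E : PseudoDoubleCategory.{u₂, v₂, w₂, z₂}) :
    PseudoDoubleCategory.{max u₁ u₂, max v₁ v₂, max w₁ w₂, max z₁ z₂} where
  Obj := D.Obj × E.Obj
  Pro A B := D.Pro A.1 B.1 × E.Pro A.2 B.2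
  Cell m n := D.Cell m.1 n.1 × E.Cell m.2 n.2
  src α := (D.src α.1, E.src α.2)
  tgt α := (D.tgt α.1, E.tgt α.2)
  cid m := (D.cid m.1, E.cid m.2)
  vcomp α β := (D.vcomp α.1 β.1, E.vcomp α.2 β.2)
  src_cid _ := Prod.ext (D.src_cid _) (E.src_cid _)
  tgt_cid _ := Prod.ext (D.tgt_cid _) (E.tgt_cid _)
  src_vcomp _ _ := Prod.ext (D.src_vcomp _ _) (E.src_vcomp _ _)
  tgt_vcomp _ _ := Prod.ext (D.tgt_vcomp _ _) (E.tgt_vcomp _ _)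
  cid_vcomp _ := Prod.ext (D.cid_vcomp _) (E.cid_vcomp _)
  vcomp_cid _ := Prod.ext (D.vcomp_cid _) (E.vcomp_cid _)
  vcomp_assoc _ _ _ := Prod.ext (D.vcomp_assoc _ _ _) (E.vcomp_assoc _ _ _)
  unit A := (D.unit A.1, E.unit A.2)
  unitMap f := (D.unitMap f.1, E.unitMap f.2)
  src_unitMap _ := Prod.ext (D.src_unitMap _) (E.src_unitMap _)
  tgt_unitMap _ := Prod.ext (D.tgt_unitMap _) (E.tgt_unitMap _)
  unitMap_id _ := Prod.ext (D.unitMap_id _) (E.unitMap_id _)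
  unitMap_comp _ _ := Prod.ext (D.unitMap_comp _ _) (E.unitMap_comp _ _)
  comp m n := (D.comp m.1 n.1, E.comp m.2 n.2)
  hcomp α β h :=
    (D.hcomp α.1 β.1 (congrArg Prod.fst h), E.hcomp α.2 β.2 (congrArg Prod.snd h))
  src_hcomp _ _ _ := Prod.ext (D.src_hcomp _ _ _) (E.src_hcomp _ _ _)
  tgt_hcomp _ _ _ := Prod.ext (D.tgt_hcomp _ _ _) (E.tgt_hcomp _ _ _)
  hcomp_cid _ _ := Prod.ext (D.hcomp_cid _ _) (E.hcomp_cid _ _)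
  interchange _ _ _ _ _ _ :=
    Prod.ext (D.interchange _ _ _ _ _ _) (E.interchange _ _ _ _ _ _)
  assocHom m n p := (D.assocHom m.1 n.1 p.1, E.assocHom m.2 n.2 p.2)
  assocInv m n p := (D.assocInv m.1 n.1 p.1, E.assocInv m.2 n.2 p.2)
  src_assocHom _ _ _ := Prod.ext (D.src_assocHom _ _ _) (E.src_assocHom _ _ _)
  tgt_assocHom _ _ _ := Prod.ext (D.tgt_assocHom _ _ _) (E.tgt_assocHom _ _ _)
  assocHom_inv _ _ _ := Prod.ext (D.assocHom_inv _ _ _) (E.assocHom_inv _ _ _)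
  assocInv_hom _ _ _ := Prod.ext (D.assocInv_hom _ _ _) (E.assocInv_hom _ _ _)
  assoc_naturality _ _ _ _ _ :=
    Prod.ext (D.assoc_naturality _ _ _ _ _) (E.assoc_naturality _ _ _ _ _)
  leftHom m := (D.leftHom m.1, E.leftHom m.2)
  leftInv m := (D.leftInv m.1, E.leftInv m.2)
  src_leftHom _ := Prod.ext (D.src_leftHom _) (E.src_leftHom _)
  tgt_leftHom _ := Prod.ext (D.tgt_leftHom _) (E.tgt_leftHom _)
  leftHom_inv _ := Prod.ext (D.leftHom_inv _) (E.leftHom_inv _)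
  leftInv_hom _ := Prod.ext (D.leftInv_hom _) (E.leftInv_hom _)
  left_naturality _ := Prod.ext (D.left_naturality _) (E.left_naturality _)
  rightHom m := (D.rightHom m.1, E.rightHom m.2)
  rightInv m := (D.rightInv m.1, E.rightInv m.2)
  src_rightHom _ := Prod.ext (D.src_rightHom _) (E.src_rightHom _)
  tgt_rightHom _ := Prod.ext (D.tgt_rightHom _) (E.tgt_rightHom _)
  rightHom_inv _ := Prod.ext (D.rightHom_inv _) (E.rightHom_inv _)
  rightInv_hom _ := Prod.ext (D.rightInv_hom _) (E.rightInv_hom _)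
  right_naturality _ := Prod.ext (D.right_naturality _) (E.right_naturality _)
  pentagon _ _ _ _ := Prod.ext (D.pentagon _ _ _ _) (E.pentagon _ _ _ _)
  triangle _ _ := Prod.ext (D.triangle _ _) (E.triangle _ _)

/-- The terminal double category: one object, one arrow, one proarrow, one cell. -/
abbrev terminal : PseudoDoubleCategory.{0, 0, 0, 0} where
  Obj := Discrete PUnit
  Pro _ _ := PUnit
  Cell _ _ := PUnit
  src _ := eqToHom (Subsingleton.elim _ _)
  tgt _ := eqToHom (Subsingleton.elim _ _)
  cid _ := ⟨⟩
  vcomp _ _ := ⟨⟩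
  src_cid _ := Subsingleton.elim _ _
  tgt_cid _ := Subsingleton.elim _ _
  src_vcomp _ _ := Subsingleton.elim _ _
  tgt_vcomp _ _ := Subsingleton.elim _ _
  cid_vcomp _ := rfl
  vcomp_cid _ := rfl
  vcomp_assoc _ _ _ := rfl
  unit _ := ⟨⟩
  unitMap _ := ⟨⟩
  src_unitMap _ := Subsingleton.elim _ _
  tgt_unitMap _ := Subsingleton.elim _ _
  unitMap_id _ := rfl
  unitMap_comp _ _ := rfl
  comp _ _ := ⟨⟩
  hcomp _ _ _ := ⟨⟩
  src_hcomp _ _ _ := Subsingleton.elim _ _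
  tgt_hcomp _ _ _ := Subsingleton.elim _ _
  hcomp_cid _ _ := rfl
  interchange _ _ _ _ _ _ := rfl
  assocHom _ _ _ := ⟨⟩
  assocInv _ _ _ := ⟨⟩
  src_assocHom _ _ _ := Subsingleton.elim _ _
  tgt_assocHom _ _ _ := Subsingleton.elim _ _
  assocHom_inv _ _ _ := rfl
  assocInv_hom _ _ _ := rfl
  assoc_naturality _ _ _ _ _ := rfl
  leftHom _ := ⟨⟩
  leftInv _ := ⟨⟩
  src_leftHom _ := Subsingleton.elim _ _
  tgt_leftHom _ := Subsingleton.elim _ _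
  leftHom_inv _ := rfl
  leftInv_hom _ := rfl
  left_naturality _ := rfl
  rightHom _ := ⟨⟩
  rightInv _ := ⟨⟩
  src_rightHom _ := Subsingleton.elim _ _
  tgt_rightHom _ := Subsingleton.elim _ _
  rightHom_inv _ := rfl
  rightInv_hom _ := rfl
  right_naturality _ := rfl
  pentagon _ _ _ _ := rfl
  triangle _ _ := rfl

theorem terminal_hom_ext {X Y : terminal.Obj} (f g : X ⟶ Y) : f = g :=
  Subsingleton.elim (α := ((show Discrete PUnit from X) ⟶ (show Discrete PUnit from Y))) f g

variable (D : PseudoDoubleCategory.{u, v, w, z})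

/-- The diagonal double functor. -/
abbrev diagonal : DoubleFunctor D (D.prod D) where
  fnc := Functor.diag D.Obj
  pro m := (m, m)
  cell α := (α, α)
  src_cell _ := rfl
  tgt_cell _ := rfl
  cell_cid _ := rfl
  cell_vcomp _ _ := rfl
  unitHom A := (D.prod D).cid ((D.prod D).unit (A, A))
  unitInv A := (D.prod D).cid ((D.prod D).unit (A, A))
  src_unitHom _ := (D.prod D).src_cid _
  tgt_unitHom _ := (D.prod D).tgt_cid _
  unitHom_inv _ := (D.prod D).cid_vcomp _
  unitInv_hom _ := (D.prod D).cid_vcomp _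
  unit_naturality _ := ((D.prod D).vcomp_cid _).trans ((D.prod D).cid_vcomp _).symm
  compHom _ _ := (D.cid _, D.cid _)
  compInv _ _ := (D.cid _, D.cid _)
  src_compHom m n := (D.prod D).src_cid (A := (_, _)) (B := (_, _)) (D.comp m n, D.comp m n)
  tgt_compHom m n := (D.prod D).tgt_cid (A := (_, _)) (B := (_, _)) (D.comp m n, D.comp m n)
  compHom_inv _ _ := Prod.ext (D.cid_vcomp _) (D.cid_vcomp _)
  compInv_hom _ _ := Prod.ext (D.cid_vcomp _) (D.cid_vcomp _)
  comp_naturality _ _ _ :=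
    Prod.ext ((D.vcomp_cid _).trans (D.cid_vcomp _).symm)
      ((D.vcomp_cid _).trans (D.cid_vcomp _).symm)
  map_assoc m n p := Prod.ext ((DoubleFunctor.id D).map_assoc m n p)
    ((DoubleFunctor.id D).map_assoc m n p)
  map_left m := Prod.ext ((DoubleFunctor.id D).map_left m) ((DoubleFunctor.id D).map_left m)
  map_right m := Prod.ext ((DoubleFunctor.id D).map_right m) ((DoubleFunctor.id D).map_right m)

/-- The unique double functor to the terminal double category. -/
abbrev toTerminal : DoubleFunctor D terminal where
  fnc := Functor.star D.Obj
  pro _ := ⟨⟩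
  cell _ := ⟨⟩
  src_cell _ := terminal_hom_ext _ _
  tgt_cell _ := terminal_hom_ext _ _
  cell_cid _ := rfl
  cell_vcomp _ _ := rfl
  unitHom _ := ⟨⟩
  unitInv _ := ⟨⟩
  src_unitHom _ := terminal_hom_ext _ _
  tgt_unitHom _ := terminal_hom_ext _ _
  unitHom_inv _ := rfl
  unitInv_hom _ := rfl
  unit_naturality _ := rfl
  compHom _ _ := ⟨⟩
  compInv _ _ := ⟨⟩
  src_compHom _ _ := terminal_hom_ext _ _
  tgt_compHom _ _ := terminal_hom_ext _ _
  compHom_inv _ _ := rfl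
  compInv_hom _ _ := rfl
  comp_naturality _ _ _ := rfl
  map_assoc _ _ _ := rfl
  map_left _ := rfl
  map_right _ := rfl

/-- A double category is cartesian if its diagonal and its functor to the terminal double category
have right adjoints in the 2-category of double categories. -/
def IsCartesian : Prop :=
  (∃ R : DoubleFunctor (D.prod D) D, Nonempty (DoubleAdjunction D.diagonal R)) ∧
    ∃ R : DoubleFunctor terminal D, Nonempty (DoubleAdjunction D.toTerminal R)

end PseudoDoubleCategory

/-! ### Factorization systems and the double category of relations -/

/-- `e` is orthogonal to `m`: every square from `e` to `m` has a unique diagonal filler. -/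
def UniqueLifting {C : Type u} [Category.{v} C] {X Y A B : C} (e : X ⟶ Y) (m : A ⟶ B) : Prop :=
  ∀ (s : X ⟶ A) (t : Y ⟶ B), s ≫ m = e ≫ t → ∃! d : Y ⟶ A, e ≫ d = s ∧ d ≫ m = t

/-- An orthogonal factorization system. -/
structure FactorizationSystem (C : Type u) [Category.{v} C] where
  E : MorphismProperty C
  M : MorphismProperty C
  iso_E : ∀ {X Y : C} (f : X ⟶ Y), IsIso f → E f
  iso_M : ∀ {X Y : C} (f : X ⟶ Y), IsIso f → M f
  comp_E : ∀ {X Y Z : C} (f : X ⟶ Y) (g : Y ⟶ Z), E f → E g → E (f ≫ g)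
  comp_M : ∀ {X Y Z : C} (f : X ⟶ Y) (g : Y ⟶ Z), M f → M g → M (f ≫ g)
  exists_fac : ∀ {X Y : C} (f : X ⟶ Y), ∃ (I : C) (e : X ⟶ I) (m : I ⟶ Y), E e ∧ M m ∧ e ≫ m = f
  orthogonal : ∀ {X Y A B : C} (e : X ⟶ Y) (m : A ⟶ B), E e → M m → UniqueLifting e m

namespace FactorizationSystem

variable {C : Type u} [Category.{v} C]

/-- Every arrow of `E` is epic and every arrow of `M` is monic. -/
structure IsProper (F : FactorizationSystem C) : Prop where
  epi : ∀ {X Y : C} (e : X ⟶ Y), F.E e → Epi e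
  mono : ∀ {X Y : C} (m : X ⟶ Y), F.M m → Mono m

/-- `E` is stable under pullback. -/
def IsStable (F : FactorizationSystem C) : Prop :=
  ∀ ⦃P X Y Z : C⦄ (e' : P ⟶ X) (g' : P ⟶ Y) (g : X ⟶ Z) (e : Y ⟶ Z),
    IsPullback e' g' g e → F.E e → F.E e'

variable (F : FactorizationSystem C)

/-- The image of a morphism: the middle object of a chosen factorization. -/
noncomputable def im {X Y : C} (f : X ⟶ Y) : C := (F.exists_fac f).choose

noncomputable def imE {X Y : C} (f : X ⟶ Y) : X ⟶ F.im f := (F.exists_fac f).choose_spec.choose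

noncomputable def imM {X Y : C} (f : X ⟶ Y) : F.im f ⟶ Y :=
  (F.exists_fac f).choose_spec.choose_spec.choose

theorem imE_mem {X Y : C} (f : X ⟶ Y) : F.E (F.imE f) :=
  (F.exists_fac f).choose_spec.choose_spec.choose_spec.1

theorem imM_mem {X Y : C} (f : X ⟶ Y) : F.M (F.imM f) :=
  (F.exists_fac f).choose_spec.choose_spec.choose_spec.2.1

theorem imE_imM {X Y : C} (f : X ⟶ Y) : F.imE f ≫ F.imM f = f :=
  (F.exists_fac f).choose_spec.choose_spec.choose_spec.2.2

variable [HasFiniteLimits C]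

/-- An `F`-relation from `A` to `B`: a span whose legs are jointly in `M`. -/
structure Relation (A B : C) where
  apex : C
  l : apex ⟶ A
  r : apex ⟶ B
  mem : F.M (prod.lift l r)

variable {F}

/-- A cell between `F`-relations: a morphism of spans. -/
structure RelCell {A B A' B' : C} (R : F.Relation A B) (S : F.Relation A' B') where
  fst : A ⟶ A'
  snd : B ⟶ B'
  hom : R.apex ⟶ S.apex
  hom_l : hom ≫ S.l = R.l ≫ fst
  hom_r : hom ≫ S.r = R.r ≫ snd

theorem RelCell.ext_of_proper (hF : F.IsProper) {A B A' B' : C} {R : F.Relation A B}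
    {S : F.Relation A' B'} {α β : RelCell R S} (h₁ : α.fst = β.fst) (h₂ : α.snd = β.snd) :
    α = β := by
  have := hF.mono _ S.mem
  obtain ⟨f, g, a, a1, a2⟩ := α
  obtain ⟨f', g', b, b1, b2⟩ := β
  dsimp only at h₁ h₂
  subst h₁ h₂
  have : a = b := by
    rw [← cancel_mono (prod.lift S.l S.r)]
    ext
    · simp only [Category.assoc, prod.lift_fst, a1, b1]
    · simp only [Category.assoc, prod.lift_snd, a2, b2]
  subst this
  rfl

/-- A cell out of `R` can be defined on a span that covers `R` by an arrow of `E`. -/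
theorem RelCell.exists_of_cover {A B A' B' : C} {R : F.Relation A B} {S : F.Relation A' B'}
    (f : A ⟶ A') (g : B ⟶ B') {X : C} (e : X ⟶ R.apex) (he : F.E e) (x : X ⟶ S.apex)
    (hl : x ≫ S.l = e ≫ R.l ≫ f) (hr : x ≫ S.r = e ≫ R.r ≫ g) :
    ∃ α : RelCell R S, α.fst = f ∧ α.snd = g := by
  obtain ⟨d, ⟨-, hd⟩, -⟩ := F.orthogonal e (prod.lift S.l S.r) he S.mem x
    (prod.lift (R.l ≫ f) (R.r ≫ g)) (by ext <;> simp [prod.lift_fst, prod.lift_snd, hl, hr])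
  refine ⟨⟨f, g, d, ?_, ?_⟩, rfl, rfl⟩
  · simpa only [Category.assoc, prod.lift_fst] using congrArg (· ≫ prod.fst) hd
  · simpa only [Category.assoc, prod.lift_snd] using congrArg (· ≫ prod.snd) hd

theorem diag_mem (hF : F.IsProper) (A : C) : F.M (prod.lift (𝟙 A) (𝟙 A)) := by
  let f := prod.lift (𝟙 A) (𝟙 A)
  have := hF.epi _ (F.imE_mem f)
  have h : F.imM f ≫ prod.fst = F.imM f ≫ prod.snd := by
    rw [← cancel_epi (F.imE f), ← Category.assoc, ← Category.assoc, F.imE_imM, prod.lift_fst, prod.lift_snd]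
  have hi : F.imE f ≫ F.imM f ≫ prod.fst = 𝟙 A := by
    rw [← Category.assoc, F.imE_imM, prod.lift_fst]
  have : IsIso (F.imE f) :=
    ⟨F.imM f ≫ prod.fst, hi, by
      rw [← cancel_epi (F.imE f), ← Category.assoc, hi, Category.id_comp, Category.comp_id]⟩
  have h' := F.comp_M _ _ (F.iso_M (F.imE f) inferInstance) (F.imM_mem f)
  rwa [F.imE_imM] at h'

variable (F) in
/-- The external unit: the diagonal relation. -/
noncomputable abbrev relUnit (hF : F.IsProper) (A : C) : F.Relation A A where
  apex := A
  l := 𝟙 A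
  r := 𝟙 A
  mem := diag_mem hF A

/-- The morphism `R ×_B S ⟶ A × X` whose image is the composite relation. -/
noncomputable def Relation.spanMap {A B X : C} (R : F.Relation A B) (S : F.Relation B X) :
    pullback R.r S.l ⟶ A ⨯ X :=
  prod.lift (pullback.fst R.r S.l ≫ R.l) (pullback.snd R.r S.l ≫ S.r)

/-- The composite of relations: the image of `R ×_B S` in `A × X`. -/
noncomputable def Relation.comp {A B X : C} (R : F.Relation A B) (S : F.Relation B X) :
    F.Relation A X where
  apex := F.im (R.spanMap S)
  l := F.imM (R.spanMap S) ≫ prod.fst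
  r := F.imM (R.spanMap S) ≫ prod.snd
  mem := by
    have h : prod.lift (F.imM (R.spanMap S) ≫ prod.fst) (F.imM (R.spanMap S) ≫ prod.snd) =
      F.imM (R.spanMap S) := by ext <;> simp only [prod.lift_fst, prod.lift_snd]
    rw [h]
    exact F.imM_mem _

/-- The quotient map from `R ×_B S` to the composite relation. -/
noncomputable def Relation.quot {A B X : C} (R : F.Relation A B) (S : F.Relation B X) :
    pullback R.r S.l ⟶ (R.comp S).apex := F.imE (R.spanMap S)

theorem Relation.quot_mem {A B X : C} (R : F.Relation A B) (S : F.Relation B X) :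
    F.E (R.quot S) := F.imE_mem _

theorem Relation.quot_l {A B X : C} (R : F.Relation A B) (S : F.Relation B X) :
    R.quot S ≫ (R.comp S).l = pullback.fst R.r S.l ≫ R.l := by
  have h := congrArg (· ≫ prod.fst) (F.imE_imM (R.spanMap S))
  simpa only [Relation.quot, Relation.comp, Category.assoc, Relation.spanMap, prod.lift_fst] using h

theorem Relation.quot_r {A B X : C} (R : F.Relation A B) (S : F.Relation B X) :
    R.quot S ≫ (R.comp S).r = pullback.snd R.r S.l ≫ S.r := by
  have h := congrArg (· ≫ prod.snd) (F.imE_imM (R.spanMap S))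
  simpa only [Relation.quot, Relation.comp, Category.assoc, Relation.spanMap, prod.lift_snd] using h

theorem exists_hcomp {A B X A' B' X' : C} {R : F.Relation A B} {S : F.Relation B X}
    {R' : F.Relation A' B'} {S' : F.Relation B' X'} (α : RelCell R R') (β : RelCell S S')
    (h : α.snd = β.fst) :
    ∃ γ : RelCell (R.comp S) (R'.comp S'), γ.fst = α.fst ∧ γ.snd = β.snd := by
  refine RelCell.exists_of_cover _ _ (R.quot S) (R.quot_mem S)
    (pullback.lift (pullback.fst R.r S.l ≫ α.hom) (pullback.snd R.r S.l ≫ β.hom) ?_ ≫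
      R'.quot S') ?_ ?_
  · rw [Category.assoc, Category.assoc, α.hom_r, β.hom_l, h, pullback.condition_assoc]
  · rw [Category.assoc, Relation.quot_l, pullback.lift_fst_assoc, Category.assoc, α.hom_l,
      ← Category.assoc (R.quot S), Relation.quot_l, Category.assoc]
  · rw [Category.assoc, Relation.quot_r, pullback.lift_snd_assoc, Category.assoc, β.hom_r,
      ← Category.assoc (R.quot S), Relation.quot_r, Category.assoc]

theorem exists_assocHom (hs : F.IsStable) {A B X Y : C} (R : F.Relation A B)
    (S : F.Relation B X) (T : F.Relation X Y) :
    ∃ γ : RelCell ((R.comp S).comp T) (R.comp (S.comp T)), γ.fst = 𝟙 A ∧ γ.snd = 𝟙 Y := by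
  let p := pullback.fst (R.comp S).r T.l
  let q := pullback.snd (R.comp S).r T.l
  let e := pullback.snd (R.quot S) p
  let x := pullback.fst (R.quot S) p
  have hx : x ≫ R.quot S = e ≫ p := pullback.condition
  have he : F.E e := hs e x p (R.quot S) (IsPullback.of_hasPullback _ _).flip (R.quot_mem S)
  have h1 : (x ≫ pullback.snd R.r S.l) ≫ S.r = (e ≫ q) ≫ T.l := by
    rw [Category.assoc, ← Relation.quot_r, ← Category.assoc, hx, Category.assoc, Category.assoc,
      pullback.condition]
  let y := pullback.lift _ _ h1 ≫ S.quot T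
  have h2 : (x ≫ pullback.fst R.r S.l) ≫ R.r = y ≫ (S.comp T).l := by
    rw [Category.assoc, Category.assoc, Relation.quot_l, pullback.lift_fst_assoc,
      Category.assoc, pullback.condition]
  refine RelCell.exists_of_cover _ _ (e ≫ (R.comp S).quot T)
    (F.comp_E _ _ he (Relation.quot_mem _ _)) (pullback.lift _ _ h2 ≫ R.quot (S.comp T)) ?_ ?_
  · rw [Category.assoc, Relation.quot_l, pullback.lift_fst_assoc, Category.comp_id,
      Category.assoc e, Relation.quot_l, Category.assoc, ← Relation.quot_l,
      ← Category.assoc, hx, Category.assoc]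
  · rw [Category.assoc, Relation.quot_r, pullback.lift_snd_assoc, Category.comp_id,
      Category.assoc e, Relation.quot_r, Category.assoc, Relation.quot_r,
      pullback.lift_snd_assoc, Category.assoc]

theorem exists_assocInv (hs : F.IsStable) {A B X Y : C} (R : F.Relation A B)
    (S : F.Relation B X) (T : F.Relation X Y) :
    ∃ γ : RelCell (R.comp (S.comp T)) ((R.comp S).comp T), γ.fst = 𝟙 A ∧ γ.snd = 𝟙 Y := by
  let p := pullback.fst R.r (S.comp T).l
  let q := pullback.snd R.r (S.comp T).l
  let e := pullback.snd (S.quot T) q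
  let x := pullback.fst (S.quot T) q
  have hx : x ≫ S.quot T = e ≫ q := pullback.condition
  have he : F.E e := hs e x q (S.quot T) (IsPullback.of_hasPullback _ _).flip (S.quot_mem T)
  have h1 : (e ≫ p) ≫ R.r = (x ≫ pullback.fst S.r T.l) ≫ S.l := by
    rw [Category.assoc x, ← Relation.quot_l, ← Category.assoc x, hx, Category.assoc,
      Category.assoc, pullback.condition]
  let y := pullback.lift _ _ h1 ≫ R.quot S
  have h2 : y ≫ (R.comp S).r = (x ≫ pullback.snd S.r T.l) ≫ T.l := by
    rw [Category.assoc, Category.assoc, Relation.quot_r, pullback.lift_snd_assoc,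
      Category.assoc, pullback.condition]
  refine RelCell.exists_of_cover _ _ (e ≫ R.quot (S.comp T))
    (F.comp_E _ _ he (Relation.quot_mem _ _)) (pullback.lift _ _ h2 ≫ (R.comp S).quot T) ?_ ?_
  · rw [Category.assoc, Relation.quot_l, pullback.lift_fst_assoc, Category.comp_id,
      Category.assoc e, Relation.quot_l, Category.assoc, Relation.quot_l,
      pullback.lift_fst_assoc, Category.assoc]
  · rw [Category.assoc, Relation.quot_r, pullback.lift_snd_assoc, Category.comp_id,
      Category.assoc e, Relation.quot_r, Category.assoc, ← Relation.quot_r,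
      ← Category.assoc, hx, Category.assoc]

theorem exists_leftHom (hF : F.IsProper) {A B : C} (R : F.Relation A B) :
    ∃ γ : RelCell ((F.relUnit hF A).comp R) R, γ.fst = 𝟙 A ∧ γ.snd = 𝟙 B := by
  refine RelCell.exists_of_cover _ _ (Relation.quot _ R) (Relation.quot_mem _ _)
    (pullback.snd (F.relUnit hF A).r R.l) ?_ ?_
  · rw [Category.comp_id, Relation.quot_l, ← pullback.condition]
  · rw [Category.comp_id, Relation.quot_r]

theorem exists_leftInv (hF : F.IsProper) {A B : C} (R : F.Relation A B) :
    ∃ γ : RelCell R ((F.relUnit hF A).comp R), γ.fst = 𝟙 A ∧ γ.snd = 𝟙 B := by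
  refine RelCell.exists_of_cover _ _ (𝟙 R.apex) (F.iso_E _ inferInstance)
    (pullback.lift R.l (𝟙 R.apex) (by simp) ≫ Relation.quot (F.relUnit hF A) R) ?_ ?_
  · rw [Category.assoc, Relation.quot_l, pullback.lift_fst_assoc]; simp
  · rw [Category.assoc, Relation.quot_r, pullback.lift_snd_assoc]; simp

theorem exists_rightHom (hF : F.IsProper) {A B : C} (R : F.Relation A B) :
    ∃ γ : RelCell (R.comp (F.relUnit hF B)) R, γ.fst = 𝟙 A ∧ γ.snd = 𝟙 B := by
  refine RelCell.exists_of_cover _ _ (Relation.quot R _) (Relation.quot_mem _ _)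
    (pullback.fst R.r (F.relUnit hF B).l) ?_ ?_
  · rw [Category.comp_id, Relation.quot_l]
  · rw [Category.comp_id, Relation.quot_r, pullback.condition]

theorem exists_rightInv (hF : F.IsProper) {A B : C} (R : F.Relation A B) :
    ∃ γ : RelCell R (R.comp (F.relUnit hF B)), γ.fst = 𝟙 A ∧ γ.snd = 𝟙 B := by
  refine RelCell.exists_of_cover _ _ (𝟙 R.apex) (F.iso_E _ inferInstance)
    (pullback.lift (𝟙 R.apex) R.r (by simp) ≫ Relation.quot R (F.relUnit hF B)) ?_ ?_
  · rw [Category.assoc, Relation.quot_l, pullback.lift_fst_assoc]; simp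
  · rw [Category.assoc, Relation.quot_r, pullback.lift_snd_assoc]; simp

/-! The structure cells of the double category of relations. -/

noncomputable def rel_hcomp {A B X A' B' X' : C} {R : F.Relation A B} {S : F.Relation B X}
    {R' : F.Relation A' B'} {S' : F.Relation B' X'} (α : RelCell R R') (β : RelCell S S')
    (h : α.snd = β.fst) :
    RelCell (R.comp S) (R'.comp S') := (exists_hcomp α β h).choose

@[simp]
theorem rel_hcomp_fst {A B X A' B' X' : C} {R : F.Relation A B} {S : F.Relation B X}
    {R' : F.Relation A' B'} {S' : F.Relation B' X'} (α : RelCell R R') (β : RelCell S S')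
    (h : α.snd = β.fst) :
    (rel_hcomp α β h).fst = α.fst := (exists_hcomp α β h).choose_spec.1

@[simp]
theorem rel_hcomp_snd {A B X A' B' X' : C} {R : F.Relation A B} {S : F.Relation B X}
    {R' : F.Relation A' B'} {S' : F.Relation B' X'} (α : RelCell R R') (β : RelCell S S')
    (h : α.snd = β.fst) :
    (rel_hcomp α β h).snd = β.snd := (exists_hcomp α β h).choose_spec.2

noncomputable def rel_assocHom (hs : F.IsStable) {A B X Y : C} (R : F.Relation A B)
    (S : F.Relation B X) (T : F.Relation X Y) :
    RelCell ((R.comp S).comp T) (R.comp (S.comp T)) := (exists_assocHom hs R S T).choose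

@[simp]
theorem rel_assocHom_fst (hs : F.IsStable) {A B X Y : C} (R : F.Relation A B)
    (S : F.Relation B X) (T : F.Relation X Y) :
    (rel_assocHom hs R S T).fst = 𝟙 A := (exists_assocHom hs R S T).choose_spec.1

@[simp]
theorem rel_assocHom_snd (hs : F.IsStable) {A B X Y : C} (R : F.Relation A B)
    (S : F.Relation B X) (T : F.Relation X Y) :
    (rel_assocHom hs R S T).snd = 𝟙 Y := (exists_assocHom hs R S T).choose_spec.2

noncomputable def rel_assocInv (hs : F.IsStable) {A B X Y : C} (R : F.Relation A B)
    (S : F.Relation B X) (T : F.Relation X Y) :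
    RelCell (R.comp (S.comp T)) ((R.comp S).comp T) := (exists_assocInv hs R S T).choose

@[simp]
theorem rel_assocInv_fst (hs : F.IsStable) {A B X Y : C} (R : F.Relation A B)
    (S : F.Relation B X) (T : F.Relation X Y) :
    (rel_assocInv hs R S T).fst = 𝟙 A := (exists_assocInv hs R S T).choose_spec.1

@[simp]
theorem rel_assocInv_snd (hs : F.IsStable) {A B X Y : C} (R : F.Relation A B)
    (S : F.Relation B X) (T : F.Relation X Y) :
    (rel_assocInv hs R S T).snd = 𝟙 Y := (exists_assocInv hs R S T).choose_spec.2

noncomputable def rel_leftHom (hF : F.IsProper) {A B : C} (R : F.Relation A B) :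
    RelCell ((F.relUnit hF A).comp R) R := (exists_leftHom hF R).choose

@[simp]
theorem rel_leftHom_fst (hF : F.IsProper) {A B : C} (R : F.Relation A B) :
    (rel_leftHom hF R).fst = 𝟙 A := (exists_leftHom hF R).choose_spec.1

@[simp]
theorem rel_leftHom_snd (hF : F.IsProper) {A B : C} (R : F.Relation A B) :
    (rel_leftHom hF R).snd = 𝟙 B := (exists_leftHom hF R).choose_spec.2

noncomputable def rel_leftInv (hF : F.IsProper) {A B : C} (R : F.Relation A B) :
    RelCell R ((F.relUnit hF A).comp R) := (exists_leftInv hF R).choose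

@[simp]
theorem rel_leftInv_fst (hF : F.IsProper) {A B : C} (R : F.Relation A B) :
    (rel_leftInv hF R).fst = 𝟙 A := (exists_leftInv hF R).choose_spec.1

@[simp]
theorem rel_leftInv_snd (hF : F.IsProper) {A B : C} (R : F.Relation A B) :
    (rel_leftInv hF R).snd = 𝟙 B := (exists_leftInv hF R).choose_spec.2

noncomputable def rel_rightHom (hF : F.IsProper) {A B : C} (R : F.Relation A B) :
    RelCell (R.comp (F.relUnit hF B)) R := (exists_rightHom hF R).choose

@[simp]
theorem rel_rightHom_fst (hF : F.IsProper) {A B : C} (R : F.Relation A B) :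
    (rel_rightHom hF R).fst = 𝟙 A := (exists_rightHom hF R).choose_spec.1

@[simp]
theorem rel_rightHom_snd (hF : F.IsProper) {A B : C} (R : F.Relation A B) :
    (rel_rightHom hF R).snd = 𝟙 B := (exists_rightHom hF R).choose_spec.2

noncomputable def rel_rightInv (hF : F.IsProper) {A B : C} (R : F.Relation A B) :
    RelCell R (R.comp (F.relUnit hF B)) := (exists_rightInv hF R).choose

@[simp]
theorem rel_rightInv_fst (hF : F.IsProper) {A B : C} (R : F.Relation A B) :
    (rel_rightInv hF R).fst = 𝟙 A := (exists_rightInv hF R).choose_spec.1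

@[simp]
theorem rel_rightInv_snd (hF : F.IsProper) {A B : C} (R : F.Relation A B) :
    (rel_rightInv hF R).snd = 𝟙 B := (exists_rightInv hF R).choose_spec.2

/-- The double category of `F`-relations in `C`: objects and arrows are those of `C`, proarrows are
`F`-relations, cells are morphisms of spans. As `M` consists of monomorphisms, a cell is determined
by its boundary, so the structure cells (which exist by orthogonality) are unique. -/
noncomputable abbrev RelDbl (F : FactorizationSystem C) (hF : F.IsProper) (hs : F.IsStable) :
    PseudoDoubleCategory.{u, v, max u v, v} where
  Obj := C
  Pro A B := F.Relation A B
  Cell R S := RelCell R S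
  src α := α.fst
  tgt α := α.snd
  cid R := ⟨𝟙 _, 𝟙 _, 𝟙 _, by simp, by simp⟩
  vcomp α β := ⟨α.fst ≫ β.fst, α.snd ≫ β.snd, α.hom ≫ β.hom,
    by rw [Category.assoc, β.hom_l, ← Category.assoc, α.hom_l, Category.assoc],
    by rw [Category.assoc, β.hom_r, ← Category.assoc, α.hom_r, Category.assoc]⟩
  src_cid _ := rfl
  tgt_cid _ := rfl
  src_vcomp _ _ := rfl
  tgt_vcomp _ _ := rfl
  cid_vcomp _ := RelCell.ext_of_proper hF (Category.id_comp _) (Category.id_comp _)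
  vcomp_cid _ := RelCell.ext_of_proper hF (Category.comp_id _) (Category.comp_id _)
  vcomp_assoc _ _ _ := RelCell.ext_of_proper hF (Category.assoc _ _ _) (Category.assoc _ _ _)
  unit A := F.relUnit hF A
  unitMap f := ⟨f, f, f, by simp, by simp⟩
  src_unitMap _ := rfl
  tgt_unitMap _ := rfl
  unitMap_id _ := RelCell.ext_of_proper hF rfl rfl
  unitMap_comp _ _ := RelCell.ext_of_proper hF rfl rfl
  comp R S := R.comp S
  hcomp α β h := rel_hcomp α β h
  src_hcomp α β h := rel_hcomp_fst α β h
  tgt_hcomp α β h := rel_hcomp_snd α β h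
  hcomp_cid _ _ := RelCell.ext_of_proper hF (rel_hcomp_fst _ _ _) (rel_hcomp_snd _ _ _)
  interchange _ _ _ _ _ _ := RelCell.ext_of_proper hF (by simp) (by simp)
  assocHom R S T := rel_assocHom hs R S T
  assocInv R S T := rel_assocInv hs R S T
  src_assocHom R S T := rel_assocHom_fst hs R S T
  tgt_assocHom R S T := rel_assocHom_snd hs R S T
  assocHom_inv _ _ _ := RelCell.ext_of_proper hF (by simp) (by simp)
  assocInv_hom _ _ _ := RelCell.ext_of_proper hF (by simp) (by simp)
  assoc_naturality _ _ _ _ _ := RelCell.ext_of_proper hF (by simp) (by simp)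
  leftHom R := rel_leftHom hF R
  leftInv R := rel_leftInv hF R
  src_leftHom R := rel_leftHom_fst hF R
  tgt_leftHom R := rel_leftHom_snd hF R
  leftHom_inv _ := RelCell.ext_of_proper hF (by simp) (by simp)
  leftInv_hom _ := RelCell.ext_of_proper hF (by simp) (by simp)
  left_naturality _ := RelCell.ext_of_proper hF (by simp) (by simp)
  rightHom R := rel_rightHom hF R
  rightInv R := rel_rightInv hF R
  src_rightHom R := rel_rightHom_fst hF R
  tgt_rightHom R := rel_rightHom_snd hF R
  rightHom_inv _ := RelCell.ext_of_proper hF (by simp) (by simp)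
  rightInv_hom _ := RelCell.ext_of_proper hF (by simp) (by simp)
  right_naturality _ := RelCell.ext_of_proper hF (by simp) (by simp)
  pentagon _ _ _ _ := RelCell.ext_of_proper hF (by simp) (by simp)
  triangle _ _ := RelCell.ext_of_proper hF (by simp) (by simp)

end FactorizationSystem

/-! ### Equipments, tabulators, covers, inclusions, relations and the Frobenius law -/

namespace PseudoDoubleCategory

variable (D : PseudoDoubleCategory.{u, v, w, z})

/-- Unit-pure: the external unit functor is full. -/
def IsUnitPure : Prop :=
  ∀ ⦃A B : D.Obj⦄ (θ : D.Cell (D.unit A) (D.unit B)), ∃ f : A ⟶ B, D.unitMap f = θ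

/-- Companion data exhibiting the proarrow `p` as `f_!`. -/
structure Companion {A B : D.Obj} (f : A ⟶ B) (p : D.Pro A B) where
  η : D.Cell (D.unit A) p
  ε : D.Cell p (D.unit B)
  src_η : D.src η = 𝟙 A
  tgt_η : D.tgt η = f
  src_ε : D.src ε = f
  tgt_ε : D.tgt ε = 𝟙 B
  vertical : D.vcomp η ε = D.unitMap f
  horizontal : D.vcomp (D.leftInv p)
    (D.vcomp (D.hcomp η ε (tgt_η.trans src_ε.symm)) (D.rightHom p)) = D.cid p

/-- Conjoint data exhibiting the proarrow `p` as `f^*`. -/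
structure Conjoint {A B : D.Obj} (f : A ⟶ B) (p : D.Pro B A) where
  η : D.Cell (D.unit A) p
  ε : D.Cell p (D.unit B)
  src_η : D.src η = f
  tgt_η : D.tgt η = 𝟙 A
  src_ε : D.src ε = 𝟙 B
  tgt_ε : D.tgt ε = f
  vertical : D.vcomp η ε = D.unitMap f
  horizontal : D.vcomp (D.rightInv p)
    (D.vcomp (D.hcomp ε η (tgt_ε.trans src_η.symm)) (D.leftHom p)) = D.cid p

/-- An equipment: every arrow has a companion and a conjoint. -/
def IsEquipment : Prop :=
  ∀ ⦃A B : D.Obj⦄ (f : A ⟶ B),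
    (∃ p : D.Pro A B, Nonempty (D.Companion f p)) ∧ ∃ p : D.Pro B A, Nonempty (D.Conjoint f p)

/-- Every invertible arrow has a companion. (The companion of `f⁻¹` is then a conjoint of `f`.) -/
def IsHorizontallyInvariant : Prop :=
  ∀ ⦃A B : D.Obj⦄ (f : A ⟶ B), IsIso f → ∃ p : D.Pro A B, Nonempty (D.Companion f p)

variable {D}

/-- Cartesian cells: cartesian arrows for `⟨src, tgt⟩`; such a cell is a restriction. -/
def IsCartesianCell {A B A' B' : D.Obj} {m : D.Pro A B} {n : D.Pro A' B'} (θ : D.Cell m n) : Prop :=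
  ∀ ⦃X Y : D.Obj⦄ ⦃p : D.Pro X Y⦄ (δ : D.Cell p n) (s : X ⟶ A) (t : Y ⟶ B),
    D.src δ = s ≫ D.src θ → D.tgt δ = t ≫ D.tgt θ →
      ∃! γ : D.Cell p m, D.src γ = s ∧ D.tgt γ = t ∧ D.vcomp γ θ = δ

/-- Opcartesian cells: opcartesian arrows for `⟨src, tgt⟩`; such a cell is an extension. -/
def IsOpcartesianCell {A B A' B' : D.Obj} {m : D.Pro A B} {n : D.Pro A' B'} (θ : D.Cell m n) :
    Prop :=
  ∀ ⦃X Y : D.Obj⦄ ⦃p : D.Pro X Y⦄ (δ : D.Cell m p) (s : A' ⟶ X) (t : B' ⟶ Y),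
    D.src δ = D.src θ ≫ s → D.tgt δ = D.tgt θ ≫ t →
      ∃! γ : D.Cell n p, D.src γ = s ∧ D.tgt γ = t ∧ D.vcomp θ γ = δ

/-- `e` is a cover if its cokernel is trivial: the extension of `y_A` along `e`, `e` is `y_E`. -/
def IsCover {A E : D.Obj} (e : A ⟶ E) : Prop := IsOpcartesianCell (D.unitMap e)

/-- `m` is an inclusion if its kernel is trivial: the restriction of `y_B` along `m`, `m` is
`y_A`. -/
def IsInclusion {A B : D.Obj} (m : A ⟶ B) : Prop := IsCartesianCell (D.unitMap m)

/-- The right class of the factorization system whose left class consists of the covers: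
inclusions orthogonal to all covers. -/
def IsRightClass {A B : D.Obj} (m : A ⟶ B) : Prop :=
  IsInclusion m ∧ ∀ ⦃X Y : D.Obj⦄ (e : X ⟶ Y), IsCover e → UniqueLifting e m

/-- The arrow `⟨f, g⟩` into the vertex of a product cone. -/
def pairing {R A B : D.Obj} (f : R ⟶ A) (g : R ⟶ B) {P : BinaryFan A B} (hP : IsLimit P) :
    R ⟶ P.pt := hP.lift (BinaryFan.mk f g)

/-- A relation in `D`: a span `A ← R → B` such that `R ⟶ A × B` is in the right class. -/
def IsRelation {R A B : D.Obj} (f : R ⟶ A) (g : R ⟶ B) : Prop :=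
  ∀ ⦃P : BinaryFan A B⦄ (hP : IsLimit P), IsRightClass (pairing f g hP)

/-- `τ : y_T ⟶ m` exhibits `T`, with legs `src τ` and `tgt τ`, as the tabulator of `m`: it is a
universal arrow from the external unit functor to `m`. -/
def IsTabulator {T A B : D.Obj} {m : D.Pro A B} (τ : D.Cell (D.unit T) m) : Prop :=
  ∀ ⦃X : D.Obj⦄ (σ : D.Cell (D.unit X) m), ∃! t : X ⟶ T, D.vcomp (D.unitMap t) τ = σ

variable (D)

/-- `D` has tabulators: the external unit functor has a right adjoint. -/
def HasTabulators : Prop :=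
  ∀ ⦃A B : D.Obj⦄ (m : D.Pro A B), ∃ (T : D.Obj) (τ : D.Cell (D.unit T) m), IsTabulator τ

/-- Tabulators are strong: every proarrow is the extension of the unit along the legs of its
tabulator, via the tabulating cell. -/
def HasStrongTabulators : Prop :=
  ∀ ⦃T A B : D.Obj⦄ ⦃m : D.Pro A B⦄ (τ : D.Cell (D.unit T) m), IsTabulator τ → IsOpcartesianCell τ

/-- Tabulators are discrete: the legs of each tabulator are jointly an inclusion. -/
def HasDiscreteTabulators : Prop :=
  ∀ ⦃T A B : D.Obj⦄ ⦃m : D.Pro A B⦄ (τ : D.Cell (D.unit T) m), IsTabulator τ →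
    ∀ ⦃P : BinaryFan A B⦄ (hP : IsLimit P), IsInclusion (pairing (D.src τ) (D.tgt τ) hP)

variable {D}

/-- The cell `y_P ≅ y_P ⊗ y_P ⟶ p ⊗ q` induced by cells `σ : y_T ⟶ p`, `ρ : y_U ⟶ q` and
arrows `a : P ⟶ T`, `b : P ⟶ U` that agree on the middle object. -/
def spanCell {P T U A B C : D.Obj} {p : D.Pro A B} {q : D.Pro B C}
    (σ : D.Cell (D.unit T) p) (ρ : D.Cell (D.unit U) q) (a : P ⟶ T) (b : P ⟶ U)
    (h : a ≫ D.tgt σ = b ≫ D.src ρ) : D.Cell (D.unit P) (D.comp p q) :=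
  D.vcomp (D.leftInv (D.unit P))
    (D.hcomp (D.vcomp (D.unitMap a) σ) (D.vcomp (D.unitMap b) ρ) (by simpa using h))

variable (D)

/-- Tabulators are externally functorial. For composable `p`, `q` with tabulators `T`, `U`, let
`e : T ×_B U ⟶ I`, `i : I ⟶ A × C` be the image factorization that defines the composite of the
relations `T` and `U`; then the morphism from `I` to the tabulator `V` of `p ⊗ q` induced by the
universal property of `V` is invertible. -/
def HasFunctorialTabulators : Prop :=
  ∀ ⦃A B C T U V : D.Obj⦄ ⦃p : D.Pro A B⦄ ⦃q : D.Pro B C⦄ (σ : D.Cell (D.unit T) p)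
    (ρ : D.Cell (D.unit U) q) (τ : D.Cell (D.unit V) (D.comp p q)),
    IsTabulator σ → IsTabulator ρ → IsTabulator τ →
    ∀ ⦃Q : D.Obj⦄ (a : Q ⟶ T) (b : Q ⟶ U) (hQ : IsPullback a b (D.tgt σ) (D.src ρ))
      ⦃P : BinaryFan A C⦄ (hP : IsLimit P) ⦃I : D.Obj⦄ (e : Q ⟶ I) (i : I ⟶ P.pt),
      IsCover e → IsRightClass i → e ≫ i = pairing (a ≫ D.src σ) (b ≫ D.tgt ρ) hP →
      ∃ γ : I ⟶ V, D.vcomp (D.unitMap (e ≫ γ)) τ = spanCell σ ρ a b hQ.w ∧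
        γ ≫ pairing (D.src τ) (D.tgt τ) hP = i ∧ IsIso γ

/-- Every relation is the tabulator of its cokernel, i.e. of the extension of the unit along its
two legs. -/
def RelationsAreTabulators : Prop :=
  ∀ ⦃R A B : D.Obj⦄ ⦃k : D.Pro A B⦄ (ξ : D.Cell (D.unit R) k),
    IsOpcartesianCell ξ → IsRelation (D.src ξ) (D.tgt ξ) → IsTabulator ξ

variable {D}

/-- Globular cells: source and target are identities. -/
def IsGlobular {A B : D.Obj} {m n : D.Pro A B} (α : D.Cell m n) : Prop :=
  D.src α = 𝟙 A ∧ D.tgt α = 𝟙 B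

/-- Isomorphism of parallel proarrows, in the category of proarrows `A ⇸ B` and globular cells. -/
def GlobularIso {A B : D.Obj} (m n : D.Pro A B) : Prop :=
  ∃ (α : D.Cell m n) (β : D.Cell n m), IsGlobular α ∧ IsGlobular β ∧
    D.vcomp α β = D.cid m ∧ D.vcomp β α = D.cid n

/-- `π₁` and `π₂` exhibit `k` as the local product `m ∧ n`: the product of `m` and `n` in the
category of proarrows `A ⇸ B` and globular cells. -/
structure IsLocalProduct {A B : D.Obj} {m n k : D.Pro A B} (π₁ : D.Cell k m) (π₂ : D.Cell k n) :
    Prop where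
  globular₁ : IsGlobular π₁
  globular₂ : IsGlobular π₂
  existsUnique_lift : ∀ {l : D.Pro A B} (α : D.Cell l m) (β : D.Cell l n),
    IsGlobular α → IsGlobular β →
      ∃! γ : D.Cell l k, IsGlobular γ ∧ D.vcomp γ π₁ = α ∧ D.vcomp γ π₂ = β

variable (D)

/-- The Frobenius law `r ∧ f^* ⊗ q ≅ f^* ⊗ (f_! ⊗ r ∧ q)`. -/
def SatisfiesFrobenius : Prop :=
  ∀ ⦃A B X : D.Obj⦄ (f : A ⟶ B) (fl : D.Pro A B) (fs : D.Pro B A),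
    D.Companion f fl → D.Conjoint f fs → ∀ (r : D.Pro B X) (q : D.Pro A X)
      (k : D.Pro B X) (π₁ : D.Cell k r) (π₂ : D.Cell k (D.comp fs q))
      (l : D.Pro A X) (κ₁ : D.Cell l (D.comp fl r)) (κ₂ : D.Cell l q),
      IsLocalProduct π₁ π₂ → IsLocalProduct κ₁ κ₂ → GlobularIso k (D.comp fs l)

end PseudoDoubleCategory

/-! Everything is read through generalized elements: a pair `(a, b)` of arrows out of `X` belongs to
a proarrow `m` (`Mem`) if some cell from the unit of `X` to `m` has boundary `(a, b)`. For relations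
this means that `(a, b)` factors through the span, and the double structure turns into logic: cells
are implications, the unit is equality, a composite is an existential quantifier whose witness may
exist only on an `E`-cover, and proarrows correspond to jointly right spans. `IsRelational` records
these rules and is the hinge of both directions. Since cells are then determined by their boundary,
all coherence is automatic, and matching proarrows with tabulating spans gives the equivalence with
relations (`IsRelational.doubleEquivalent`).

Necessity: relations are relational (`relDbl_isRelational`), and the property passes along an
equivalence (`IsRelational.of_doubleEquivalent`). There companions of isomorphisms are needed,
because a proarrow brought back by the equivalence has endpoints that are only isomorphic to the
prescribed ones. The conditions of the theorem are then checked on elements.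

Sufficiency: unit-purity and strong discrete tabulators make cells unique over their boundary and
turn them into implications (`isThin_of_hasTabulators`, `cellOver_of_mem`). The tabulator of `f_! ⊗
g^*` is a pullback, so finite limits exist. Take `E` to be the covers and `M` the inclusions
orthogonal to them. A cover is an arrow along which membership in every proarrow descends.

The image of `f : A ⟶ B` is the tabulator of the extension of the unit along `A ⟶ 1` and `f`. That
`A` covers it is the main point of `exists_fac`: the part of the image where a given membership
holds is again a relation between `1` and `B`, hence the tabulator of its cokernel by condition 3;
if `A` factors through this part, the cokernel of `f` maps to that of the part, so the part is
everything.

Functoriality of tabulators yields the existential reading of composites. Applied to `e^* ⊗ (e_! ⊗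
g^*)` it also makes covers stable under pullback (`isCover_of_isPullback`). -/

open PseudoDoubleCategory

/-! ### Orthogonal factorization systems -/

namespace FactorizationSystem

variable {C : Type u} [Category.{v} C] (F : FactorizationSystem C)

/-- An arrow orthogonal to `E` is in `M`. -/
theorem mem_M_of_uniqueLifting {A B : C} (m : A ⟶ B)
    (h : ∀ ⦃X Y : C⦄ (e : X ⟶ Y), F.E e → UniqueLifting e m) : F.M m := by
  obtain ⟨I, e, i, he, hi, rfl⟩ := F.exists_fac m
  obtain ⟨d, ⟨h₁, h₂⟩, -⟩ := h e he (𝟙 A) i (Category.id_comp _)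
  -- Both `d ≫ e` and the identity fill the square from `e` to `i`, so the `E`-part of `m` is
  -- invertible.
  have h₃ : d ≫ e = 𝟙 I :=
    (F.orthogonal e i he hi e i rfl).unique
      ⟨by rw [← Category.assoc, h₁, Category.id_comp], by rw [Category.assoc, h₂]⟩
      ⟨Category.comp_id _, Category.id_comp _⟩
  have : IsIso e := ⟨d, h₁, h₃⟩
  exact F.comp_M _ _ (F.iso_M e this) hi

/-- The legs of a span are jointly right if they are jointly orthogonal to `E`. -/
def IsJointlyRight {R A B : C} (l : R ⟶ A) (r : R ⟶ B) : Prop :=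
  ∀ ⦃X Y : C⦄ (e : X ⟶ Y), F.E e → ∀ (s : X ⟶ R) (a : Y ⟶ A) (b : Y ⟶ B),
    s ≫ l = e ≫ a → s ≫ r = e ≫ b → ∃! d : Y ⟶ R, e ≫ d = s ∧ d ≫ l = a ∧ d ≫ r = b

variable {F}

/-- A square into a product is a pair of squares. This allows relations to be handled by their legs
alone, with no choice of product. -/
theorem isJointlyRight_iff {R A B Q : C} {p : Q ⟶ A} {q : Q ⟶ B}
    (hQ : IsLimit (BinaryFan.mk p q)) (u : R ⟶ Q) :
    F.IsJointlyRight (u ≫ p) (u ≫ q) ↔ F.M u := by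
  have ext {Y : C} {s t : Y ⟶ Q} (h₁ : s ≫ p = t ≫ p) (h₂ : s ≫ q = t ≫ q) : s = t :=
    BinaryFan.IsLimit.hom_ext hQ h₁ h₂
  constructor
  · refine fun h => F.mem_M_of_uniqueLifting u fun X Y e he s t hst => ?_
    obtain ⟨d, ⟨h₁, h₂, h₃⟩, hu⟩ := h e he s (t ≫ p) (t ≫ q)
      (by rw [← Category.assoc, hst, Category.assoc])
      (by rw [← Category.assoc, hst, Category.assoc])
    refine ⟨d, ⟨h₁, ext (by rw [Category.assoc, h₂]) (by rw [Category.assoc, h₃])⟩, ?_⟩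
    rintro d' ⟨h₁', rfl⟩
    exact hu d' ⟨h₁', by simp, by simp⟩
  · intro h X Y e he s a b ha hb
    obtain ⟨t, rfl, rfl⟩ : ∃ t : Y ⟶ Q, t ≫ p = a ∧ t ≫ q = b :=
      ⟨_, (BinaryFan.IsLimit.lift' hQ a b).2⟩
    obtain ⟨d, ⟨h₁, rfl⟩, hu⟩ := F.orthogonal e u he h s t
      (ext (by simpa using ha) (by simpa using hb))
    refine ⟨d, ⟨h₁, by simp, by simp⟩, ?_⟩
    rintro d' ⟨h₁', h₂', h₃'⟩
    exact hu d' ⟨h₁', ext (by simpa using h₂') (by simpa using h₃')⟩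

theorem isJointlyRight_iff_prod_lift [HasFiniteLimits C] {R A B : C} (l : R ⟶ A) (r : R ⟶ B) :
    F.IsJointlyRight l r ↔ F.M (prod.lift l r) := by
  simpa only [prod.lift_fst, prod.lift_snd] using
    isJointlyRight_iff (F := F) (prodIsProd A B) (prod.lift l r)

theorem Relation.isJointlyRight [HasFiniteLimits C] {A B : C} (R : F.Relation A B) :
    F.IsJointlyRight R.l R.r :=
  (isJointlyRight_iff_prod_lift _ _).2 R.mem

/-- Jointly right legs are jointly monic. -/
theorem IsJointlyRight.hom_ext [HasFiniteLimits C] (hF : F.IsProper) {R A B X : C} {l : R ⟶ A}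
    {r : R ⟶ B} (h : F.IsJointlyRight l r) {s t : X ⟶ R} (hl : s ≫ l = t ≫ l)
    (hr : s ≫ r = t ≫ r) : s = t := by
  have := hF.mono _ ((isJointlyRight_iff_prod_lift l r).1 h)
  rw [← cancel_mono (prod.lift l r)]
  ext
  · rw [Category.assoc, Category.assoc, prod.lift_fst, hl]
  · rw [Category.assoc, Category.assoc, prod.lift_snd, hr]

/-- For a proper factorization system the graph of an arrow is a relation. -/
theorem isJointlyRight_graph (hF : F.IsProper) {A B : C} (f : A ⟶ B) :
    F.IsJointlyRight (𝟙 A) f := by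
  intro X Y e he s a b ha hb
  have := hF.epi e he
  rw [Category.comp_id] at ha
  subst ha
  -- The identity leg forces the filler to be `a`; the other leg agrees because `e` is epic.
  refine ⟨a, ⟨rfl, Category.comp_id _, ?_⟩, fun d hd => by simpa using hd.2.1⟩
  rwa [Category.assoc, cancel_epi] at hb

theorem IsJointlyRight.symm {R A B : C} {l : R ⟶ A} {r : R ⟶ B} (h : F.IsJointlyRight l r) :
    F.IsJointlyRight r l := fun X Y e he s a b ha hb => by
  obtain ⟨d, ⟨h₁, h₂, h₃⟩, hu⟩ := h e he s b a hb ha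
  exact ⟨d, ⟨h₁, h₃, h₂⟩, fun d' hd' => hu d' ⟨hd'.1, hd'.2.2, hd'.2.1⟩⟩

theorem IsJointlyRight.of_iso {R S A B : C} {l : R ⟶ A} {r : R ⟶ B}
    (h : F.IsJointlyRight l r) (i : S ≅ R) : F.IsJointlyRight (i.hom ≫ l) (i.hom ≫ r) := by
  intro X Y e he s a b ha hb
  obtain ⟨d, ⟨h₁, h₂, h₃⟩, hu⟩ := h e he (s ≫ i.hom) a b (by simpa using ha) (by simpa using hb)
  refine ⟨d ≫ i.inv, ⟨by rw [← Category.assoc, h₁]; simp, by simpa using h₂, by simpa using h₃⟩, ?_⟩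
  rintro d' ⟨h₁', h₂', h₃'⟩
  rw [Iso.eq_comp_inv]
  exact hu _ ⟨by rw [← Category.assoc, h₁'], by simpa using h₂', by simpa using h₃'⟩

end FactorizationSystem

/-! ### Cells over a given boundary -/

namespace PseudoDoubleCategory

variable {D : PseudoDoubleCategory.{u, v, w, z}}

/-- There is a cell `m ⟶ n` with source `f` and target `g`. -/
def CellOver {A B A' B' : D.Obj} (m : D.Pro A B) (n : D.Pro A' B') (f : A ⟶ A') (g : B ⟶ B') :
    Prop :=
  ∃ α : D.Cell m n, D.src α = f ∧ D.tgt α = g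

/-- The pair `(a, b)` is a generalized element of the proarrow `m`. -/
abbrev Mem {X A B : D.Obj} (m : D.Pro A B) (a : X ⟶ A) (b : X ⟶ B) : Prop :=
  CellOver (D.unit X) m a b

variable (D) in
/-- Cells are determined by their boundary. -/
def IsThin : Prop :=
  ∀ ⦃A B A' B' : D.Obj⦄ ⦃m : D.Pro A B⦄ ⦃n : D.Pro A' B'⦄ (α β : D.Cell m n),
    D.src α = D.src β → D.tgt α = D.tgt β → α = β

-- Only the boundary of `leftHom` is part of the structure; the inverse cell gets its own from the
-- inverse law.
@[simp]
theorem src_leftInv {A B : D.Obj} (m : D.Pro A B) : D.src (D.leftInv m) = 𝟙 A := by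
  have h := congrArg D.src (D.leftHom_inv m)
  rwa [D.src_vcomp, D.src_leftHom, D.src_cid, Category.id_comp] at h

@[simp]
theorem tgt_leftInv {A B : D.Obj} (m : D.Pro A B) : D.tgt (D.leftInv m) = 𝟙 B := by
  have h := congrArg D.tgt (D.leftHom_inv m)
  rwa [D.tgt_vcomp, D.tgt_leftHom, D.tgt_cid, Category.id_comp] at h

@[simp]
theorem src_rightInv {A B : D.Obj} (m : D.Pro A B) : D.src (D.rightInv m) = 𝟙 A := by
  have h := congrArg D.src (D.rightHom_inv m)
  rwa [D.src_vcomp, D.src_rightHom, D.src_cid, Category.id_comp] at h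

@[simp]
theorem tgt_rightInv {A B : D.Obj} (m : D.Pro A B) : D.tgt (D.rightInv m) = 𝟙 B := by
  have h := congrArg D.tgt (D.rightHom_inv m)
  rwa [D.tgt_vcomp, D.tgt_rightHom, D.tgt_cid, Category.id_comp] at h

namespace CellOver

/-- A chosen cell over a given boundary. -/
noncomputable def cell {A B A' B' : D.Obj} {m : D.Pro A B} {n : D.Pro A' B'} {f : A ⟶ A'}
    {g : B ⟶ B'} (h : CellOver m n f g) : D.Cell m n := h.choose

@[simp]
theorem src_cell {A B A' B' : D.Obj} {m : D.Pro A B} {n : D.Pro A' B'} {f : A ⟶ A'}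
    {g : B ⟶ B'} (h : CellOver m n f g) : D.src h.cell = f := h.choose_spec.1

@[simp]
theorem tgt_cell {A B A' B' : D.Obj} {m : D.Pro A B} {n : D.Pro A' B'} {f : A ⟶ A'}
    {g : B ⟶ B'} (h : CellOver m n f g) : D.tgt h.cell = g := h.choose_spec.2

theorem of_cell {A B A' B' : D.Obj} {m : D.Pro A B} {n : D.Pro A' B'} (α : D.Cell m n) :
    CellOver m n (D.src α) (D.tgt α) := ⟨α, rfl, rfl⟩

theorem refl {A B : D.Obj} (m : D.Pro A B) : CellOver m m (𝟙 A) (𝟙 B) := ⟨D.cid m, by simp, by simp⟩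

theorem unitMap {A B : D.Obj} (f : A ⟶ B) : CellOver (D.unit A) (D.unit B) f f :=
  ⟨D.unitMap f, by simp, by simp⟩

theorem trans {A B A' B' A'' B'' : D.Obj} {m : D.Pro A B} {n : D.Pro A' B'} {p : D.Pro A'' B''}
    {f : A ⟶ A'} {g : B ⟶ B'} {f' : A' ⟶ A''} {g' : B' ⟶ B''} (h : CellOver m n f g)
    (h' : CellOver n p f' g') : CellOver m p (f ≫ f') (g ≫ g') := by
  obtain ⟨α, rfl, rfl⟩ := h
  obtain ⟨β, rfl, rfl⟩ := h'
  exact ⟨D.vcomp α β, by simp, by simp⟩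

theorem cast {A B A' B' : D.Obj} {m : D.Pro A B} {n : D.Pro A' B'} {f f' : A ⟶ A'} {g g' : B ⟶ B'}
    (h : CellOver m n f g) (hf : f = f') (hg : g = g') : CellOver m n f' g' := by
  subst hf hg; exact h

theorem trans_globular {A B A' B' : D.Obj} {m : D.Pro A B} {n p : D.Pro A' B'}
    {f : A ⟶ A'} {g : B ⟶ B'} (h : CellOver m n f g) (h' : CellOver n p (𝟙 A') (𝟙 B')) :
    CellOver m p f g :=
  (h.trans h').cast (Category.comp_id _) (Category.comp_id _)

theorem globular_trans {A B A' B' : D.Obj} {m n : D.Pro A B} {p : D.Pro A' B'}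
    {f : A ⟶ A'} {g : B ⟶ B'} (h : CellOver m n (𝟙 A) (𝟙 B)) (h' : CellOver n p f g) :
    CellOver m p f g :=
  (h.trans h').cast (Category.id_comp _) (Category.id_comp _)

/-- Generalized elements can be restricted. -/
theorem restrict {X Y A B : D.Obj} {m : D.Pro A B} {a : X ⟶ A} {b : X ⟶ B} (h : Mem m a b)
    (t : Y ⟶ X) : Mem m (t ≫ a) (t ≫ b) :=
  (unitMap t).trans h

theorem hcomp {A B C A' B' C' : D.Obj} {m : D.Pro A B} {n : D.Pro B C} {m' : D.Pro A' B'}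
    {n' : D.Pro B' C'} {f : A ⟶ A'} {g : B ⟶ B'} {k : C ⟶ C'} (h : CellOver m m' f g)
    (h' : CellOver n n' g k) : CellOver (D.comp m n) (D.comp m' n') f k := by
  obtain ⟨α, rfl, rfl⟩ := h
  obtain ⟨β, hβ, rfl⟩ := h'
  exact ⟨D.hcomp α β hβ.symm, by simp, by simp⟩

theorem assocHom {A B C E : D.Obj} (m : D.Pro A B) (n : D.Pro B C) (p : D.Pro C E) :
    CellOver (D.comp (D.comp m n) p) (D.comp m (D.comp n p)) (𝟙 A) (𝟙 E) :=
  ⟨D.assocHom m n p, by simp, by simp⟩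

theorem leftHom {A B : D.Obj} (m : D.Pro A B) : CellOver (D.comp (D.unit A) m) m (𝟙 A) (𝟙 B) :=
  ⟨D.leftHom m, by simp, by simp⟩

theorem leftInv {A B : D.Obj} (m : D.Pro A B) : CellOver m (D.comp (D.unit A) m) (𝟙 A) (𝟙 B) :=
  ⟨D.leftInv m, by simp, by simp⟩

theorem rightHom {A B : D.Obj} (m : D.Pro A B) : CellOver (D.comp m (D.unit B)) m (𝟙 A) (𝟙 B) :=
  ⟨D.rightHom m, by simp, by simp⟩

theorem rightInv {A B : D.Obj} (m : D.Pro A B) : CellOver m (D.comp m (D.unit B)) (𝟙 A) (𝟙 B) :=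
  ⟨D.rightInv m, by simp, by simp⟩

/-- Generalized elements of composable proarrows compose. -/
theorem mem_comp {X A B C : D.Obj} {m : D.Pro A B} {n : D.Pro B C} {a : X ⟶ A} {b : X ⟶ B}
    {c : X ⟶ C} (h : Mem m a b) (h' : Mem n b c) : Mem (D.comp m n) a c :=
  (leftInv _).globular_trans (h.hcomp h')

end CellOver

/-- The binding cells of companions and conjoints act as introduction and elimination rules: `η`
puts the graph of `f` into the proarrow, and `ε` sends an element of it to an element of the unit,
which is an equation once units are equality. -/
theorem Companion.cellOver_η {A B : D.Obj} {f : A ⟶ B} {p : D.Pro A B} (c : D.Companion f p) :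
    Mem p (𝟙 A) f := ⟨c.η, c.src_η, c.tgt_η⟩

theorem Companion.cellOver_ε {A B : D.Obj} {f : A ⟶ B} {p : D.Pro A B} (c : D.Companion f p) :
    CellOver p (D.unit B) f (𝟙 B) := ⟨c.ε, c.src_ε, c.tgt_ε⟩

theorem Conjoint.cellOver_η {A B : D.Obj} {f : A ⟶ B} {p : D.Pro B A} (c : D.Conjoint f p) :
    Mem p f (𝟙 A) := ⟨c.η, c.src_η, c.tgt_η⟩

theorem Conjoint.cellOver_ε {A B : D.Obj} {f : A ⟶ B} {p : D.Pro B A} (c : D.Conjoint f p) :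
    CellOver p (D.unit B) (𝟙 B) f := ⟨c.ε, c.src_ε, c.tgt_ε⟩

end PseudoDoubleCategory

/-! ### Double functors into thin double categories -/


/-- A double functor into a thin double category can be given by the existence of its structure
cells. -/
noncomputable def DoubleFunctor.ofThin {D : PseudoDoubleCategory.{u₁, v₁, w₁, z₁}}
    {E : PseudoDoubleCategory.{u₂, v₂, w₂, z₂}} (hE : E.IsThin) (fnc : D.Obj ⥤ E.Obj)
    (pro : ∀ {A B : D.Obj}, D.Pro A B → E.Pro (fnc.obj A) (fnc.obj B))
    (cell : ∀ {A B A' B' : D.Obj} {m : D.Pro A B} {n : D.Pro A' B'} (α : D.Cell m n),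
      CellOver (pro m) (pro n) (fnc.map (D.src α)) (fnc.map (D.tgt α)))
    (unitHom : ∀ A : D.Obj, CellOver (E.unit (fnc.obj A)) (pro (D.unit A)) (𝟙 _) (𝟙 _))
    (unitInv : ∀ A : D.Obj, CellOver (pro (D.unit A)) (E.unit (fnc.obj A)) (𝟙 _) (𝟙 _))
    (compHom : ∀ {A B C : D.Obj} (m : D.Pro A B) (n : D.Pro B C),
      CellOver (E.comp (pro m) (pro n)) (pro (D.comp m n)) (𝟙 _) (𝟙 _))
    (compInv : ∀ {A B C : D.Obj} (m : D.Pro A B) (n : D.Pro B C),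
      CellOver (pro (D.comp m n)) (E.comp (pro m) (pro n)) (𝟙 _) (𝟙 _)) :
    DoubleFunctor D E where
  fnc := fnc
  pro := pro
  cell α := (cell α).cell
  src_cell α := (cell α).src_cell
  tgt_cell α := (cell α).tgt_cell
  cell_cid m := hE _ _ (by simp) (by simp)
  cell_vcomp α β := hE _ _ (by simp) (by simp)
  unitHom A := (unitHom A).cell
  unitInv A := (unitInv A).cell
  src_unitHom A := (unitHom A).src_cell
  tgt_unitHom A := (unitHom A).tgt_cell
  unitHom_inv A := hE _ _ (by simp) (by simp)
  unitInv_hom A := hE _ _ (by simp) (by simp)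
  unit_naturality f := hE _ _ (by simp) (by simp)
  compHom m n := (compHom m n).cell
  compInv m n := (compInv m n).cell
  src_compHom m n := (compHom m n).src_cell
  tgt_compHom m n := (compHom m n).tgt_cell
  compHom_inv m n := hE _ _ (by simp) (by simp)
  compInv_hom m n := hE _ _ (by simp) (by simp)
  comp_naturality α β h := hE _ _ (by simp) (by simp)
  map_assoc m n p := hE _ _ (by simp) (by simp)
  map_left m := hE _ _ (by simp) (by simp)
  map_right m := hE _ _ (by simp) (by simp)

/-- A transformation of double functors into a thin double category can be given by the existence
of its component cells. -/
noncomputable def DoubleTrans.ofThin {D : PseudoDoubleCategory.{u₁, v₁, w₁, z₁}}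
    {E : PseudoDoubleCategory.{u₂, v₂, w₂, z₂}} (hE : E.IsThin) {F G : DoubleFunctor D E}
    (app : F.fnc ⟶ G.fnc)
    (capp : ∀ {A B : D.Obj} (m : D.Pro A B),
      CellOver (F.pro m) (G.pro m) (app.app A) (app.app B)) :
    DoubleTrans F G where
  app := app
  capp m := (capp m).cell
  src_capp m := (capp m).src_cell
  tgt_capp m := (capp m).tgt_cell
  naturality α := hE _ _ (by simp) (by simp)
  unit_coh A := hE _ _ (by simp) (by simp)
  comp_coh m n := hE _ _ (by simp) (by simp)

theorem DoubleTrans.isInvertible_of_thin {D : PseudoDoubleCategory.{u₁, v₁, w₁, z₁}}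
    {E : PseudoDoubleCategory.{u₂, v₂, w₂, z₂}} (hE : E.IsThin) {F G : DoubleFunctor D E}
    (σ : DoubleTrans F G) (τ : DoubleTrans G F)
    (h : ∀ A : D.Obj, σ.app.app A ≫ τ.app.app A = 𝟙 _ ∧ τ.app.app A ≫ σ.app.app A = 𝟙 _) :
    σ.IsInvertible :=
  ⟨τ, h, fun A B m => ⟨hE _ _ (by simp [σ.src_capp, τ.src_capp, h])
      (by simp [σ.tgt_capp, τ.tgt_capp, h]), hE _ _ (by simp [σ.src_capp, τ.src_capp, h])
      (by simp [σ.tgt_capp, τ.tgt_capp, h])⟩⟩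

/-! ### Relational double categories -/

namespace PseudoDoubleCategory

variable {D : PseudoDoubleCategory.{u, v, w, z}}

/-- The generalized elements of `m` are those that factor through the span `(l, r)`. -/
def Tabulates {T A B : D.Obj} (l : T ⟶ A) (r : T ⟶ B) (m : D.Pro A B) : Prop :=
  ∀ ⦃X : D.Obj⦄ (a : X ⟶ A) (b : X ⟶ B), Mem m a b ↔ ∃ t : X ⟶ T, t ≫ l = a ∧ t ≫ r = b

theorem Tabulates.mem {T A B : D.Obj} {l : T ⟶ A} {r : T ⟶ B} {m : D.Pro A B}
    (h : Tabulates l r m) : Mem m l r :=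
  (h l r).2 ⟨𝟙 T, Category.id_comp _, Category.id_comp _⟩

/-- The proarrows of `D` are relations for the factorization system `F`, described by their
generalized elements. -/
structure IsRelational (D : PseudoDoubleCategory.{u, v, w, z}) (F : FactorizationSystem D.Obj) :
    Prop where
  proper : F.IsProper
  stable : F.IsStable
  thin : D.IsThin
  cellOver : ∀ {A B A' B' : D.Obj} {m : D.Pro A B} {n : D.Pro A' B'} {f : A ⟶ A'} {g : B ⟶ B'},
    (∀ ⦃X : D.Obj⦄ (a : X ⟶ A) (b : X ⟶ B), Mem m a b → Mem n (a ≫ f) (b ≫ g)) → CellOver m n f g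
  mem_unit : ∀ {A X : D.Obj} {a b : X ⟶ A}, Mem (D.unit A) a b → a = b
  mem_comp : ∀ {A B C X : D.Obj} {m : D.Pro A B} {n : D.Pro B C} (a : X ⟶ A) (c : X ⟶ C),
    Mem (D.comp m n) a c ↔
      ∃ (Y : D.Obj) (e : Y ⟶ X) (b : Y ⟶ B), F.E e ∧ Mem m (e ≫ a) b ∧ Mem n b (e ≫ c)
  exists_tabulates : ∀ {A B : D.Obj} (m : D.Pro A B),
    ∃ (T : D.Obj) (l : T ⟶ A) (r : T ⟶ B), F.IsJointlyRight l r ∧ Tabulates l r m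
  exists_pro : ∀ {R A B : D.Obj} (l : R ⟶ A) (r : R ⟶ B), F.IsJointlyRight l r →
    ∃ m : D.Pro A B, Tabulates l r m

end PseudoDoubleCategory

/-! ### Relations form a relational double category -/

namespace FactorizationSystem

variable {C : Type u} [Category.{v} C] [HasFiniteLimits C] (F : FactorizationSystem C)
  (hF : F.IsProper) (hs : F.IsStable)

theorem relDbl_tabulates {A B : C} (R : F.Relation A B) :
    Tabulates (D := F.RelDbl hF hs) (A := A) (B := B) R.l R.r R := by
  intro X a b
  constructor
  · rintro ⟨α, rfl, rfl⟩
    exact ⟨α.hom, by simpa using α.hom_l, by simpa using α.hom_r⟩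
  · rintro ⟨t, rfl, rfl⟩
    exact ⟨⟨t ≫ R.l, t ≫ R.r, t, by simp, by simp⟩, rfl, rfl⟩

theorem relDbl_mem_iff {A B X : C} (R : F.Relation A B) (a : X ⟶ A) (b : X ⟶ B) :
    Mem (D := F.RelDbl hF hs) (A := A) (B := B) (X := X) R a b ↔
      ∃ t : X ⟶ R.apex, t ≫ R.l = a ∧ t ≫ R.r = b :=
  relDbl_tabulates F hF hs R a b

/-- The double category of relations is relational. -/
theorem relDbl_isRelational : (F.RelDbl hF hs).IsRelational F where
  proper := hF
  stable := hs
  thin A B A' B' m n α β h h' := RelCell.ext_of_proper hF h h'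
  cellOver {A B A' B' m n f g} h := by
    -- By the Yoneda argument it suffices to test the universal element, given by the legs of `m`.
    obtain ⟨t, ht, ht'⟩ := (relDbl_mem_iff F hF hs n _ _).1
      (h m.l m.r (relDbl_tabulates F hF hs m).mem)
    exact ⟨⟨f, g, t, ht, ht'⟩, rfl, rfl⟩
  mem_unit {A X a b} h := by
    obtain ⟨t, rfl, rfl⟩ := (relDbl_mem_iff F hF hs _ a b).1 h
    rfl
  mem_comp {A B Z X R S} a c := by
    rw [relDbl_mem_iff]
    constructor
    · rintro ⟨t, rfl, rfl⟩
      -- The middle element exists on `R ×_B S`; stability makes the pullback of the quotient map a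
      -- cover of `X` on which it can be used.
      refine ⟨pullback t (R.quot S), pullback.fst _ _, pullback.snd _ _ ≫ pullback.fst _ _ ≫ R.r,
        hs _ _ _ _ (IsPullback.of_hasPullback t (R.quot S)) (R.quot_mem S), ?_, ?_⟩
      · rw [relDbl_mem_iff]
        refine ⟨pullback.snd _ _ ≫ pullback.fst _ _, ?_, Category.assoc _ _ _⟩
        rw [Category.assoc, ← Relation.quot_l, ← pullback.condition_assoc]
      · rw [relDbl_mem_iff]
        refine ⟨pullback.snd _ _ ≫ pullback.snd _ _, ?_, ?_⟩
        · rw [Category.assoc, ← pullback.condition]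
        · rw [Category.assoc, ← Relation.quot_r, ← pullback.condition_assoc]
    · rintro ⟨Y, e, b, he, h, h'⟩
      obtain ⟨t, ht, rfl⟩ := (relDbl_mem_iff F hF hs _ _ _).1 h
      obtain ⟨t', ht', ht''⟩ := (relDbl_mem_iff F hF hs _ _ _).1 h'
      -- Conversely, an element of the composite that is defined on a cover descends, since the legs
      -- are orthogonal to `E`.
      obtain ⟨d, ⟨-, hd, hd'⟩, -⟩ := (R.comp S).isJointlyRight e he
        (pullback.lift t t' ht'.symm ≫ R.quot S) a c
        (by rw [Category.assoc, Relation.quot_l, pullback.lift_fst_assoc, ht])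
        (by rw [Category.assoc, Relation.quot_r, pullback.lift_snd_assoc, ht''])
      exact ⟨d, hd, hd'⟩
  exists_tabulates R := ⟨R.apex, R.l, R.r, R.isJointlyRight, relDbl_tabulates F hF hs R⟩
  exists_pro l r h :=
    ⟨⟨_, l, r, (isJointlyRight_iff_prod_lift _ _).1 h⟩, relDbl_tabulates F hF hs _⟩

end FactorizationSystem

/-! ### Relational double categories are double categories of relations -/

namespace PseudoDoubleCategory.IsRelational

variable {D : PseudoDoubleCategory.{u, v, w, z}} {F : FactorizationSystem D.Obj}

/-- Membership is local for covers. -/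
theorem mem_of_cover (H : D.IsRelational F) {X Y A B : D.Obj} {m : D.Pro A B} (e : Y ⟶ X)
    (he : F.E e) {a : X ⟶ A} {b : X ⟶ B} (h : Mem m (e ≫ a) (e ≫ b)) : Mem m a b := by
  obtain ⟨T, l, r, hlr, hT⟩ := H.exists_tabulates m
  obtain ⟨t, ht, ht'⟩ := (hT _ _).1 h
  obtain ⟨d, ⟨-, hd, hd'⟩, -⟩ := hlr e he t a b ht ht'
  exact (hT _ _).2 ⟨d, hd, hd'⟩

theorem mem_unit_iff (H : D.IsRelational F) {A X : D.Obj} {a b : X ⟶ A} :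
    Mem (D.unit A) a b ↔ a = b :=
  ⟨H.mem_unit, by rintro rfl; exact CellOver.unitMap a⟩

theorem cellOver_iff (H : D.IsRelational F) {A B A' B' : D.Obj} {m : D.Pro A B} {n : D.Pro A' B'}
    {f : A ⟶ A'} {g : B ⟶ B'} : CellOver m n f g ↔
      ∀ ⦃X : D.Obj⦄ (a : X ⟶ A) (b : X ⟶ B), Mem m a b → Mem n (a ≫ f) (b ≫ g) :=
  ⟨fun h _ _ _ h' => h'.trans h, H.cellOver⟩

theorem cellOver_globular_iff (H : D.IsRelational F) {A B : D.Obj} {m n : D.Pro A B} :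
    CellOver m n (𝟙 A) (𝟙 B) ↔
      ∀ ⦃X : D.Obj⦄ (a : X ⟶ A) (b : X ⟶ B), Mem m a b → Mem n a b := by
  rw [H.cellOver_iff]
  simp only [Category.comp_id]

/-- A relational double category is equivalent to the double category of relations. -/
theorem doubleEquivalent [HasFiniteLimits D.Obj] (H : D.IsRelational F) :
    DoubleEquivalent D (F.RelDbl H.proper H.stable) := by
  have HE := F.relDbl_isRelational H.proper H.stable
  -- Proarrows and relations are matched by having the same elements. Both double functors are then
  -- the identity on objects and arrows, and each structure cell is an implication between
  -- memberships.
  have h₁ : ∀ {A B : D.Obj} (m : D.Pro A B), ∃ R : F.Relation A B, ∀ {X : D.Obj} (a : X ⟶ A)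
      (b : X ⟶ B), Mem (D := F.RelDbl H.proper H.stable) (A := A) (B := B) (X := X) R a b ↔
        Mem m a b := fun m => by
    obtain ⟨T, l, r, hlr, hT⟩ := H.exists_tabulates m
    exact ⟨⟨T, l, r, (FactorizationSystem.isJointlyRight_iff_prod_lift _ _).1 hlr⟩, fun a b => by
      rw [FactorizationSystem.relDbl_mem_iff, hT]⟩
  have h₂ : ∀ {A B : D.Obj} (R : F.Relation A B), ∃ m : D.Pro A B, ∀ {X : D.Obj} (a : X ⟶ A)
      (b : X ⟶ B), Mem m a b ↔
        Mem (D := F.RelDbl H.proper H.stable) (A := A) (B := B) (X := X) R a b := fun R => by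
    obtain ⟨m, hm⟩ := H.exists_pro R.l R.r R.isJointlyRight
    exact ⟨m, fun a b => by rw [FactorizationSystem.relDbl_mem_iff, hm]⟩
  choose rel hrel using @h₁
  choose pro hpro using @h₂
  let Φ : DoubleFunctor D (F.RelDbl H.proper H.stable) := DoubleFunctor.ofThin HE.thin (𝟭 _)
    (fun m => rel m)
    (fun α => HE.cellOver_iff.2 fun X a b h =>
      (hrel _ _ _).2 (H.cellOver_iff.1 (CellOver.of_cell α) _ _ ((hrel _ _ _).1 h)))
    (fun A => HE.cellOver_globular_iff.2 fun X a b h =>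
      (hrel _ _ _).2 (H.mem_unit_iff.2 (HE.mem_unit_iff.1 h)))
    (fun A => HE.cellOver_globular_iff.2 fun X a b h =>
      HE.mem_unit_iff.2 (H.mem_unit_iff.1 ((hrel _ _ _).1 h)))
    (fun m n => HE.cellOver_globular_iff.2 fun X a b h => (hrel _ _ _).2 ((H.mem_comp _ _).2 (by
      obtain ⟨Y, e, c, he, hc, hc'⟩ := (HE.mem_comp _ _).1 h
      exact ⟨Y, e, c, he, (hrel _ _ _).1 hc, (hrel _ _ _).1 hc'⟩)))
    (fun m n => HE.cellOver_globular_iff.2 fun X a b h => (HE.mem_comp _ _).2 (by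
      obtain ⟨Y, e, c, he, hc, hc'⟩ := (H.mem_comp _ _).1 ((hrel _ _ _).1 h)
      exact ⟨Y, e, c, he, (hrel _ _ _).2 hc, (hrel _ _ _).2 hc'⟩))
  let Ψ : DoubleFunctor (F.RelDbl H.proper H.stable) D := DoubleFunctor.ofThin H.thin (𝟭 _)
    (fun R => pro R)
    (fun α => H.cellOver_iff.2 fun X a b h =>
      (hpro _ _ _).2 (HE.cellOver_iff.1 (CellOver.of_cell α) _ _ ((hpro _ _ _).1 h)))
    (fun A => H.cellOver_globular_iff.2 fun X a b h =>
      (hpro _ _ _).2 (HE.mem_unit_iff.2 (H.mem_unit_iff.1 h)))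
    (fun A => H.cellOver_globular_iff.2 fun X a b h =>
      H.mem_unit_iff.2 (HE.mem_unit_iff.1 ((hpro _ _ _).1 h)))
    (fun m n => H.cellOver_globular_iff.2 fun X a b h => (hpro _ _ _).2 ((HE.mem_comp _ _).2 (by
      obtain ⟨Y, e, c, he, hc, hc'⟩ := (H.mem_comp _ _).1 h
      exact ⟨Y, e, c, he, (hpro _ _ _).1 hc, (hpro _ _ _).1 hc'⟩)))
    (fun m n => H.cellOver_globular_iff.2 fun X a b h => (H.mem_comp _ _).2 (by
      obtain ⟨Y, e, c, he, hc, hc'⟩ := (HE.mem_comp _ _).1 ((hpro _ _ _).1 h)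
      exact ⟨Y, e, c, he, (hpro _ _ _).2 hc, (hpro _ _ _).2 hc'⟩))
  let η : DoubleTrans (DoubleFunctor.id D) (Φ.comp Ψ) := DoubleTrans.ofThin H.thin
    (𝟙 (𝟭 D.Obj)) fun m => H.cellOver_globular_iff.2 fun X a b h =>
      (hpro _ _ _).2 ((hrel _ _ _).2 h)
  let η' : DoubleTrans (Φ.comp Ψ) (DoubleFunctor.id D) := DoubleTrans.ofThin H.thin
    (𝟙 (𝟭 D.Obj)) fun m => H.cellOver_globular_iff.2 fun X a b h =>
      (hrel _ _ _).1 ((hpro _ _ _).1 h)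
  let ε : DoubleTrans (Ψ.comp Φ) (DoubleFunctor.id (F.RelDbl H.proper H.stable)) :=
    DoubleTrans.ofThin HE.thin (𝟙 (𝟭 D.Obj)) fun m => HE.cellOver_globular_iff.2 fun X a b h =>
      (hpro _ _ _).1 ((hrel _ _ _).1 h)
  let ε' : DoubleTrans (DoubleFunctor.id (F.RelDbl H.proper H.stable)) (Ψ.comp Φ) :=
    DoubleTrans.ofThin HE.thin (𝟙 (𝟭 D.Obj)) fun m => HE.cellOver_globular_iff.2 fun X a b h =>
      (hrel _ _ _).2 ((hpro _ _ _).2 h)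
  exact ⟨Φ, Ψ, η, ε,
    DoubleTrans.isInvertible_of_thin H.thin η η' fun A => ⟨Category.comp_id _, Category.comp_id _⟩,
    DoubleTrans.isInvertible_of_thin HE.thin ε ε' fun A => ⟨Category.comp_id _, Category.comp_id _⟩⟩

end PseudoDoubleCategory.IsRelational

/-! ### Universal cells in thin double categories -/

namespace PseudoDoubleCategory

variable {D : PseudoDoubleCategory.{u, v, w, z}}

/-- Thinness supplies uniqueness and the equation for the composite, so only the existence of a cell
over the new boundary remains. -/
theorem IsThin.isOpcartesianCell_iff (hD : D.IsThin) {A B A' B' : D.Obj} {m : D.Pro A B}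
    {n : D.Pro A' B'} (θ : D.Cell m n) : IsOpcartesianCell θ ↔
      ∀ ⦃X Y : D.Obj⦄ ⦃p : D.Pro X Y⦄ (s : A' ⟶ X) (t : B' ⟶ Y),
        CellOver m p (D.src θ ≫ s) (D.tgt θ ≫ t) → CellOver n p s t := by
  constructor
  · rintro h X Y p s t ⟨δ, hδ, hδ'⟩
    obtain ⟨γ, ⟨h₁, h₂, -⟩, -⟩ := h δ s t hδ hδ'
    exact ⟨γ, h₁, h₂⟩
  · intro h X Y p δ s t hs ht
    obtain ⟨γ, rfl, rfl⟩ := h s t ⟨δ, hs, ht⟩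
    exact ⟨γ, ⟨rfl, rfl, hD _ _ (by simp [hs]) (by simp [ht])⟩, fun γ' hγ => hD _ _ hγ.1 hγ.2.1⟩

theorem IsThin.isCartesianCell_iff (hD : D.IsThin) {A B A' B' : D.Obj} {m : D.Pro A B}
    {n : D.Pro A' B'} (θ : D.Cell m n) : IsCartesianCell θ ↔
      ∀ ⦃X Y : D.Obj⦄ ⦃p : D.Pro X Y⦄ (s : X ⟶ A) (t : Y ⟶ B),
        CellOver p n (s ≫ D.src θ) (t ≫ D.tgt θ) → CellOver p m s t := by
  constructor
  · rintro h X Y p s t ⟨δ, hδ, hδ'⟩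
    obtain ⟨γ, ⟨h₁, h₂, -⟩, -⟩ := h δ s t hδ hδ'
    exact ⟨γ, h₁, h₂⟩
  · intro h X Y p δ s t hs ht
    obtain ⟨γ, rfl, rfl⟩ := h s t ⟨δ, hs, ht⟩
    exact ⟨γ, ⟨rfl, rfl, hD _ _ (by simp [hs]) (by simp [ht])⟩, fun γ' hγ => hD _ _ hγ.1 hγ.2.1⟩

/-- The form in which covers are used: membership descends along `e`. -/
theorem IsThin.isCover_iff (hD : D.IsThin) {A B : D.Obj} (e : A ⟶ B) : IsCover e ↔
    ∀ ⦃X Y : D.Obj⦄ ⦃p : D.Pro X Y⦄ (s : B ⟶ X) (t : B ⟶ Y),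
      Mem p (e ≫ s) (e ≫ t) → Mem p s t := by
  rw [IsCover, hD.isOpcartesianCell_iff]
  simp only [src_unitMap, tgt_unitMap]

theorem IsThin.isInclusion_iff (hD : D.IsThin) {A B : D.Obj} (i : A ⟶ B) : IsInclusion i ↔
    ∀ ⦃X Y : D.Obj⦄ ⦃p : D.Pro X Y⦄ (s : X ⟶ A) (t : Y ⟶ A),
      CellOver p (D.unit B) (s ≫ i) (t ≫ i) → CellOver p (D.unit A) s t := by
  rw [IsInclusion, hD.isCartesianCell_iff]
  simp only [src_unitMap, tgt_unitMap]

/-- The legs `l`, `r` are jointly monic. -/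
def IsJointlyMonic {T A B : D.Obj} (l : T ⟶ A) (r : T ⟶ B) : Prop :=
  ∀ ⦃X : D.Obj⦄ (s t : X ⟶ T), s ≫ l = t ≫ l → s ≫ r = t ≫ r → s = t

/-- The universal property splits: existence of factorizations is tabulation, and their uniqueness
is joint monicity of the legs. -/
theorem IsThin.isTabulator_iff (hD : D.IsThin) {T A B : D.Obj} {m : D.Pro A B}
    (τ : D.Cell (D.unit T) m) :
    IsTabulator τ ↔ Tabulates (D.src τ) (D.tgt τ) m ∧ IsJointlyMonic (D.src τ) (D.tgt τ) := by
  constructor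
  · refine fun h => ⟨fun X a b => ⟨?_, ?_⟩, fun X s t h₁ h₂ => ?_⟩
    · rintro ⟨σ, rfl, rfl⟩
      obtain ⟨t, rfl, -⟩ := h σ
      exact ⟨t, by simp, by simp⟩
    · rintro ⟨t, rfl, rfl⟩
      exact (CellOver.of_cell τ).restrict t
    · exact (h (D.vcomp (D.unitMap t) τ)).unique
        (hD _ _ (by simpa using h₁) (by simpa using h₂)) rfl
  · rintro ⟨h, hm⟩ X σ
    obtain ⟨t, ht, ht'⟩ := (h _ _).1 (CellOver.of_cell σ)
    refine ⟨t, hD _ _ (by simpa using ht) (by simpa using ht'), ?_⟩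
    rintro s rfl
    exact hm _ _ (by simpa using ht.symm) (by simpa using ht'.symm)

theorem pairing_fst {R A B : D.Obj} (f : R ⟶ A) (g : R ⟶ B) {P : BinaryFan A B}
    (hP : IsLimit P) : pairing f g hP ≫ P.fst = f := hP.fac _ ⟨WalkingPair.left⟩

theorem pairing_snd {R A B : D.Obj} (f : R ⟶ A) (g : R ⟶ B) {P : BinaryFan A B}
    (hP : IsLimit P) : pairing f g hP ≫ P.snd = g := hP.fac _ ⟨WalkingPair.right⟩

theorem comp_pairing {X R A B : D.Obj} (t : X ⟶ R) (f : R ⟶ A) (g : R ⟶ B) {P : BinaryFan A B}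
    (hP : IsLimit P) : t ≫ pairing f g hP = pairing (t ≫ f) (t ≫ g) hP :=
  BinaryFan.IsLimit.hom_ext hP
    ((Category.assoc _ _ _).trans ((congrArg (t ≫ ·) (pairing_fst f g hP)).trans
      (pairing_fst (t ≫ f) (t ≫ g) hP).symm))
    ((Category.assoc _ _ _).trans ((congrArg (t ≫ ·) (pairing_snd f g hP)).trans
      (pairing_snd (t ≫ f) (t ≫ g) hP).symm))

theorem mono_pairing_iff {R A B : D.Obj} (f : R ⟶ A) (g : R ⟶ B) {P : BinaryFan A B}
    (hP : IsLimit P) : Mono (pairing f g hP) ↔ IsJointlyMonic f g := by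
  constructor
  · intro h X s t h₁ h₂
    rw [← cancel_mono (pairing f g hP), comp_pairing, comp_pairing, h₁, h₂]
  · refine fun h => ⟨fun s t hst => h s t ?_ ?_⟩
    · have := congrArg (· ≫ P.fst) hst
      simp only [comp_pairing] at this
      exact (pairing_fst _ _ hP).symm.trans (this.trans (pairing_fst _ _ hP))
    · have := congrArg (· ≫ P.snd) hst
      simp only [comp_pairing] at this
      exact (pairing_snd _ _ hP).symm.trans (this.trans (pairing_snd _ _ hP))

theorem isJointlyRight_iff_pairing {F : FactorizationSystem D.Obj} {R A B : D.Obj} (f : R ⟶ A)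
    (g : R ⟶ B) {P : BinaryFan A B} (hP : IsLimit P) :
    F.IsJointlyRight f g ↔ F.M (pairing f g hP) := by
  have h := FactorizationSystem.isJointlyRight_iff (F := F)
    (IsLimit.ofIsoLimit hP (isoBinaryFanMk P)) (pairing f g hP)
  have e₁ := pairing_fst f g hP
  have e₂ := pairing_snd f g hP
  exact (Iff.of_eq (congrArg₂ F.IsJointlyRight e₁ e₂)).symm.trans h

end PseudoDoubleCategory

namespace FactorizationSystem

variable {C : Type u} [Category.{v} C] [HasFiniteLimits C] {F : FactorizationSystem C}

theorem IsJointlyRight.comp {R S A B : C} {l : R ⟶ A} {r : R ⟶ B} (h : F.IsJointlyRight l r)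
    (i : S ⟶ R) (hi : F.M i) : F.IsJointlyRight (i ≫ l) (i ≫ r) := by
  rw [isJointlyRight_iff_prod_lift] at h ⊢
  rw [← prod.comp_lift]
  exact F.comp_M _ _ hi h

/-- Lifting is done componentwise. This makes the product of two relations a relation, as needed for
the right adjoint of the diagonal. -/
theorem IsJointlyRight.prod_map {R A B R' A' B' : C} {l : R ⟶ A} {r : R ⟶ B} {l' : R' ⟶ A'}
    {r' : R' ⟶ B'} (h : F.IsJointlyRight l r) (h' : F.IsJointlyRight l' r') :
    F.IsJointlyRight (prod.map l l') (prod.map r r') := by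
  intro X Y e he s a b ha hb
  obtain ⟨d, ⟨h₁, h₂, h₃⟩, hu⟩ := h e he (s ≫ prod.fst) (a ≫ prod.fst) (b ≫ prod.fst)
    (by simpa using congrArg (· ≫ prod.fst) ha) (by simpa using congrArg (· ≫ prod.fst) hb)
  obtain ⟨d', ⟨h₁', h₂', h₃'⟩, hu'⟩ := h' e he (s ≫ prod.snd) (a ≫ prod.snd) (b ≫ prod.snd)
    (by simpa using congrArg (· ≫ prod.snd) ha) (by simpa using congrArg (· ≫ prod.snd) hb)
  refine ⟨prod.lift d d', ⟨by ext <;> simp [prod.lift_fst, prod.lift_snd, h₁, h₁'],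
    by ext <;> simp [prod.lift_fst, prod.lift_snd, h₂, h₂'],
    by ext <;> simp [prod.lift_fst, prod.lift_snd, h₃, h₃']⟩, ?_⟩
  rintro t ⟨rfl, rfl, rfl⟩
  ext
  · simpa [prod.lift_fst] using hu (t ≫ prod.fst) ⟨by simp, by simp, by simp⟩
  · simpa [prod.lift_snd] using hu' (t ≫ prod.snd) ⟨by simp, by simp, by simp⟩

end FactorizationSystem

/-! ### The conditions of the theorem hold in relational double categories -/

namespace PseudoDoubleCategory.IsRelational

open FactorizationSystem

variable {D : PseudoDoubleCategory.{u, v, w, z}} {F : FactorizationSystem D.Obj}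

/-- A cell between units is an element of a unit, so its source and target agree. -/
theorem isUnitPure (H : D.IsRelational F) : D.IsUnitPure := fun A B θ =>
  ⟨D.src θ, H.thin _ _ (by simp) (by simpa using H.mem_unit (CellOver.of_cell θ))⟩

/-- The companion is the graph of `f` and the conjoint its opposite; properness makes them
relations, and thinness proves the binding equations. -/
theorem isEquipment (H : D.IsRelational F) : D.IsEquipment := by
  intro A B f
  constructor
  · obtain ⟨p, hp⟩ := H.exists_pro (𝟙 A) f (isJointlyRight_graph H.proper f)
    have h : CellOver p (D.unit B) f (𝟙 B) := H.cellOver fun X a b hab => by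
      obtain ⟨t, rfl, rfl⟩ := (hp _ _).1 hab
      exact H.mem_unit_iff.2 (by simp)
    exact ⟨p, ⟨⟨hp.mem.cell, h.cell, by simp, by simp, by simp, by simp,
      H.thin _ _ (by simp) (by simp), H.thin _ _ (by simp) (by simp)⟩⟩⟩
  · obtain ⟨p, hp⟩ := H.exists_pro f (𝟙 A) (isJointlyRight_graph H.proper f).symm
    have h : CellOver p (D.unit B) (𝟙 B) f := H.cellOver fun X a b hab => by
      obtain ⟨t, rfl, rfl⟩ := (hp _ _).1 hab
      exact H.mem_unit_iff.2 (by simp)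
    exact ⟨p, ⟨⟨hp.mem.cell, h.cell, by simp, by simp, by simp, by simp,
      H.thin _ _ (by simp) (by simp), H.thin _ _ (by simp) (by simp)⟩⟩⟩

/-- The unit is equality, and equality after a monomorphism is equality. -/
theorem isInclusion_of_mono (H : D.IsRelational F) {A B : D.Obj} (i : A ⟶ B) [Mono i] :
    IsInclusion i :=
  (H.thin.isInclusion_iff i).2 fun X Y p s t h => H.cellOver fun Z a b hab =>
    H.mem_unit_iff.2 (by
      rw [← cancel_mono i]
      simpa using H.mem_unit (hab.trans h))

theorem hasDiscreteTabulators (H : D.IsRelational F) : D.HasDiscreteTabulators := by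
  intro T A B m τ hτ P hP
  have := (mono_pairing_iff _ _ hP).2 ((H.thin.isTabulator_iff τ).1 hτ).2
  exact H.isInclusion_of_mono _

variable [HasFiniteLimits D.Obj]

/-- Every pair of arrows generates a least proarrow that contains it. -/
theorem exists_image (H : D.IsRelational F) {X A B : D.Obj} (a : X ⟶ A) (b : X ⟶ B) :
    ∃ m : D.Pro A B, Mem m a b ∧ ∀ n : D.Pro A B, Mem n a b → CellOver m n (𝟙 A) (𝟙 B) := by
  obtain ⟨I, e, i, he, hi, hei⟩ := F.exists_fac (prod.lift a b)
  have h₁ : e ≫ i ≫ prod.fst = a := by rw [← Category.assoc, hei, prod.lift_fst]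
  have h₂ : e ≫ i ≫ prod.snd = b := by rw [← Category.assoc, hei, prod.lift_snd]
  obtain ⟨m, hm⟩ := H.exists_pro (i ≫ prod.fst) (i ≫ prod.snd)
    ((isJointlyRight_iff (prodIsProd A B) i).2 hi)
  refine ⟨m, (hm a b).2 ⟨e, h₁, h₂⟩, fun n hn => H.cellOver_globular_iff.2 fun Y c d h => ?_⟩
  obtain ⟨t, rfl, rfl⟩ := (hm c d).1 h
  -- The pair `(a, b)` is the restriction along the `E`-arrow `e` of the legs of the image, so by
  -- locality `n` contains these legs, and with them every element of `m`.
  rw [← h₁, ← h₂] at hn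
  exact (H.mem_of_cover e he hn).restrict t

/-- A local product is tested only by globular cells between parallel proarrows, so an element `(a,
b)` is replaced by the least proarrow that contains it. -/
theorem mem_localProduct_iff (H : D.IsRelational F) {A B : D.Obj} {m n k : D.Pro A B}
    {π₁ : D.Cell k m} {π₂ : D.Cell k n} (h : IsLocalProduct π₁ π₂) {X : D.Obj} (a : X ⟶ A)
    (b : X ⟶ B) : Mem k a b ↔ Mem m a b ∧ Mem n a b := by
  constructor
  · exact fun hk => ⟨hk.trans_globular ⟨π₁, h.globular₁⟩, hk.trans_globular ⟨π₂, h.globular₂⟩⟩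
  · rintro ⟨hm, hn⟩
    obtain ⟨i, hi, hi'⟩ := H.exists_image a b
    obtain ⟨α, hα⟩ := hi' m hm
    obtain ⟨β, hβ⟩ := hi' n hn
    obtain ⟨γ, ⟨hγ, -⟩, -⟩ := h.existsUnique_lift α β hα hβ
    exact hi.trans_globular ⟨γ, hγ⟩

/-- On elements `(b, x)`, both sides say that locally there is an `a` with `f a = b`, `r (b, x)` and
`q (a, x)`. -/
theorem satisfiesFrobenius (H : D.IsRelational F) : D.SatisfiesFrobenius := by
  intro A B X f fl fs hfl hfs r q k π₁ π₂ l κ₁ κ₂ hk hl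
  have h₁ : CellOver k (D.comp fs l) (𝟙 B) (𝟙 X) := H.cellOver_globular_iff.2 fun Y b x hbx => by
    obtain ⟨hr, hq⟩ := (H.mem_localProduct_iff hk b x).1 hbx
    obtain ⟨Z, e, a, he, ha, hax⟩ := (H.mem_comp b x).1 hq
    have hf : e ≫ b = a ≫ f := by simpa using H.mem_unit (ha.trans hfs.cellOver_ε)
    refine (H.mem_comp b x).2 ⟨Z, e, a, he, ha, (H.mem_localProduct_iff hl _ _).2 ⟨?_, hax⟩⟩
    refine CellOver.mem_comp ((hfl.cellOver_η.restrict a).cast (Category.comp_id _) rfl) ?_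
    rw [← hf]
    exact hr.restrict e
  have h₂ : CellOver (D.comp fs l) k (𝟙 B) (𝟙 X) := H.cellOver_globular_iff.2 fun Y b x hbx => by
    obtain ⟨Z, e, a, he, ha, hax⟩ := (H.mem_comp b x).1 hbx
    obtain ⟨hr, hq⟩ := (H.mem_localProduct_iff hl _ _).1 hax
    have hf : e ≫ b = a ≫ f := by simpa using H.mem_unit (ha.trans hfs.cellOver_ε)
    refine (H.mem_localProduct_iff hk b x).2 ⟨?_, (H.mem_comp b x).2 ⟨Z, e, a, he, ha, hq⟩⟩
    -- Membership in `f_! ⊗ r` brings a second cover. Its middle element is forced to be the value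
    -- of `f` at `a`, and locality removes both covers.
    obtain ⟨W, e', b', he', hb', hr'⟩ := (H.mem_comp _ _).1 hr
    have hf' : (e' ≫ a) ≫ f = b' := by simpa using H.mem_unit (hb'.trans hfl.cellOver_ε)
    refine H.mem_of_cover e he (H.mem_of_cover e' he' (hr'.cast ?_ rfl))
    rw [hf, ← hf', Category.assoc]
  obtain ⟨α, hα⟩ := h₁
  obtain ⟨β, hβ⟩ := h₂
  exact ⟨α, β, hα, hβ, H.thin _ _ (by simp [hα.1, hβ.1]) (by simp [hα.2, hβ.2]),
    H.thin _ _ (by simp [hα.1, hβ.1]) (by simp [hα.2, hβ.2])⟩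

/-- Let `i` be the `M`-part of a cover. The proarrow tabulated by `(i, i)` contains `(e, e)`, hence
by descent the diagonal, and this gives a section of the monomorphism `i`. -/
theorem isCover_iff (H : D.IsRelational F) {A B : D.Obj} (e : A ⟶ B) : IsCover e ↔ F.E e := by
  rw [H.thin.isCover_iff]
  refine ⟨fun h => ?_, fun he X Y p s t hst => H.mem_of_cover e he hst⟩
  obtain ⟨I, e', i, he', hi, rfl⟩ := F.exists_fac e
  have := H.proper.mono i hi
  obtain ⟨m, hm⟩ := H.exists_pro (i ≫ 𝟙 B) (i ≫ 𝟙 B)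
    ((isJointlyRight_graph H.proper (𝟙 B)).comp i hi)
  obtain ⟨t, ht, -⟩ := (hm _ _).1 (h (p := m) (𝟙 B) (𝟙 B) ((hm _ _).2 ⟨e', by simp, by simp⟩))
  rw [Category.comp_id] at ht
  have : IsIso i := ⟨t, by rw [← cancel_mono i, Category.assoc, ht]; simp, ht⟩
  exact F.comp_E _ _ he' (F.iso_E i this)

theorem isRightClass_iff (H : D.IsRelational F) {A B : D.Obj} (i : A ⟶ B) :
    IsRightClass i ↔ F.M i := by
  constructor
  · exact fun h => F.mem_M_of_uniqueLifting i fun X Y e he => h.2 e ((H.isCover_iff e).2 he)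
  · intro h
    have := H.proper.mono i h
    exact ⟨H.isInclusion_of_mono i, fun X Y e he => F.orthogonal e i ((H.isCover_iff e).1 he) h⟩

/-- Jointly monic spans with the same elements are isomorphic, so a tabulator inherits joint
rightness from the span in `exists_tabulates`. -/
theorem isTabulator_iff (H : D.IsRelational F) {T A B : D.Obj} {m : D.Pro A B}
    (τ : D.Cell (D.unit T) m) :
    IsTabulator τ ↔ Tabulates (D.src τ) (D.tgt τ) m ∧ F.IsJointlyRight (D.src τ) (D.tgt τ) := by
  rw [H.thin.isTabulator_iff]
  refine and_congr_right fun hτ => ⟨fun hm => ?_, fun h X s t => h.hom_ext H.proper⟩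
  obtain ⟨T', l, r, hlr, hT⟩ := H.exists_tabulates m
  obtain ⟨s, hs, hs'⟩ := (hT _ _).1 hτ.mem
  obtain ⟨t, ht, ht'⟩ := (hτ _ _).1 hT.mem
  let i : T ≅ T' := ⟨s, t, hm _ _ (by simp [ht, hs]) (by simp [ht', hs']),
    hlr.hom_ext H.proper (by simp [ht, hs]) (by simp [ht', hs'])⟩
  have := hlr.of_iso i
  rwa [show i.hom ≫ l = D.src τ from hs, show i.hom ≫ r = D.tgt τ from hs'] at this

theorem hasTabulators (H : D.IsRelational F) : D.HasTabulators := fun A B m => by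
  obtain ⟨T, l, r, hlr, hT⟩ := H.exists_tabulates m
  exact ⟨T, hT.mem.cell, (H.isTabulator_iff _).2 (by simpa using ⟨hT, hlr⟩)⟩

theorem hasStrongTabulators (H : D.IsRelational F) : D.HasStrongTabulators := by
  intro T A B m τ hτ
  refine (H.thin.isOpcartesianCell_iff τ).2 fun X Y p s t h => H.cellOver fun Z a b hab => ?_
  obtain ⟨u, rfl, rfl⟩ := (((H.isTabulator_iff τ).1 hτ).1 a b).1 hab
  simpa using h.restrict u

/-- The cokernel of a relation maps to the proarrow `p` tabulated by that relation, because `p`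
contains its legs. So no new elements appear in the cokernel. -/
theorem relationsAreTabulators (H : D.IsRelational F) : D.RelationsAreTabulators := by
  intro R A B k ξ hξ hR
  have hlr : F.IsJointlyRight (D.src ξ) (D.tgt ξ) := by
    rw [isJointlyRight_iff_pairing _ _ (prodIsProd A B), ← H.isRightClass_iff]
    exact hR (prodIsProd A B)
  obtain ⟨p, hp⟩ := H.exists_pro _ _ hlr
  have hkp : CellOver k p (𝟙 A) (𝟙 B) :=
    (H.thin.isOpcartesianCell_iff ξ).1 hξ _ _ (by simpa using hp.mem)
  refine (H.isTabulator_iff ξ).2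
    ⟨fun X a b => ⟨fun h => (hp a b).1 (h.trans_globular hkp), ?_⟩, hlr⟩
  rintro ⟨t, rfl, rfl⟩
  exact (CellOver.of_cell ξ).restrict t

theorem hasFunctorialTabulators (H : D.IsRelational F) : D.HasFunctorialTabulators := by
  intro A B C T U V p q σ ρ τ hσ hρ hτ Q a b hQ P hP I e i he hi hei
  obtain ⟨hσ, -⟩ := (H.isTabulator_iff σ).1 hσ
  obtain ⟨hρ, -⟩ := (H.isTabulator_iff ρ).1 hρ
  obtain ⟨v, hv, -⟩ := hτ (spanCell σ ρ a b hQ.w)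
  obtain ⟨hτ, hlr⟩ := (H.isTabulator_iff τ).1 hτ
  rw [H.isCover_iff] at he
  rw [H.isRightClass_iff] at hi
  have hv₁ : v ≫ D.src τ = a ≫ D.src σ := by simpa [spanCell] using congrArg D.src hv
  have hv₂ : v ≫ D.tgt τ = b ≫ D.tgt ρ := by simpa [spanCell] using congrArg D.tgt hv
  -- The comparison from `T ×_B U` to `V` is in `E`: its `M`-part `j` tabulates a proarrow `n` that
  -- already contains the composite `p ⊗ q`, so `j` has a section.
  have hvE : F.E v := by
    obtain ⟨J, e', j, he', hj, rfl⟩ := F.exists_fac v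
    have := H.proper.mono j hj
    obtain ⟨n, hn⟩ := H.exists_pro _ _ (hlr.comp j hj)
    have h : CellOver (D.comp p q) n (𝟙 A) (𝟙 C) := H.cellOver_globular_iff.2 fun X x y hxy => by
      obtain ⟨Y, c, z, hc, hz, hz'⟩ := (H.mem_comp x y).1 hxy
      obtain ⟨s, hs, hs'⟩ := (hσ _ _).1 hz
      obtain ⟨t, ht, ht'⟩ := (hρ _ _).1 hz'
      refine H.mem_of_cover c hc ((hn _ _).2 ⟨hQ.lift s t (hs'.trans ht.symm) ≫ e', ?_, ?_⟩)
      · rw [Category.assoc, ← Category.assoc e', hv₁, hQ.lift_fst_assoc, hs]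
      · rw [Category.assoc, ← Category.assoc e', hv₂, hQ.lift_snd_assoc, ht']
    obtain ⟨d, hd, hd'⟩ := (hn _ _).1 (hτ.mem.trans_globular h)
    have hdj : d ≫ j = 𝟙 V := hlr.hom_ext H.proper (by simpa using hd) (by simpa using hd')
    have : IsIso j := ⟨d, by rw [← cancel_mono j, Category.assoc, hdj]; simp, hdj⟩
    exact F.comp_E _ _ he' (F.iso_E j this)
  have hM : F.M (pairing (D.src τ) (D.tgt τ) hP) := (isJointlyRight_iff_pairing _ _ hP).1 hlr
  have hsq : v ≫ pairing (D.src τ) (D.tgt τ) hP = e ≫ i := by rw [hei, comp_pairing, hv₁, hv₂]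
  -- Now `v` and `e` begin two factorizations of the same arrow, and the fillers in both directions
  -- are mutually inverse.
  obtain ⟨γ, ⟨hγ, hγ'⟩, -⟩ := F.orthogonal e _ he hM v i hsq
  obtain ⟨δ, ⟨hδ, hδ'⟩, -⟩ := F.orthogonal v i hvE hi e _ hsq.symm
  have := H.proper.mono _ hM
  have := H.proper.mono _ hi
  refine ⟨γ, by rw [hγ, hv], hγ', δ, ?_, ?_⟩
  · rw [← cancel_mono i, Category.assoc, hδ', hγ', Category.id_comp]
  · rw [← cancel_mono (pairing (D.src τ) (D.tgt τ) hP), Category.assoc, hγ', hδ', Category.id_comp]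

theorem exists_prod (H : D.IsRelational F) {A B A' B' : D.Obj} (m : D.Pro A B) (n : D.Pro A' B') :
    ∃ k : D.Pro (A ⨯ A') (B ⨯ B'), ∀ {X : D.Obj} (a : X ⟶ A ⨯ A') (b : X ⟶ B ⨯ B'), Mem k a b ↔
      Mem m (a ≫ prod.fst) (b ≫ prod.fst) ∧ Mem n (a ≫ prod.snd) (b ≫ prod.snd) := by
  obtain ⟨T, l, r, hlr, hT⟩ := H.exists_tabulates m
  obtain ⟨T', l', r', hlr', hT'⟩ := H.exists_tabulates n
  obtain ⟨k, hk⟩ := H.exists_pro _ _ (hlr.prod_map hlr')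
  refine ⟨k, fun a b => ?_⟩
  rw [hk, hT, hT']
  constructor
  · rintro ⟨t, rfl, rfl⟩
    exact ⟨⟨t ≫ prod.fst, by simp, by simp⟩, ⟨t ≫ prod.snd, by simp, by simp⟩⟩
  · rintro ⟨⟨t, ht₁, ht₂⟩, ⟨t', ht₁', ht₂'⟩⟩
    exact ⟨prod.lift t t', by ext <;> simp [prod.lift_fst, prod.lift_snd, ht₁, ht₁'],
      by ext <;> simp [prod.lift_fst, prod.lift_snd, ht₂, ht₂']⟩

theorem isCartesian (H : D.IsRelational F) : D.IsCartesian := by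
  constructor
  · have hDD : (D.prod D).IsThin := fun A B A' B' m n α β h h' =>
      Prod.ext (H.thin _ _ (congrArg Prod.fst h) (congrArg Prod.fst h'))
        (H.thin _ _ (congrArg Prod.snd h) (congrArg Prod.snd h'))
    have overPair {X Y : (D.prod D).Obj} {X' Y' : (D.prod D).Obj} {m : (D.prod D).Pro X Y}
        {n : (D.prod D).Pro X' Y'} {f : X ⟶ X'} {g : Y ⟶ Y'} (h : CellOver m.1 n.1 f.1 g.1)
        (h' : CellOver m.2 n.2 f.2 g.2) : CellOver m n f g :=
      ⟨(h.cell, h'.cell), Prod.ext h.src_cell h'.src_cell, Prod.ext h.tgt_cell h'.tgt_cell⟩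
    choose pr hpr using @exists_prod D F _ H
    let fnc : (D.prod D).Obj ⥤ D.Obj :=
      { obj := fun X => X.1 ⨯ X.2
        map := fun f => prod.map f.1 f.2
        map_id := fun X => prod.map_id_id
        map_comp := fun f g => (prod.map_map f.1 f.2 g.1 g.2).symm }
    let R : DoubleFunctor (D.prod D) D := DoubleFunctor.ofThin H.thin fnc
      (fun m => pr m.1 m.2)
      (fun α => H.cellOver_iff.2 fun X a b h => by
        obtain ⟨h₁, h₂⟩ := (hpr _ _ _ _).1 h
        refine (hpr _ _ _ _).2 ⟨?_, ?_⟩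
        · exact (h₁.trans (CellOver.of_cell α.1)).cast (by simp [fnc]) (by simp [fnc])
        · exact (h₂.trans (CellOver.of_cell α.2)).cast (by simp [fnc]) (by simp [fnc]))
      (fun A => H.cellOver_globular_iff.2 fun X a b h => by
        obtain rfl := H.mem_unit h
        exact (hpr _ _ _ _).2 ⟨CellOver.unitMap _, CellOver.unitMap _⟩)
      (fun A => H.cellOver_globular_iff.2 fun X a b h => by
        obtain ⟨h₁, h₂⟩ := (hpr _ _ _ _).1 h
        exact H.mem_unit_iff.2 (Limits.prod.hom_ext (H.mem_unit h₁) (H.mem_unit h₂)))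
      (fun m n => H.cellOver_globular_iff.2 fun X a b h => by
        obtain ⟨Y, e, c, he, hc, hc'⟩ := (H.mem_comp _ _).1 h
        obtain ⟨h₁, h₂⟩ := (hpr _ _ _ _).1 hc
        obtain ⟨h₁', h₂'⟩ := (hpr _ _ _ _).1 hc'
        rw [Category.assoc] at h₁ h₂ h₁' h₂'
        exact (hpr _ _ _ _).2 ⟨(H.mem_comp _ _).2 ⟨Y, e, _, he, h₁, h₁'⟩,
          (H.mem_comp _ _).2 ⟨Y, e, _, he, h₂, h₂'⟩⟩)
      (fun m n => H.cellOver_globular_iff.2 fun X a b h => by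
        obtain ⟨h₁, h₂⟩ := (hpr _ _ _ _).1 h
        obtain ⟨Y, e, c, he, hc, hc'⟩ := (H.mem_comp _ _).1 h₁
        obtain ⟨Y', e', d, he', hd, hd'⟩ := (H.mem_comp _ _).1 h₂
        -- The two middle elements live on different covers of `X`; by stability their pullback is a
        -- common refinement.
        refine (H.mem_comp _ _).2 ⟨pullback e e', pullback.fst e e' ≫ e,
          prod.lift (pullback.fst e e' ≫ c) (pullback.snd e e' ≫ d), F.comp_E _ _
            (H.stable _ _ _ _ (IsPullback.of_hasPullback e e') he') he,
          (hpr _ _ _ _).2 ⟨?_, ?_⟩, (hpr _ _ _ _).2 ⟨?_, ?_⟩⟩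
        · exact (hc.restrict (pullback.fst e e')).cast (by simp) (prod.lift_fst _ _).symm
        · exact (hd.restrict (pullback.snd e e')).cast
            (by simp [pullback.condition_assoc]) (prod.lift_snd _ _).symm
        · exact (hc'.restrict (pullback.fst e e')).cast (prod.lift_fst _ _).symm (by simp)
        · exact (hd'.restrict (pullback.snd e e')).cast
            (prod.lift_snd _ _).symm (by simp [pullback.condition_assoc]))
    refine ⟨R, ⟨?_⟩⟩
    have diag_fst {X A : D.Obj} (a : X ⟶ A) : (a ≫ prod.lift (𝟙 A) (𝟙 A)) ≫ prod.fst = a := by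
      rw [Category.assoc, prod.lift_fst, Category.comp_id]
    have diag_snd {X A : D.Obj} (a : X ⟶ A) : (a ≫ prod.lift (𝟙 A) (𝟙 A)) ≫ prod.snd = a := by
      rw [Category.assoc, prod.lift_snd, Category.comp_id]
    let η : DoubleTrans (DoubleFunctor.id D) (D.diagonal.comp R) := DoubleTrans.ofThin H.thin
      { app := fun A => (prod.lift (𝟙 A) (𝟙 A) : A ⟶ A ⨯ A)
        naturality := fun A B f => by
          change f ≫ prod.lift (𝟙 B) (𝟙 B) = prod.lift (𝟙 A) (𝟙 A) ≫ prod.map f f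
          simp }
      fun m => H.cellOver fun X a b h => (hpr _ _ _ _).2
        ⟨h.cast (diag_fst a).symm (diag_fst b).symm, h.cast (diag_snd a).symm (diag_snd b).symm⟩
    let ε : DoubleTrans (R.comp D.diagonal) (DoubleFunctor.id (D.prod D)) :=
      DoubleTrans.ofThin hDD
      { app := fun X => ((prod.fst, prod.snd) : (X.1 ⨯ X.2, X.1 ⨯ X.2) ⟶ (X.1, X.2))
        naturality := fun X Y f => Prod.ext (prod.map_fst f.1 f.2) (prod.map_snd f.1 f.2) }
      fun m => overPair (H.cellOver fun X a b h => ((hpr _ _ _ _).1 h).1)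
        (H.cellOver fun X a b h => ((hpr _ _ _ _).1 h).2)
    have lt : ∀ A : D.Obj, D.diagonal.fnc.map (η.app.app A) ≫ ε.app.app (D.diagonal.fnc.obj A) =
        𝟙 (D.diagonal.fnc.obj A) := fun A =>
      Prod.ext (prod.lift_fst (𝟙 A) (𝟙 A)) (prod.lift_snd (𝟙 A) (𝟙 A))
    have rt : ∀ X : (D.prod D).Obj, η.app.app (R.fnc.obj X) ≫ R.fnc.map (ε.app.app X) =
        𝟙 (R.fnc.obj X) := fun X => by
      change prod.lift (𝟙 (X.1 ⨯ X.2)) (𝟙 (X.1 ⨯ X.2)) ≫ prod.map prod.fst prod.snd =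
        𝟙 (X.1 ⨯ X.2)
      simp
    exact
      { unit := η
        counit := ε
        left_triangle := lt
        left_triangle_cell := fun m => hDD _ _
          (by rw [src_vcomp, DoubleFunctor.src_cell, η.src_capp, ε.src_capp, src_cid]; exact lt _)
          (by rw [tgt_vcomp, DoubleFunctor.tgt_cell, η.tgt_capp, ε.tgt_capp, tgt_cid]; exact lt _)
        right_triangle := rt
        right_triangle_cell := fun m => H.thin _ _
          (by rw [src_vcomp, DoubleFunctor.src_cell, η.src_capp, ε.src_capp, src_cid]; exact rt _)
          (by rw [tgt_vcomp, DoubleFunctor.tgt_cell, η.tgt_capp, ε.tgt_capp, tgt_cid]; exact rt _) }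
  -- The right adjoint picks the terminal object with its unit proarrow.
  · let R : DoubleFunctor terminal D := DoubleFunctor.ofThin H.thin
      ((Functor.const _).obj (⊤_ D.Obj)) (fun _ => D.unit (⊤_ D.Obj)) (fun _ => CellOver.refl _)
      (fun _ => CellOver.refl _) (fun _ => CellOver.refl _) (fun _ _ => CellOver.leftHom _)
      (fun _ _ => CellOver.leftInv _)
    have hT : terminal.IsThin := fun _ _ _ _ _ _ _ _ _ _ => rfl
    refine ⟨R, ⟨?_⟩⟩
    exact
      { unit := DoubleTrans.ofThin H.thin
          { app := fun A => (terminal.from A : A ⟶ ⊤_ D.Obj)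
            naturality := fun A B f =>
              (terminal.hom_ext _ _ : f ≫ terminal.from B = (terminal.from A ≫ 𝟙 (⊤_ D.Obj))) }
          fun m => H.cellOver fun X a b h => H.mem_unit_iff.2 (terminal.hom_ext _ _)
        counit := DoubleTrans.ofThin hT
          { app := fun X => 𝟙 X
            naturality := fun X Y f => terminal_hom_ext _ _ }
          fun m => ⟨⟨⟩, terminal_hom_ext _ _, terminal_hom_ext _ _⟩
        left_triangle := fun A => terminal_hom_ext _ _
        left_triangle_cell := fun m => rfl
        right_triangle := fun X => (terminal.hom_ext _ _ : _ = 𝟙 (⊤_ D.Obj))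
        right_triangle_cell := fun m => H.thin _ _ (terminal.hom_ext _ _) (terminal.hom_ext _ _) }

end PseudoDoubleCategory.IsRelational

/-! ### Transport along equivalences -/

namespace FactorizationSystem

variable {C : Type u₁} [Category.{v₁} C] {K : Type u₂} [Category.{v₂} K]

/-- The inverse image of a factorization system under an equivalence of categories. -/
def inverseImage (F : FactorizationSystem K) (G : C ⥤ K) [G.IsEquivalence] :
    FactorizationSystem C where
  E := F.E.inverseImage G
  M := F.M.inverseImage G
  iso_E f hf := F.iso_E (G.map f) inferInstance
  iso_M f hf := F.iso_M (G.map f) inferInstance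
  comp_E f g hf hg := by
    change F.E (G.map (f ≫ g))
    rw [G.map_comp]
    exact F.comp_E _ _ hf hg
  comp_M f g hf hg := by
    change F.M (G.map (f ≫ g))
    rw [G.map_comp]
    exact F.comp_M _ _ hf hg
  exists_fac f := by
    obtain ⟨I, e, m, he, hm, hem⟩ := F.exists_fac (G.map f)
    let i := G.objObjPreimageIso I
    refine ⟨G.objPreimage I, G.preimage (e ≫ i.inv), G.preimage (i.hom ≫ m), ?_, ?_,
      G.map_injective (by simpa using hem)⟩
    · change F.E (G.map _)
      rw [G.map_preimage]
      exact F.comp_E _ _ he (F.iso_E _ inferInstance)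
    · change F.M (G.map _)
      rw [G.map_preimage]
      exact F.comp_M _ _ (F.iso_M _ inferInstance) hm
  orthogonal e m he hm s t hst := by
    obtain ⟨d, ⟨h₁, h₂⟩, hu⟩ := F.orthogonal (G.map e) (G.map m) he hm (G.map s) (G.map t)
      (by rw [← G.map_comp, hst, G.map_comp])
    refine ⟨G.preimage d, ⟨G.map_injective (by simpa using h₁),
      G.map_injective (by simpa using h₂)⟩, ?_⟩
    rintro d' ⟨rfl, rfl⟩
    exact G.map_injective (by simpa using hu (G.map d') ⟨by simp, by simp⟩)

variable (F : FactorizationSystem K) (G : C ⥤ K) [G.IsEquivalence]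

theorem IsProper.inverseImage (hF : F.IsProper) : (F.inverseImage G).IsProper where
  epi e he := by
    have := hF.epi (G.map e) he
    exact G.epi_of_epi_map this
  mono m hm := by
    have := hF.mono (G.map m) hm
    exact G.mono_of_mono_map this

theorem IsStable.inverseImage (hs : F.IsStable) : (F.inverseImage G).IsStable :=
  fun _ _ _ _ _ _ _ _ h he => hs _ _ _ _ (h.map G) he

theorem isJointlyRight_inverseImage_iff [HasFiniteLimits C] {R A B : C} (l : R ⟶ A) (r : R ⟶ B) :
    (F.inverseImage G).IsJointlyRight l r ↔ F.IsJointlyRight (G.map l) (G.map r) := by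
  rw [isJointlyRight_iff_prod_lift]
  have h := isJointlyRight_iff (F := F)
    (mapIsLimitOfPreservesOfIsLimit G _ _ (prodIsProd A B)) (G.map (prod.lift l r))
  rw [← G.map_comp, ← G.map_comp, prod.lift_fst, prod.lift_snd] at h
  exact h.symm

end FactorizationSystem

namespace PseudoDoubleCategory

/-- In a horizontally invariant double category proarrows can be moved along isomorphisms. -/
theorem IsHorizontallyInvariant.exists_pro {D : PseudoDoubleCategory.{u, v, w, z}}
    (hD : D.IsHorizontallyInvariant) {A B A' B' : D.Obj} (f : A ≅ A') (g : B ≅ B')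
    (n : D.Pro A' B') :
    ∃ m : D.Pro A B, CellOver m n f.hom g.hom ∧ CellOver n m f.inv g.inv := by
  obtain ⟨p, ⟨cp⟩⟩ := hD f.hom inferInstance
  obtain ⟨q, ⟨cq⟩⟩ := hD g.inv inferInstance
  -- The restriction of `n` along `f` and `g` is `f_! ⊗ n ⊗ g^*`, where the companion of `g⁻¹`
  -- serves as `g^*`.
  refine ⟨D.comp p (D.comp n q), ?_, ?_⟩
  · have h : CellOver q (D.unit B') (𝟙 B') g.hom :=
      (cq.cellOver_ε.trans (CellOver.unitMap g.hom)).cast (by simp) (by simp)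
    exact ((cp.cellOver_ε.hcomp ((CellOver.refl n).hcomp h)).trans_globular
      (CellOver.leftHom _)).trans_globular (CellOver.rightHom _)
  · have h : CellOver (D.unit A') p f.inv (𝟙 A') :=
      (cp.cellOver_η.restrict f.inv).cast (by simp) (by simp)
    exact (CellOver.rightInv _).globular_trans ((CellOver.leftInv _).globular_trans
      (h.hcomp ((CellOver.refl n).hcomp cq.cellOver_η)))

end PseudoDoubleCategory

namespace DoubleFunctor

variable {D : PseudoDoubleCategory.{u₁, v₁, w₁, z₁}} {E : PseudoDoubleCategory.{u₂, v₂, w₂, z₂}}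
  (Φ : DoubleFunctor D E)

theorem cellOver_map {A B A' B' : D.Obj} {m : D.Pro A B} {n : D.Pro A' B'} {f : A ⟶ A'}
    {g : B ⟶ B'} (h : CellOver m n f g) :
    CellOver (Φ.pro m) (Φ.pro n) (Φ.fnc.map f) (Φ.fnc.map g) := by
  obtain ⟨α, rfl, rfl⟩ := h
  exact ⟨Φ.cell α, by simp, by simp⟩

theorem cellOver_unitHom (A : D.Obj) :
    CellOver (E.unit (Φ.fnc.obj A)) (Φ.pro (D.unit A)) (𝟙 _) (𝟙 _) :=
  ⟨Φ.unitHom A, by simp, by simp⟩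

theorem cellOver_unitInv (A : D.Obj) :
    CellOver (Φ.pro (D.unit A)) (E.unit (Φ.fnc.obj A)) (𝟙 _) (𝟙 _) := by
  refine ⟨Φ.unitInv A, ?_, ?_⟩
  · have h := congrArg E.src (Φ.unitHom_inv A)
    rwa [E.src_vcomp, Φ.src_unitHom, E.src_cid, Category.id_comp] at h
  · have h := congrArg E.tgt (Φ.unitHom_inv A)
    rwa [E.tgt_vcomp, Φ.tgt_unitHom, E.tgt_cid, Category.id_comp] at h

theorem cellOver_compHom {A B C : D.Obj} (m : D.Pro A B) (n : D.Pro B C) :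
    CellOver (E.comp (Φ.pro m) (Φ.pro n)) (Φ.pro (D.comp m n)) (𝟙 _) (𝟙 _) :=
  ⟨Φ.compHom m n, by simp, by simp⟩

theorem cellOver_compInv {A B C : D.Obj} (m : D.Pro A B) (n : D.Pro B C) :
    CellOver (Φ.pro (D.comp m n)) (E.comp (Φ.pro m) (Φ.pro n)) (𝟙 _) (𝟙 _) := by
  refine ⟨Φ.compInv m n, ?_, ?_⟩
  · have h := congrArg E.src (Φ.compHom_inv m n)
    rwa [E.src_vcomp, Φ.src_compHom, E.src_cid, Category.id_comp] at h
  · have h := congrArg E.tgt (Φ.compHom_inv m n)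
    rwa [E.tgt_vcomp, Φ.tgt_compHom, E.tgt_cid, Category.id_comp] at h

end DoubleFunctor

theorem DoubleTrans.cellOver {D : PseudoDoubleCategory.{u₁, v₁, w₁, z₁}}
    {E : PseudoDoubleCategory.{u₂, v₂, w₂, z₂}} {F G : DoubleFunctor D E} (σ : DoubleTrans F G)
    {A B : D.Obj} (m : D.Pro A B) : CellOver (F.pro m) (G.pro m) (σ.app.app A) (σ.app.app B) :=
  ⟨σ.capp m, σ.src_capp m, σ.tgt_capp m⟩

namespace PseudoDoubleCategory

/-- A horizontally invariant double category that is equivalent to a relational one is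
relational. -/
theorem IsRelational.of_doubleEquivalent {D : PseudoDoubleCategory.{u₁, v₁, w₁, z₁}}
    {E : PseudoDoubleCategory.{u₂, v₂, w₂, z₂}} (hD : D.IsHorizontallyInvariant)
    (hDE : DoubleEquivalent D E) [HasFiniteLimits E.Obj] {F : FactorizationSystem E.Obj}
    (H : E.IsRelational F) :
    ∃ (_ : HasFiniteLimits D.Obj) (F' : FactorizationSystem D.Obj), D.IsRelational F' := by
  obtain ⟨Φ, Ψ, η, ε, ⟨η', hη, hη'⟩, ⟨ε', hε, -⟩⟩ := hDE
  have : Φ.fnc.IsEquivalence := Functor.IsEquivalence.mk' Ψ.fnc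
    { hom := η.app, inv := η'.app
      hom_inv_id := by ext A; exact (hη A).1
      inv_hom_id := by ext A; exact (hη A).2 }
    { hom := ε.app, inv := ε'.app
      hom_inv_id := by ext A; exact (hε A).1
      inv_hom_id := by ext A; exact (hε A).2 }
  have hlim : HasFiniteLimits D.Obj :=
    ⟨fun J _ _ => Adjunction.hasLimitsOfShape_of_equivalence Φ.fnc⟩
  -- The existence of a cell is reflected by `Φ`: apply `Ψ` and conjugate with `η`.
  have full {A B A' B' : D.Obj} {m : D.Pro A B} {n : D.Pro A' B'} {f : A ⟶ A'} {g : B ⟶ B'}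
      (h : CellOver (Φ.pro m) (Φ.pro n) (Φ.fnc.map f) (Φ.fnc.map g)) : CellOver m n f g := by
    have e {X Y : D.Obj} (k : X ⟶ Y) :
        η.app.app X ≫ Ψ.fnc.map (Φ.fnc.map k) ≫ η'.app.app Y = k := by
      have := η.app.naturality k
      dsimp at this
      rw [← Category.assoc, ← this, Category.assoc]
      exact (congrArg (k ≫ ·) (hη Y).1).trans (Category.comp_id k)
    exact ((η.cellOver m).trans ((Ψ.cellOver_map h).trans (η'.cellOver n))).cast (e f) (e g)
  have mem_iff {A B X : D.Obj} {m : D.Pro A B} {a : X ⟶ A} {b : X ⟶ B} :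
      Mem m a b ↔ Mem (Φ.pro m) (Φ.fnc.map a) (Φ.fnc.map b) :=
    ⟨fun h => (Φ.cellOver_unitHom X).globular_trans (Φ.cellOver_map h),
      fun h => full ((Φ.cellOver_unitInv X).globular_trans h)⟩
  refine ⟨hlim, F.inverseImage Φ.fnc, ?_⟩
  exact
    { proper := H.proper.inverseImage F Φ.fnc
      stable := H.stable.inverseImage F Φ.fnc
      thin := fun A B A' B' m n α β h h' => by
        -- By naturality of `η`, whose components are invertible, a cell is recovered from its
        -- image.
        have e : Φ.cell α = Φ.cell β := H.thin _ _ (by simp [h]) (by simp [h'])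
        have hα := η.naturality α
        have hβ := η.naturality β
        dsimp at hα hβ
        rw [e, ← hβ] at hα
        have := congrArg (D.vcomp · (η'.capp n)) hα
        simpa [D.vcomp_assoc, (hη' n).1] using this
      cellOver := fun {A B A' B' m n f g} h => full (H.cellOver fun X a b hab => by
        -- Elements on the other side have arbitrary domains, so `X` is replaced by an isomorphic
        -- object in the image of `Φ`.
        let i := Φ.fnc.objObjPreimageIso X
        have h₁ : Mem m (Φ.fnc.preimage (i.hom ≫ a)) (Φ.fnc.preimage (i.hom ≫ b)) :=
          mem_iff.2 (by simpa using hab.restrict i.hom)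
        simpa using (mem_iff.1 (h _ _ h₁)).restrict i.inv)
      mem_unit := fun {A X a b} h =>
        Φ.fnc.map_injective (H.mem_unit ((mem_iff.1 h).trans_globular (Φ.cellOver_unitInv A)))
      mem_comp := fun {A B C X m n} a c => by
        constructor
        · intro h
          obtain ⟨Y, e, b, he, hm, hn⟩ := (H.mem_comp _ _).1
            ((mem_iff.1 h).trans_globular (Φ.cellOver_compInv m n))
          let i := Φ.fnc.objObjPreimageIso Y
          refine ⟨Φ.fnc.objPreimage Y, Φ.fnc.preimage (i.hom ≫ e), Φ.fnc.preimage (i.hom ≫ b),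
            ?_, mem_iff.2 ?_, mem_iff.2 ?_⟩
          · change F.E (Φ.fnc.map _)
            rw [Φ.fnc.map_preimage]
            exact F.comp_E _ _ (F.iso_E _ inferInstance) he
          · simpa using hm.restrict i.hom
          · simpa using hn.restrict i.hom
        · rintro ⟨Y, e, b, he, hm, hn⟩
          refine mem_iff.2 (CellOver.trans_globular ?_ (Φ.cellOver_compHom m n))
          exact (H.mem_comp _ _).2 ⟨Φ.fnc.obj Y, Φ.fnc.map e, Φ.fnc.map b, he,
            by simpa using mem_iff.1 hm, by simpa using mem_iff.1 hn⟩
      exists_tabulates := fun {A B} m => by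
        obtain ⟨T, l, r, hlr, hT⟩ := H.exists_tabulates (Φ.pro m)
        let i := Φ.fnc.objObjPreimageIso T
        refine ⟨Φ.fnc.objPreimage T, Φ.fnc.preimage (i.hom ≫ l), Φ.fnc.preimage (i.hom ≫ r), ?_,
          fun X a b => ?_⟩
        · rw [FactorizationSystem.isJointlyRight_inverseImage_iff, Φ.fnc.map_preimage,
            Φ.fnc.map_preimage]
          exact hlr.of_iso i
        · rw [mem_iff, hT]
          constructor
          · rintro ⟨t, ht, ht'⟩
            exact ⟨Φ.fnc.preimage (t ≫ i.inv), Φ.fnc.map_injective (by simpa using ht),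
              Φ.fnc.map_injective (by simpa using ht')⟩
          · rintro ⟨t, rfl, rfl⟩
            exact ⟨Φ.fnc.map t ≫ i.hom, by simp, by simp⟩
      exists_pro := fun {R A B} l r hlr => by
        rw [FactorizationSystem.isJointlyRight_inverseImage_iff] at hlr
        obtain ⟨m', hm'⟩ := H.exists_pro _ _ hlr
        -- The proarrow `Ψ.pro m'` must be moved back from `Ψ (Φ A)` to `A`. Taking for `k` the
        -- preimage of `ε'`, instead of `η`, makes `Φ k` cancel against `ε`; the data of an
        -- equivalence include no triangle identities.
        let k (A : D.Obj) : A ≅ Ψ.fnc.obj (Φ.fnc.obj A) := Φ.fnc.preimageIso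
          ⟨ε'.app.app (Φ.fnc.obj A), ε.app.app (Φ.fnc.obj A), (hε _).2, (hε _).1⟩
        have hk (A : D.Obj) : Φ.fnc.map (k A).hom = ε'.app.app (Φ.fnc.obj A) := by simp [k]
        have hk' (A : D.Obj) : Φ.fnc.map (k A).inv = ε.app.app (Φ.fnc.obj A) := by simp [k]
        obtain ⟨m, hm₁, hm₂⟩ := hD.exists_pro (k A) (k B) (Ψ.pro m')
        have h₁ : CellOver (Φ.pro m) m' (𝟙 _) (𝟙 _) :=
          ((Φ.cellOver_map hm₁).trans (ε.cellOver m')).cast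
            (by rw [hk]; exact (hε _).2) (by rw [hk]; exact (hε _).2)
        have h₂ : CellOver m' (Φ.pro m) (𝟙 _) (𝟙 _) :=
          ((ε'.cellOver m').trans (Φ.cellOver_map hm₂)).cast
            (by rw [hk']; exact (hε _).2) (by rw [hk']; exact (hε _).2)
        refine ⟨m, fun X a b => ?_⟩
        rw [mem_iff]
        constructor
        · intro h
          obtain ⟨t, ht, ht'⟩ := (hm' _ _).1 (h.trans_globular h₁)
          exact ⟨Φ.fnc.preimage t, Φ.fnc.map_injective (by simpa using ht),
            Φ.fnc.map_injective (by simpa using ht')⟩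
        · rintro ⟨t, rfl, rfl⟩
          exact ((hm' _ _).2 ⟨Φ.fnc.map t, by simp, by simp⟩).trans_globular h₂ }

end PseudoDoubleCategory

/-! ### Finite products and thinness -/

/-- The adjunction between the underlying categories of objects and arrows. -/
def DoubleAdjunction.toAdjunction {D : PseudoDoubleCategory.{u₁, v₁, w₁, z₁}}
    {E : PseudoDoubleCategory.{u₂, v₂, w₂, z₂}} {F : DoubleFunctor D E} {G : DoubleFunctor E D}
    (adj : DoubleAdjunction F G) : F.fnc ⊣ G.fnc where
  unit := adj.unit.app
  counit := adj.counit.app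
  left_triangle_components := adj.left_triangle
  right_triangle_components := adj.right_triangle

namespace PseudoDoubleCategory

variable {D : PseudoDoubleCategory.{u, v, w, z}}

/-- The components of the counit at `(A, B)` are the projections. -/
theorem IsCartesian.hasBinaryProducts (h : D.IsCartesian) : HasBinaryProducts D.Obj := by
  obtain ⟨⟨R, ⟨adj⟩⟩, -⟩ := h
  let a : Functor.diag D.Obj ⊣ R.fnc := adj.toAdjunction
  have key (A B : D.Obj) : HasLimit (pair A B) := by
    let c : (R.fnc.obj (A, B), R.fnc.obj (A, B)) ⟶ (A, B) := a.counit.app (A, B)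
    have hc {X : D.Obj} (t : X ⟶ R.fnc.obj (A, B)) :
        (a.homEquiv X (A, B)).symm t = (t ≫ c.1, t ≫ c.2) := a.homEquiv_counit _ _ _
    refine ⟨⟨⟨BinaryFan.mk c.1 c.2, BinaryFan.isLimitMk
      (fun s => a.homEquiv _ _ ((s.fst, s.snd) : (s.pt, s.pt) ⟶ (A, B))) (fun s => ?_) (fun s => ?_)
      (fun s m h₁ h₂ => ?_)⟩⟩⟩
    · have := hc (a.homEquiv _ _ ((s.fst, s.snd) : (s.pt, s.pt) ⟶ (A, B)))
      rw [Equiv.symm_apply_apply] at this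
      exact (congrArg Prod.fst this).symm
    · have := hc (a.homEquiv _ _ ((s.fst, s.snd) : (s.pt, s.pt) ⟶ (A, B)))
      rw [Equiv.symm_apply_apply] at this
      exact (congrArg Prod.snd this).symm
    · apply (a.homEquiv _ _).symm.injective
      rw [Equiv.symm_apply_apply, hc]
      exact Prod.ext h₁ h₂
  exact hasBinaryProducts_of_hasLimit_pair D.Obj

theorem IsCartesian.hasTerminal (h : D.IsCartesian) : HasTerminal D.Obj := by
  obtain ⟨-, ⟨R, ⟨adj⟩⟩⟩ := h
  let a : Functor.star D.Obj ⊣ R.fnc := adj.toAdjunction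
  let T : D.Obj := R.fnc.obj ⟨⟨⟩⟩
  have (X : D.Obj) : Unique (X ⟶ T) :=
    { default := a.homEquiv X ⟨⟨⟩⟩ (𝟙 _)
      uniq := fun f => (a.homEquiv X ⟨⟨⟩⟩).symm.injective (terminal_hom_ext _ _) }
  exact hasTerminal_of_unique T

theorem IsUnitPure.eq_of_mem (hU : D.IsUnitPure) {X A : D.Obj} {a b : X ⟶ A}
    (h : Mem (D.unit A) a b) : a = b := by
  obtain ⟨σ, rfl, rfl⟩ := h
  obtain ⟨f, rfl⟩ := hU σ
  simp

/-- If `s ≫ i = t ≫ i`, the trivial kernel lifts the unit cell of this arrow to a cell between units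
over `(s, t)`, and unit-purity gives `s = t`. -/
theorem IsUnitPure.mono_of_isInclusion (hU : D.IsUnitPure) {A B : D.Obj} {i : A ⟶ B}
    (hi : IsInclusion i) : Mono i := by
  refine ⟨fun {X} s t hst => ?_⟩
  obtain ⟨γ, ⟨hs, ht, -⟩, -⟩ := hi (D.unitMap (s ≫ i)) s t (by simp) (by simp [hst])
  exact hU.eq_of_mem ⟨γ, hs, ht⟩

/-- If tabulators are strong and discrete, then cells are determined by their boundary. -/
theorem isThin_of_hasTabulators [HasBinaryProducts D.Obj] (hU : D.IsUnitPure)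
    (hT : D.HasTabulators) (hS : D.HasStrongTabulators) (hd : D.HasDiscreteTabulators) :
    D.IsThin := by
  -- Cells out of a unit factor through the tabulator, whose legs are jointly monic by discreteness.
  have unit_thin {X A B : D.Obj} {n : D.Pro A B} (α β : D.Cell (D.unit X) n)
      (h : D.src α = D.src β) (h' : D.tgt α = D.tgt β) : α = β := by
    obtain ⟨T, τ, hτ⟩ := hT n
    obtain ⟨s, rfl, -⟩ := hτ α
    obtain ⟨t, rfl, -⟩ := hτ β
    have := hU.mono_of_isInclusion (hd τ hτ (prodIsProd A B))
    rw [(mono_pairing_iff _ _ (prodIsProd A B)).1 this s t (by simpa using h) (by simpa using h')]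
  intro A B A' B' m n α β hs ht
  obtain ⟨T, τ, hτ⟩ := hT m
  -- The tabulating cell is opcartesian and can be cancelled, which reduces the general case to
  -- cells out of a unit.
  exact (hS τ hτ (D.vcomp τ α) (D.src α) (D.tgt α) (by simp) (by simp)).unique ⟨rfl, rfl, rfl⟩
    ⟨hs.symm, ht.symm, unit_thin _ _ (by simp [hs]) (by simp [ht])⟩

/-! ### Pullbacks, images and stable covers from tabulators -/

/-- A thin unit-pure equipment with strong tabulators. -/
structure IsTabular (D : PseudoDoubleCategory.{u, v, w, z}) : Prop where
  thin : D.IsThin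
  unitPure : D.IsUnitPure
  equipment : D.IsEquipment
  tabulators : D.HasTabulators
  strong : D.HasStrongTabulators

namespace IsTabular

theorem mem_unit_iff (H : D.IsTabular) {X A : D.Obj} {a b : X ⟶ A} :
    Mem (D.unit A) a b ↔ a = b :=
  ⟨H.unitPure.eq_of_mem, by rintro rfl; exact CellOver.unitMap a⟩

theorem exists_tabulates (H : D.IsTabular) {A B : D.Obj} (m : D.Pro A B) :
    ∃ (T : D.Obj) (l : T ⟶ A) (r : T ⟶ B), Tabulates l r m ∧ IsJointlyMonic l r := by
  obtain ⟨T, τ, hτ⟩ := H.tabulators m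
  exact ⟨T, _, _, (H.thin.isTabulator_iff τ).1 hτ⟩

/-- By strength, `m` is the extension of the unit of its tabulator, so an implication needs to hold
only at the tabulating element. -/
theorem cellOver_of_mem (H : D.IsTabular) {A B A' B' : D.Obj} {m : D.Pro A B} {n : D.Pro A' B'}
    {f : A ⟶ A'} {g : B ⟶ B'}
    (h : ∀ ⦃X : D.Obj⦄ (a : X ⟶ A) (b : X ⟶ B), Mem m a b → Mem n (a ≫ f) (b ≫ g)) :
    CellOver m n f g := by
  obtain ⟨T, τ, hτ⟩ := H.tabulators m
  exact (H.thin.isOpcartesianCell_iff τ).1 (H.strong τ hτ) f g (h _ _ (CellOver.of_cell τ))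

theorem isInclusion_of_mono (H : D.IsTabular) {A B : D.Obj} (i : A ⟶ B) [Mono i] :
    IsInclusion i :=
  (H.thin.isInclusion_iff i).2 fun X Y p s t h => H.cellOver_of_mem fun Z a b hab =>
    H.mem_unit_iff.2 (by
      rw [← cancel_mono i]
      simpa using H.mem_unit_iff.1 (hab.trans h))

/-- A monomorphism against which covers lift is in the right class. -/
theorem isRightClass_of_mono (H : D.IsTabular) {A B : D.Obj} (i : A ⟶ B) [Mono i]
    (h : ∀ ⦃X Y : D.Obj⦄ (e : X ⟶ Y), IsCover e → ∀ (s : X ⟶ A) (t : Y ⟶ B),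
      s ≫ i = e ≫ t → ∃ d : Y ⟶ A, d ≫ i = t) : IsRightClass i := by
  refine ⟨H.isInclusion_of_mono i, fun X Y e he s t hst => ?_⟩
  obtain ⟨d, rfl⟩ := h e he s t hst
  refine ⟨d, ⟨?_, rfl⟩, fun d' hd' => by rw [← cancel_mono i, hd'.2]⟩
  rw [← cancel_mono i, hst, Category.assoc]

/-- The witness in the middle is `a ≫ f`. It follows that the tabulator of `f_! ⊗ g^*` is the
pullback of `f` and `g`. -/
theorem mem_companion_comp_conjoint_iff (H : D.IsTabular) {A B C X : D.Obj} {f : A ⟶ C} {g : B ⟶ C}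
    {p : D.Pro A C} {q : D.Pro C B} (cp : D.Companion f p) (cq : D.Conjoint g q) (a : X ⟶ A)
    (b : X ⟶ B) : Mem (D.comp p q) a b ↔ a ≫ f = b ≫ g := by
  constructor
  · intro h
    exact H.mem_unit_iff.1 (h.trans ((cp.cellOver_ε.hcomp cq.cellOver_ε).trans_globular
      (CellOver.leftHom _)))
  · intro h
    refine CellOver.mem_comp (b := a ≫ f)
      ((cp.cellOver_η.restrict a).cast (Category.comp_id _) rfl) ?_
    rw [h]
    exact (cq.cellOver_η.restrict b).cast rfl (Category.comp_id _)

theorem hasPullbacks (H : D.IsTabular) : HasPullbacks D.Obj := by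
  have key {A B C : D.Obj} (f : A ⟶ C) (g : B ⟶ C) : HasLimit (cospan f g) := by
    obtain ⟨p, ⟨cp⟩⟩ := (H.equipment f).1
    obtain ⟨q, ⟨cq⟩⟩ := (H.equipment g).2
    obtain ⟨T, l, r, hT, hm⟩ := H.exists_tabulates (D.comp p q)
    have w : l ≫ f = r ≫ g := (H.mem_companion_comp_conjoint_iff cp cq l r).1 hT.mem
    have ex (s : PullbackCone f g) : ∃ t : s.pt ⟶ T, t ≫ l = s.fst ∧ t ≫ r = s.snd :=
      (hT _ _).1 ((H.mem_companion_comp_conjoint_iff cp cq _ _).2 s.condition)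
    choose t ht ht' using ex
    exact ⟨⟨⟨PullbackCone.mk l r w, PullbackCone.IsLimit.mk w t ht ht'
      fun s m h₁ h₂ => hm _ _ (h₁.trans (ht s).symm) (h₂.trans (ht' s).symm)⟩⟩⟩
  exact hasPullbacks_of_hasLimit_cospan D.Obj

/-- The external unit has extensions along arbitrary spans. -/
theorem exists_extension (H : D.IsTabular) {R A B : D.Obj} (l : R ⟶ A) (r : R ⟶ B) :
    ∃ (k : D.Pro A B) (ξ : D.Cell (D.unit R) k),
      D.src ξ = l ∧ D.tgt ξ = r ∧ IsOpcartesianCell ξ := by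
  obtain ⟨p, ⟨cp⟩⟩ := (H.equipment l).2
  obtain ⟨q, ⟨cq⟩⟩ := (H.equipment r).1
  obtain ⟨ξ, hl, hr⟩ : Mem (D.comp p q) l r := CellOver.mem_comp cp.cellOver_η cq.cellOver_η
  refine ⟨_, ξ, hl, hr, (H.thin.isOpcartesianCell_iff ξ).2 fun X Y n s t h => ?_⟩
  rw [hl, hr] at h
  have h₁ : CellOver p (D.unit X) s (l ≫ s) :=
    (cp.cellOver_ε.trans (CellOver.unitMap s)).cast (Category.id_comp _) rfl
  have h₂ : CellOver q (D.unit Y) (r ≫ t) t :=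
    (cq.cellOver_ε.trans (CellOver.unitMap t)).cast rfl (Category.id_comp _)
  -- The extension is `l^* ⊗ r_!`. Inserting a unit in the middle lets the given cell act there
  -- while the outer factors collapse to units.
  exact (((CellOver.refl p).hcomp (CellOver.leftInv q)).globular_trans
    (h₁.hcomp (h.hcomp h₂))).trans_globular
      ((CellOver.leftHom _).globular_trans (CellOver.rightHom _))

theorem mono_of_isRightClass (H : D.IsTabular) {A B : D.Obj} {i : A ⟶ B} (hi : IsRightClass i) :
    Mono i := H.unitPure.mono_of_isInclusion hi.1

theorem isCover_of_isIso (H : D.IsTabular) {A B : D.Obj} (e : A ⟶ B) [IsIso e] : IsCover e :=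
  (H.thin.isCover_iff e).2 fun X Y p s t h => by simpa using h.restrict (inv e)

theorem isCover_comp (H : D.IsTabular) {A B C : D.Obj} {e : A ⟶ B} {e' : B ⟶ C} (he : IsCover e)
    (he' : IsCover e') : IsCover (e ≫ e') := by
  rw [H.thin.isCover_iff] at *
  exact fun X Y p s t h => he' s t (he _ _ (by simpa using h))

/-- Equality is membership in the unit, which descends along covers. -/
theorem epi_of_isCover (H : D.IsTabular) {A B : D.Obj} {e : A ⟶ B} (he : IsCover e) : Epi e :=
  ⟨fun s t h => H.mem_unit_iff.1 ((H.thin.isCover_iff e).1 he s t (H.mem_unit_iff.2 h))⟩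

theorem isRightClass_of_isIso (H : D.IsTabular) {A B : D.Obj} (i : A ⟶ B) [IsIso i] :
    IsRightClass i :=
  H.isRightClass_of_mono i fun X Y e he s t h =>
    ⟨t ≫ inv i, by simp⟩

theorem isRightClass_comp (H : D.IsTabular) {A B C : D.Obj} {i : A ⟶ B} {j : B ⟶ C}
    (hi : IsRightClass i) (hj : IsRightClass j) : IsRightClass (i ≫ j) := by
  have := H.mono_of_isRightClass hi
  have := H.mono_of_isRightClass hj
  refine H.isRightClass_of_mono _ fun X Y e he s t h => ?_
  obtain ⟨d, ⟨hd, rfl⟩, -⟩ := hj.2 e he (s ≫ i) t (by simpa using h)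
  obtain ⟨c, ⟨-, rfl⟩, -⟩ := hi.2 e he s d hd.symm
  exact ⟨c, by simp⟩

/-- The subobject of `I` on which the pair `(s, t)` belongs to `p`. -/
theorem exists_comprehension [HasFiniteLimits D.Obj] (H : D.IsTabular) {I X Y : D.Obj} (s : I ⟶ X)
    (t : I ⟶ Y) (p : D.Pro X Y) : ∃ (J : D.Obj) (j : J ⟶ I), Mono j ∧ Mem p (j ≫ s) (j ≫ t) ∧
      ∀ ⦃Z : D.Obj⦄ (x : Z ⟶ I), Mem p (x ≫ s) (x ≫ t) → ∃ d : Z ⟶ J, d ≫ j = x := by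
  obtain ⟨T, l, r, hT, hm⟩ := H.exists_tabulates p
  have : Mono (prod.lift l r) := ⟨fun a b h => hm a b
    (by simpa [prod.lift_fst] using congrArg (· ≫ prod.fst) h)
    (by simpa [prod.lift_snd] using congrArg (· ≫ prod.snd) h)⟩
  let c := pullback.fst (prod.lift l r) (prod.lift s t)
  let j := pullback.snd (prod.lift l r) (prod.lift s t)
  have hcj : c ≫ prod.lift l r = j ≫ prod.lift s t := pullback.condition
  refine ⟨_, j, inferInstance, (hT _ _).2 ⟨c, ?_, ?_⟩, fun Z x hx => ?_⟩
  · simpa [prod.lift_fst] using congrArg (· ≫ prod.fst) hcj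
  · simpa [prod.lift_snd] using congrArg (· ≫ prod.snd) hcj
  · obtain ⟨d, hd, hd'⟩ := (hT _ _).1 hx
    exact ⟨pullback.lift d x (by ext <;> simp [prod.lift_fst, prod.lift_snd, hd, hd']),
      pullback.lift_snd _ _ _⟩

/-- Every arrow factors as a cover followed by an arrow of the right class. -/
theorem exists_fac [HasFiniteLimits D.Obj] (H : D.IsTabular) (hR : D.RelationsAreTabulators)
    {A B : D.Obj} (f : A ⟶ B) :
    ∃ (I : D.Obj) (e : A ⟶ I) (i : I ⟶ B), IsCover e ∧ IsRightClass i ∧ e ≫ i = f := by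
  -- The terminal object as first endpoint turns subobjects of `B` into proarrows; the image is the
  -- tabulator of the cokernel of `(A ⟶ 1, f)`.
  obtain ⟨m, ξ, hξ₁, hξ₂, hξ⟩ := H.exists_extension (terminal.from A) f
  obtain ⟨I, l, i, hI, hm⟩ := H.exists_tabulates m
  obtain ⟨e, -, hei⟩ := (hI _ _).1 ⟨ξ, hξ₁, hξ₂⟩
  have hi : Mono i := ⟨fun s t h => hm s t (terminal.hom_ext _ _) h⟩
  have lift_i {X Y : D.Obj} (c : X ⟶ Y) (hc : IsCover c) (s : X ⟶ I) (t : Y ⟶ B)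
      (h : s ≫ i = c ≫ t) : ∃ d : Y ⟶ I, d ≫ i = t := by
    have h₁ : Mem m (c ≫ terminal.from Y) (c ≫ t) :=
      (hI.mem.restrict s).cast (terminal.hom_ext _ _) h
    obtain ⟨d, -, hd⟩ := (hI _ _).1 ((H.thin.isCover_iff c).1 hc _ _ h₁)
    exact ⟨d, hd⟩
  refine ⟨I, e, i, (H.thin.isCover_iff e).2 fun X Y p s t hst => ?_,
    H.isRightClass_of_mono i fun X Y c => lift_i c, hei⟩
  -- To show that `e` is a cover, let `J` be the part of `I` where `(s, t)` belongs to `p`. Since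
  -- `e` factors through `J`, it remains to split `j`.
  obtain ⟨J, j, hj, hjp, hJ⟩ := H.exists_comprehension s t p
  obtain ⟨k, ζ, hζ₁, hζ₂, hζ⟩ := H.exists_extension (terminal.from J) (j ≫ i)
  -- Covers lift against `j ≫ i`: lift to `I` with `lift_i`, and then to `J`, because membership in
  -- `p` descends.
  have hrel : IsRelation (D.src ζ) (D.tgt ζ) := by
    intro P hP
    have hmono : Mono (pairing (D.src ζ) (D.tgt ζ) hP) := by
      rw [mono_pairing_iff, hζ₁, hζ₂]
      exact fun Z x y _ h => (cancel_mono (j ≫ i)).1 h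
    refine H.isRightClass_of_mono _ fun Z W c hc x y hxy => ?_
    obtain ⟨b, hb⟩ : ∃ b : W ⟶ B, b = y ≫ P.snd := ⟨_, rfl⟩
    have h₂ : (x ≫ j) ≫ i = c ≫ b := by
      have h₃ : x ≫ D.tgt ζ = c ≫ b :=
        (congrArg (x ≫ ·) (pairing_snd _ _ hP)).symm.trans ((Category.assoc _ _ _).symm.trans
          ((congrArg (· ≫ P.snd) hxy).trans ((Category.assoc _ _ _).trans
            (congrArg (c ≫ ·) hb.symm))))
      rw [Category.assoc, ← hζ₂, h₃]
    obtain ⟨d, hd⟩ := lift_i c hc (x ≫ j) _ h₂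
    have hcd : x ≫ j = c ≫ d := by rw [← cancel_mono i, h₂, Category.assoc, hd]
    have h₅ : Mem p (c ≫ d ≫ s) (c ≫ d ≫ t) := by
      rw [← Category.assoc, ← Category.assoc c, ← hcd, Category.assoc, Category.assoc]
      exact hjp.restrict x
    obtain ⟨d', hd'⟩ := hJ d ((H.thin.isCover_iff c).1 hc _ _ h₅)
    refine ⟨d', BinaryFan.IsLimit.hom_ext hP ?_ ?_⟩
    · have : ∀ a b : W ⟶ ⊤_ D.Obj, a = b := fun a b => terminal.hom_ext a b
      exact this _ _
    · refine ((Category.assoc _ _ _).trans (congrArg (d' ≫ ·) (pairing_snd _ _ hP))).trans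
        (Eq.trans ?_ hb)
      rw [hζ₂, ← hd, ← hd', Category.assoc]
      rfl
  have hk := ((H.thin.isTabulator_iff ζ).1 (hR ζ hζ hrel)).1
  rw [hζ₁, hζ₂] at hk
  obtain ⟨d, hd⟩ := hJ e hst
  -- By condition 3 the proarrow `k` is tabulated by `J`. It contains `(A ⟶ 1, f)`, as `e` factors
  -- through `J`, so it receives a cell from `m`; on tabulators this is a section of `j`.
  have hmk : CellOver m k (𝟙 _) (𝟙 B) := by
    refine (H.thin.isOpcartesianCell_iff ξ).1 hξ _ _ ((hk _ _).2 ⟨d, terminal.hom_ext _ _, ?_⟩)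
    rw [hξ₂, Category.comp_id, ← Category.assoc, hd, hei]
  obtain ⟨c, -, hc⟩ := (hk _ _).1 (hI.mem.trans_globular hmk)
  have hcj : c ≫ j = 𝟙 I := by rw [← cancel_mono i, Category.assoc, hc, Category.id_comp]
  have := hjp.restrict c
  rwa [← Category.assoc, ← Category.assoc, hcj, Category.id_comp, Category.id_comp] at this

/-- The factorization system of covers and arrows of the right class. -/
def coverSystem [HasFiniteLimits D.Obj] (H : D.IsTabular) (hR : D.RelationsAreTabulators) :
    FactorizationSystem D.Obj where
  E _ _ e := IsCover e
  M _ _ i := IsRightClass i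
  iso_E f _ := H.isCover_of_isIso f
  iso_M f _ := H.isRightClass_of_isIso f
  comp_E _ _ he he' := H.isCover_comp he he'
  comp_M _ _ hi hj := H.isRightClass_comp hi hj
  exists_fac f := H.exists_fac hR f
  orthogonal e _ he hi := hi.2 e he

/-- Functoriality of tabulators makes covers stable under pullback. -/
theorem isCover_of_isPullback [HasFiniteLimits D.Obj] (H : D.IsTabular)
    (hR : D.RelationsAreTabulators) (hFn : D.HasFunctorialTabulators) {P X Y Z : D.Obj} {e' : P ⟶ X}
    {g' : P ⟶ Y} {g : X ⟶ Z} {e : Y ⟶ Z} (h : IsPullback e' g' g e) (he : IsCover e) :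
    IsCover e' := by
  obtain ⟨el, ⟨cl⟩⟩ := (H.equipment e).1
  obtain ⟨es, ⟨cs⟩⟩ := (H.equipment e).2
  obtain ⟨gs, ⟨cg⟩⟩ := (H.equipment g).2
  -- Functoriality is applied to `e^*`, tabulated by `Y` with legs `(e, 𝟙)`, and `e_! ⊗ g^*`,
  -- tabulated by `P`. The span to be factored then has apex `Y ×_Y P`, which is `P`.
  obtain ⟨σ, hσ₁, hσ₂⟩ : Mem es e (𝟙 Y) := cs.cellOver_η
  have hσ : IsTabulator σ := by
    rw [H.thin.isTabulator_iff, hσ₁, hσ₂]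
    refine ⟨fun W a b => ⟨fun hab => ⟨b, ?_, Category.comp_id b⟩, ?_⟩, fun W s t _ h₂ => by
      simpa using h₂⟩
    · simpa using (H.mem_unit_iff.1 (hab.trans cs.cellOver_ε)).symm
    · rintro ⟨t, rfl, rfl⟩
      exact cs.cellOver_η.restrict t
  obtain ⟨ρ, hρ₁, hρ₂⟩ : Mem (D.comp el gs) g' e' :=
    (H.mem_companion_comp_conjoint_iff cl cg _ _).2 h.w.symm
  have hρ : IsTabulator ρ := by
    rw [H.thin.isTabulator_iff, hρ₁, hρ₂]
    refine ⟨fun W a b => ?_, fun W s t h₁ h₂ => h.hom_ext h₂ h₁⟩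
    rw [H.mem_companion_comp_conjoint_iff cl cg]
    constructor
    · exact fun hab => ⟨h.lift b a hab.symm, h.lift_snd _ _ _, h.lift_fst _ _ _⟩
    · rintro ⟨t, rfl, rfl⟩
      rw [Category.assoc, Category.assoc, h.w]
  obtain ⟨V, τ, hτ⟩ := H.tabulators (D.comp es (D.comp el gs))
  have hQ : IsPullback g' (𝟙 P) (D.tgt σ) (D.src ρ) := by
    rw [hσ₂, hρ₁]
    exact IsPullback.of_id_snd
  obtain ⟨I, c, i, hc, hi, hci⟩ := H.exists_fac hR
    (pairing (g' ≫ D.src σ) (𝟙 P ≫ D.tgt ρ) (prodIsProd Z X))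
  obtain ⟨γ, -, hγ, hγ'⟩ := hFn σ ρ τ hσ hρ hτ g' (𝟙 P) hQ (prodIsProd Z X) c i hc hi hci
  -- As `e` is a cover, there is a globular cell from the unit of `Z` to `e^* ⊗ e_!`, so the element
  -- `(g, 𝟙)` of `g^*` also lies in the triple composite.
  have hV : Mem (D.comp es (D.comp el gs)) g (𝟙 X) := by
    have h₁ : CellOver (D.unit Z) (D.comp es el) (𝟙 Z) (𝟙 Z) :=
      (H.thin.isCover_iff e).1 he _ _ ((CellOver.mem_comp cs.cellOver_η cl.cellOver_η).cast
        (Category.comp_id _).symm (Category.comp_id _).symm)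
    exact (CellOver.mem_comp (CellOver.unitMap g) cg.cellOver_η).trans_globular
      ((h₁.hcomp (CellOver.refl gs)).trans_globular (CellOver.assocHom _ _ _))
  obtain ⟨x, -, hx⟩ := (((H.thin.isTabulator_iff τ).1 hτ).1 _ _).1 hV
  have hi₂ : γ ≫ D.tgt τ = i ≫ prod.snd := by
    rw [← hγ, Category.assoc]
    exact (congrArg (γ ≫ ·) (pairing_snd _ _ (prodIsProd Z X))).symm
  have hx' : (x ≫ inv γ) ≫ i ≫ prod.snd = 𝟙 X := by
    rw [← hi₂, Category.assoc, IsIso.inv_hom_id_assoc, hx]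
  have hc' : c ≫ i ≫ prod.snd = e' := by
    rw [← Category.assoc, hci]
    refine (pairing_snd _ _ (prodIsProd Z X)).trans ?_
    rw [Category.id_comp, hρ₂]
  -- Here `e'` is the cover `c` followed by `i ≫ prod.snd`, which has the section `x ≫ inv γ`:
  -- membership descends along `c` and is then restricted along the section.
  refine (H.thin.isCover_iff e').2 fun W W' n s t hst => ?_
  rw [← hc', Category.assoc, Category.assoc c] at hst
  have hst₂ := ((H.thin.isCover_iff c).1 hc _ _ hst).restrict (x ≫ inv γ)
  rwa [← Category.assoc _ _ s, ← Category.assoc _ _ t, hx', Category.id_comp,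
    Category.id_comp] at hst₂

/-- The double category is relational for the factorization system of covers. -/
theorem isRelational [HasFiniteLimits D.Obj] (H : D.IsTabular) (hR : D.RelationsAreTabulators)
    (hFn : D.HasFunctorialTabulators) : D.IsRelational (H.coverSystem hR) where
  proper := ⟨fun _ he => H.epi_of_isCover he, fun _ hi => H.mono_of_isRightClass hi⟩
  stable _ _ _ _ _ _ _ _ h he := H.isCover_of_isPullback hR hFn h he
  thin := H.thin
  cellOver := H.cellOver_of_mem
  mem_unit := H.mem_unit_iff.1
  mem_comp {A B C X m n} a c := by
    constructor
    · intro h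
      obtain ⟨T, σ, hσ⟩ := H.tabulators m
      obtain ⟨U, ρ, hρ⟩ := H.tabulators n
      obtain ⟨V, τ, hτ⟩ := H.tabulators (D.comp m n)
      have hQ := IsPullback.of_hasPullback (D.tgt σ) (D.src ρ)
      obtain ⟨I, e, i, he, hi, hei⟩ := H.exists_fac hR
        (pairing (pullback.fst (D.tgt σ) (D.src ρ) ≫ D.src σ)
          (pullback.snd (D.tgt σ) (D.src ρ) ≫ D.tgt ρ) (prodIsProd A C))
      obtain ⟨γ, hγ, -, hγ'⟩ := hFn σ ρ τ hσ hρ hτ _ _ hQ (prodIsProd A C) e i he hi hei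
      obtain ⟨x, rfl, rfl⟩ := (((H.thin.isTabulator_iff τ).1 hτ).1 _ _).1 h
      have h₁ : (e ≫ γ) ≫ D.src τ = pullback.fst _ _ ≫ D.src σ := by
        simpa [spanCell] using congrArg D.src hγ
      have h₂ : (e ≫ γ) ≫ D.tgt τ = pullback.snd _ _ ≫ D.tgt ρ := by
        simpa [spanCell] using congrArg D.tgt hγ
      -- By functoriality `e ≫ γ` is a cover from the pullback of `T` and `U` to `V`; pulling it
      -- back along `x` gives the cover of `X` that carries the middle element.
      refine ⟨pullback x (e ≫ γ), pullback.fst _ _,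
        pullback.snd _ _ ≫ pullback.fst _ _ ≫ D.tgt σ,
        H.isCover_of_isPullback hR hFn (IsPullback.of_hasPullback x (e ≫ γ))
          (H.isCover_comp he (H.isCover_of_isIso γ)), ?_, ?_⟩
      · rw [pullback.condition_assoc, h₁]
        simpa using (CellOver.of_cell σ).restrict
          (pullback.snd x (e ≫ γ) ≫ pullback.fst (D.tgt σ) (D.src ρ))
      · rw [pullback.condition_assoc, h₂, pullback.condition]
        simpa using (CellOver.of_cell ρ).restrict
          (pullback.snd x (e ≫ γ) ≫ pullback.snd (D.tgt σ) (D.src ρ))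
    · rintro ⟨Y, e, b, he, hm, hn⟩
      exact (H.thin.isCover_iff e).1 he _ _ (hm.mem_comp hn)
  exists_tabulates m := by
    obtain ⟨T, l, r, hT, hm⟩ := H.exists_tabulates m
    refine ⟨T, l, r, fun X Y e he s a b ha hb => ?_, hT⟩
    -- Tabulators are orthogonal to covers because membership descends along covers.
    obtain ⟨d, rfl, rfl⟩ := (hT _ _).1 ((H.thin.isCover_iff e).1 he a b
      ((hT _ _).2 ⟨s, ha, hb⟩))
    exact ⟨d, ⟨hm _ _ (by simpa using ha.symm) (by simpa using hb.symm), rfl, rfl⟩,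
      fun d' hd' => hm _ _ hd'.2.1 hd'.2.2⟩
  exists_pro l r h := by
    obtain ⟨k, ξ, rfl, rfl, hξ⟩ := H.exists_extension l r
    exact ⟨k, ((H.thin.isTabulator_iff ξ).1
      (hR ξ hξ fun P hP => (isJointlyRight_iff_pairing _ _ hP).1 h)).1⟩

end IsTabular

end PseudoDoubleCategory

/-! ### The characterization theorem -/

theorem mainTheorem1 (D : PseudoDoubleCategory.{u, v, w, z}) (hD : D.IsHorizontallyInvariant) :
    (∃ (C : Type u) (_ : Category.{v} C) (_ : HasFiniteLimits C) (F : FactorizationSystem C)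
        (hF : F.IsProper) (hs : F.IsStable), DoubleEquivalent D (F.RelDbl hF hs)) ↔
      (D.IsUnitPure ∧ D.IsCartesian ∧ D.IsEquipment) ∧
      (D.HasTabulators ∧ D.HasStrongTabulators ∧ D.HasDiscreteTabulators ∧
        D.HasFunctorialTabulators) ∧
      D.RelationsAreTabulators ∧
      D.SatisfiesFrobenius := by
  constructor
  · rintro ⟨C, _, _, F, hF, hs, h⟩
    have : HasFiniteLimits (F.RelDbl hF hs).Obj := inferInstanceAs (HasFiniteLimits C)
    -- The conditions themselves are not transported along the equivalence; being relational is, and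
    -- the conditions are then derived in `D`.
    obtain ⟨_, F', H⟩ := IsRelational.of_doubleEquivalent hD h (F.relDbl_isRelational hF hs)
    exact ⟨⟨H.isUnitPure, H.isCartesian, H.isEquipment⟩, ⟨H.hasTabulators, H.hasStrongTabulators,
      H.hasDiscreteTabulators, H.hasFunctorialTabulators⟩, H.relationsAreTabulators,
      H.satisfiesFrobenius⟩
  · rintro ⟨⟨hU, hC, hE⟩, ⟨hT, hS, hd, hFn⟩, hR, -⟩
    have := hC.hasBinaryProducts
    have := hC.hasTerminal
    -- Binary products come first, since discreteness is used through them to prove thinness, which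
    -- in turn gives pullbacks.
    have H : D.IsTabular := ⟨isThin_of_hasTabulators hU hT hS hd, hU, hE, hT, hS⟩
    have := H.hasPullbacks
    have : HasFiniteLimits D.Obj := hasFiniteLimits_of_hasTerminal_and_pullbacks
    have H' := H.isRelational hR hFn
    exact ⟨D.Obj, inferInstance, inferInstance, H.coverSystem hR, H'.proper, H'.stable,
      H'.doubleEquivalent⟩
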